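/- Theorem 3.1 (fractional Liouville reduction). Let $s\in(0,1)$, let $n\ge 1$ with $2s<n$, put $p=n/(2s)\in(1,\infty)$, let $\Omega\subset\mathbb R^n$ be open and $\Omega_e=\mathbb R^n\setminus\overline\Omega$. For $k\ge 0$ and $1<r<\infty$ let $W^{k,r}=W^{k,r}(\mathbb R^n)=\{f\in L^r:\mathcal F^{-1}((1+|\xi|^2)^{k/2}\hat f)\in L^r\}$ with its usual norm, let $W^{k,r}_c(\Omega)$ be the closure of $C_c^\infty(\Omega)$ in $W^{k,r}$, and let $H^s=W^{s,2}$ and $H^s(\Omega_e)=\{v|_{\Omega_e}:v\in H^s\}$. Let $H^{-s}$ be the dual of $H^s$ with respect to the bilinear pairing $\langle T,\varphi\rangle=\int T\varphi\,dx$, and for a function $a$ that is a multiplier on $H^s$ define $aT\in H^{-s}$ by $\langle aT,\varphi\rangle=\langle T,a\varphi\rangle$. Functions in these spaces may be complex valued. The operator $(-\Delta)^s$ is the one with Fourier symbol $|\xi|^{2s}$ (for $\hat u(\xi)=\int e^{-ix\cdot\xi}u(x)\,dx$), acting $H^s\to H^{-s}$ and $W^{2s,p}\to L^{p}$. With $\mathcal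 C_{n,s}=\frac{4^s\Gamma(n/2+s)}{\pi^{n/2}|\Gamma(-s)|}$, the fractional gradient of $u\in H^s$ is $$\nabla^s u(x,y)=-\frac{\mathcal C_{n,s}^{1/2}}{\sqrt2}\,\frac{u(y)-u(x)}{|y-x|^{n/2+s+1}}\,(y-x),$$ and the fractional divergence $(\nabla\cdot)^s:L^2(\mathbb R^{2n};\mathbb C^n)\to H^{-s}$ is given by $\langle(\nabla\cdot)^sV,\varphi\rangle=\int_{\mathbb R^{2n}}V\cdot\nabla^s\varphi\,dx\,dy$ for $\varphi\in H^s$. Let $\gamma:\mathbb R^n\to\mathbb R$ be measurable with $0<\underline\gamma\le\gamma(x)\le\overline\gamma<\infty$ for a.e. $x$, for some constants $\underline\gamma,\overline\gamma$, and suppose that $m:=\gamma^{1/2}-1\in W^{2s,n/2s}_c(\Omega)$. Put $\Theta(x,y)=\gamma(x)^{1/2}\gamma(y)^{1/2}\,\mathrm{Id}$, $\mathrm C^s_\gamma u=(\nabla\cdot)^s(\Theta\cdot\nabla^su)$ and $q=-\dfrac{(-\Delta)^sm}{\gamma^{1/2}}$. Then: 1. All terms are well defined: $(-\Delta)^sm\in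 L^{n/2s}$ and is real valued; for every $u\in H^s$ one has $\Theta\cdot\nabla^su\in L^2(\mathbb R^{2n})$, $\mathrm C^s_\gamma u\in H^{-s}$, $\gamma^{1/2}u\in H^s$, $\gamma^{-1/2}u\in H^s$, $q\,u\,\varphi\in L^1$ for all $\varphi\in H^s$, and $((-\Delta)^s+q)u\in H^{-s}$, where $\langle qu,\varphi\rangle=\int qu\varphi\,dx$. 2. Let $u\in H^s$, $g\in H^s(\Omega_e)$, $w=\gamma^{1/2}u$ and $f=\gamma^{1/2}g$. Then $f\in H^s(\Omega_e)$, and $$\begin{cases}\mathrm C^s_\gamma u=0&\text{in }\Omega\\ u=g&\text{in }\Omega_e\end{cases}\quad\Longleftrightarrow\quad\begin{cases}((-\Delta)^s+q)w=0&\text{in }\Omega\\ w=f&\text{in }\Omega_e,\end{cases}$$ where $T=0$ in $\Omega$ means $\langle T,\varphi\rangle=0$ for all $\varphi\in C_c^\infty(\Omega)$. 3. For every $w\in H^s$, $\;\mathrm C^s_\gamma(\gamma^{-1/2}w)=\gamma^{1/2}((-\Delta)^s+q)w\;$ in $H^{-s}$. -/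

import Mathlib

open MeasureTheory FourierTransform TemperedDistribution
open scoped SchwartzMap ENNReal

/-- The Euclidean space `ℝⁿ`. -/
abbrev Rn (n : ℕ) : Type := EuclideanSpace ℝ (Fin n)

noncomputable section

namespace FracCond

variable {n : ℕ}

/-! ### Sobolev spaces

Functions stand for their classes modulo equality almost everywhere, and are complex valued;
the real-valued case is included. -/

/-- `f ∈ W^{k,p}(ℝⁿ)`, the Bessel potential space, for `k ≥ 0` (so that `W^{k,p} ⊆ L^p`). -/
def MemW (k : ℝ) (p : ℝ≥0∞) [Fact (1 ≤ p)] (f : Rn n → ℂ) : Prop :=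
  ∃ hf : MemLp f p volume, MemSobolev k p ((hf.toLp f : Lp ℂ p (volume : Measure (Rn n))) : 𝓢'(Rn n, ℂ))

/-- The norm `‖𝓕⁻¹ (⟨ξ⟩^k 𝓕 f)‖_{L^p}` of `W^{k,p}(ℝⁿ)`, with value `∞` outside of that space.
The infimum is over the at most one `h ∈ L^p` that represents `𝓕⁻¹ (⟨ξ⟩^k 𝓕 f)`. -/
def wNorm (k : ℝ) (p : ℝ≥0∞) [Fact (1 ≤ p)] (f : Rn n → ℂ) : ℝ≥0∞ :=
  ⨅ (hf : MemLp f p volume) (h : Lp ℂ p (volume : Measure (Rn n)))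
    (_ : besselPotential (Rn n) ℂ k
      ((hf.toLp f : Lp ℂ p (volume : Measure (Rn n))) : 𝓢'(Rn n, ℂ)) = (h : 𝓢'(Rn n, ℂ))), ‖h‖ₑ

/-- `φ ∈ C_c^∞(Ω)`; smoothness is part of being a Schwartz function. -/
def IsTest (Ω : Set (Rn n)) (φ : 𝓢(Rn n, ℂ)) : Prop :=
  HasCompactSupport φ ∧ tsupport φ ⊆ Ω

/-- `f ∈ W_c^{k,p}(Ω)`: `f` is a limit, in the norm of `W^{k,p}(ℝⁿ)`, of functions in
`C_c^∞(Ω)`. -/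
def MemWc (k : ℝ) (p : ℝ≥0∞) [Fact (1 ≤ p)] (Ω : Set (Rn n)) (f : Rn n → ℂ) : Prop :=
  MemW k p f ∧ ∀ ε : ℝ≥0∞, 0 < ε → ∃ φ : 𝓢(Rn n, ℂ), IsTest Ω φ ∧
    wNorm k p (fun x => f x - φ x) < ε

/-- `u ∈ H^s(ℝⁿ) = W^{s,2}(ℝⁿ)`. -/
def MemH (s : ℝ) (u : Rn n → ℂ) : Prop := MemW s 2 u

/-- `g ∈ H^s(U) = {v|_U : v ∈ H^s(ℝⁿ)}`; only the values of `g` in `U` matter. -/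
def MemHOn (s : ℝ) (U : Set (Rn n)) (g : Rn n → ℂ) : Prop :=
  ∃ v : Rn n → ℂ, MemH s v ∧ g =ᵐ[volume.restrict U] v

/-- `T ∈ H^{-s}(ℝⁿ)`, the dual of `H^s(ℝⁿ)`: `T` is linear and bounded on `H^s(ℝⁿ)`. (By the bound,
`T φ` depends only on the class of `φ` modulo equality almost everywhere.) The duality is the
bilinear one, `⟨T, φ⟩ = ∫ T φ dx`. -/
def MemHNeg (s : ℝ) (T : (Rn n → ℂ) → ℂ) : Prop :=
  (∀ φ ψ : Rn n → ℂ, MemH s φ → MemH s ψ → T (fun x => φ x + ψ x) = T φ + T ψ) ∧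
  (∀ (c : ℂ) (φ : Rn n → ℂ), MemH s φ → T (fun x => c * φ x) = c * T φ) ∧
  ∃ K : NNReal, ∀ φ : Rn n → ℂ, MemH s φ → ‖T φ‖ₑ ≤ K * wNorm s 2 φ

/-- `T = 0` in `Ω`. -/
def VanishesIn (Ω : Set (Rn n)) (T : (Rn n → ℂ) → ℂ) : Prop :=
  ∀ φ : 𝓢(Rn n, ℂ), IsTest Ω φ → T φ = 0

/-- The product of a real function and a complex function. -/
def mulFun (a : Rn n → ℝ) (u : Rn n → ℂ) : Rn n → ℂ := fun x => (a x : ℂ) * u x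

/-- The product of a function `a` and a distribution `T`: `⟨a T, φ⟩ = ⟨T, a φ⟩`. -/
def mulDual (a : Rn n → ℝ) (T : (Rn n → ℂ) → ℂ) : (Rn n → ℂ) → ℂ :=
  fun φ => T (mulFun a φ)

/-- The exterior domain `ℝⁿ ∖ closure Ω`. -/
def exterior (Ω : Set (Rn n)) : Set (Rn n) := (closure Ω)ᶜ

/-! ### The fractional Laplacian

It is the operator with Fourier symbol `|ξ|^{2s}` for the transform `∫ e^{-i x·ξ} u(x) dx`, hence
with symbol `|2πξ|^{2s}` for Mathlib's transform `∫ e^{-2πi x·ξ} u(x) dx`. -/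

/-- The Fourier symbol of `(-Δ)^s`. -/
def lapSymbol (s : ℝ) (ξ : Rn n) : ℝ := (2 * Real.pi * ‖ξ‖) ^ (2 * s)

/-- `(-Δ)^s φ` for a Schwartz function `φ`. -/
def fracLapSchwartz (s : ℝ) (φ : 𝓢(Rn n, ℂ)) : Rn n → ℂ :=
  𝓕⁻ (fun ξ : Rn n => (lapSymbol s ξ : ℂ) * 𝓕 (φ : Rn n → ℂ) ξ)

/-- The Fourier transform of an `L²` function. -/
def fourierL2 (u : Rn n → ℂ) : Rn n → ℂ := by
  classical
  exact if h : MemLp u 2 volume then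
    ((𝓕 (h.toLp u : Lp ℂ 2 (volume : Measure (Rn n))) : Lp ℂ 2 (volume : Measure (Rn n))) :
      Rn n → ℂ)
  else 0

/-- `(-Δ)^s w ∈ H^{-s}(ℝⁿ)` for `w ∈ H^s(ℝⁿ)`: the distribution with Fourier transform
`|ξ|^{2s} 𝓕 w(ξ)`, written through `⟨T, φ⟩ = ∫ 𝓕 T(ξ) 𝓕 φ(-ξ) dξ`. -/
def fracLapH (s : ℝ) (w : Rn n → ℂ) : (Rn n → ℂ) → ℂ :=
  fun φ => ∫ ξ : Rn n, (lapSymbol s ξ : ℂ) * fourierL2 w ξ * fourierL2 φ (-ξ)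

/-- `L ∈ L^p(ℝⁿ)` is `(-Δ)^s m`, in the sense of distributions, where `m ∈ W^{2s,p}(ℝⁿ)`. -/
def IsFracLap (s : ℝ) (p : ℝ≥0∞) (m L : Rn n → ℝ) : Prop :=
  MemLp L p volume ∧ ∀ φ : 𝓢(Rn n, ℂ),
    Integrable (fun x => (m x : ℂ) * fracLapSchwartz s φ x) volume ∧
    ∫ x, (L x : ℂ) * φ x = ∫ x, (m x : ℂ) * fracLapSchwartz s φ x

/-- The function `(-Δ)^s m ∈ L^p(ℝⁿ)` (unique almost everywhere) for `m ∈ W^{2s,p}(ℝⁿ)`; it is `0` if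
there is no such function. -/
def fracLapW (s : ℝ) (p : ℝ≥0∞) (m : Rn n → ℝ) : Rn n → ℝ := by
  classical
  exact if h : ∃ L, IsFracLap s p m L then h.choose else 0

/-! ### Fractional gradient and divergence -/

/-- The constant `C_{n,s} = 4^s Γ(n/2 + s) / (π^{n/2} |Γ(-s)|)`. -/
def fracConst (n : ℕ) (s : ℝ) : ℝ :=
  (4 : ℝ) ^ s * Real.Gamma ((n : ℝ) / 2 + s) /
    (Real.pi ^ ((n : ℝ) / 2) * |Real.Gamma (-s)|)

/-- The fractional gradient of `u` at the points `x = z.1` and `y = z.2`. -/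
def fracGrad (s : ℝ) (u : Rn n → ℂ) (z : Rn n × Rn n) : EuclideanSpace ℂ (Fin n) :=
  WithLp.toLp 2 fun i =>
    -((Real.sqrt (fracConst n s) / Real.sqrt 2 : ℝ) : ℂ) *
      ((u z.2 - u z.1) / ((‖z.2 - z.1‖ ^ ((n : ℝ) / 2 + s + 1) : ℝ) : ℂ)) *
      ((z.2 i - z.1 i : ℝ) : ℂ)

/-- The fractional divergence of `V ∈ L²(ℝ^{2n})`, the element of `H^{-s}(ℝⁿ)` given by
`⟨(∇·)^s V, φ⟩ = ⟨V, ∇^s φ⟩`. -/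
def fracDiv (s : ℝ) (V : Rn n × Rn n → EuclideanSpace ℂ (Fin n)) : (Rn n → ℂ) → ℂ :=
  fun φ => ∫ z : Rn n × Rn n, ∑ i, V z i * fracGrad s φ z i

/-! ### The conductivity equation and the Schrödinger equation -/

/-- `γ^{1/2}`. -/
def sqrtCond (γ : Rn n → ℝ) : Rn n → ℝ := fun x => Real.sqrt (γ x)

/-- `γ^{-1/2}`. -/
def invSqrtCond (γ : Rn n → ℝ) : Rn n → ℝ := fun x => (Real.sqrt (γ x))⁻¹

/-- `Θ · ∇^s u`, where `Θ(x,y)` is the matrix `γ(x)^{1/2} γ(y)^{1/2} Id`. -/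
def flux (s : ℝ) (γ : Rn n → ℝ) (u : Rn n → ℂ) : Rn n × Rn n → EuclideanSpace ℂ (Fin n) :=
  fun z => ((sqrtCond γ z.1 * sqrtCond γ z.2 : ℝ) : ℂ) • fracGrad s u z

/-- The conductivity operator `C_γ^s u = (∇·)^s (Θ · ∇^s u)`. -/
def condOp (s : ℝ) (γ : Rn n → ℝ) (u : Rn n → ℂ) : (Rn n → ℂ) → ℂ :=
  fracDiv s (flux s γ u)

/-- `m = γ^{1/2} - 1`. -/
def mCond (γ : Rn n → ℝ) : Rn n → ℝ := fun x => sqrtCond γ x - 1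

/-- The potential `q = -(-Δ)^s m / γ^{1/2}`, where `(-Δ)^s m ∈ L^p`. -/
def potential (s : ℝ) (p : ℝ≥0∞) (γ : Rn n → ℝ) : Rn n → ℝ :=
  fun x => -fracLapW s p (mCond γ) x / sqrtCond γ x

/-- The distribution `((-Δ)^s + q) w`. -/
def schrodOp (s : ℝ) (q : Rn n → ℝ) (w : Rn n → ℂ) : (Rn n → ℂ) → ℂ :=
  fun φ => fracLapH s w φ + ∫ x, (q x : ℂ) * w x * φ x

/-- `u` solves `C_γ^s u = 0` in `Ω`, `u = g` in the exterior. -/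
def SolvesCond (s : ℝ) (γ : Rn n → ℝ) (Ω : Set (Rn n)) (u g : Rn n → ℂ) : Prop :=
  VanishesIn Ω (condOp s γ u) ∧ u =ᵐ[volume.restrict (exterior Ω)] g

/-- `w` solves `((-Δ)^s + q) w = 0` in `Ω`, `w = f` in the exterior. -/
def SolvesSchrod (s : ℝ) (q : Rn n → ℝ) (Ω : Set (Rn n)) (w f : Rn n → ℂ) : Prop :=
  VanishesIn Ω (schrodOp s q w) ∧ w =ᵐ[volume.restrict (exterior Ω)] f

end FracCond

end

noncomputable section

namespace FracCond

variable {n : ℕ}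

/-! ### The Fourier transform on `L²` -/

/-! Put a = γ^{1/2}, m = a - 1, W = a u, Ψ = a φ, and write δf for the difference f(x+h) - f(x).
Expanding both sides gives the pointwise identity a(x) a(x+h) δu δφ = δW δΨ - δm δ(W φ). Integrate
it against (C/2) |h|^{-(n+2s)} dh dx, where C is the constant of the fractional gradient. The left
side becomes ⟨C_γ^s u, φ⟩. The first term on the right is the bilinear form of (-Δ)^s, that is
⟨(-Δ)^s W, Ψ⟩. The second is -∫ ((-Δ)^s m) W φ = ∫ q W Ψ, because Ψ = a φ cancels the denominator of
q. Hence ⟨C_γ^s u, φ⟩ = ⟨((-Δ)^s + q)(a u), a φ⟩ for all u, φ in H^s (`condOp_eq_schrodOp`). The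
operator identity and the equivalence of the two problems follow from this.

Four points need proof.

The form of (-Δ)^s. The Lévy–Khintchine formula `lintegral_cos_levy` writes |2πξ|^{2s} as an
integral of 2 - 2cos(2π h·ξ) against |h|^{-(n+2s)} dh. With Plancherel it identifies the Fourier
energy with the Gagliardo seminorm (`lintegral_diff_sq`, `integral_diff_mul_diff`), so that u lies
in H^s exactly when u is in L² and δu is in L² of the jump measure.

The function (-Δ)^s m. The symbol (1+|ξ|²)^s - |ξ|^{2s} is the transform of a probability density, a
mixture of Gaussians. So, up to the factor (2π)^{2s}, (-Δ)^s m is the Bessel potential of order 2s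
of m minus a convolution of m with an L¹ kernel, and both are in L^p (`exists_isFracLap`).

Multiplication by a and 1/a. It suffices that δm · u is in L²(jump) for every u in H^s, by the
product rule for differences. This is an estimate of Caccioppoli type: m is bounded because γ is,
and testing (-Δ)^s m with m|u|² bounds ∫∫ |δm|²|u|² by ‖(-Δ)^s m‖_{n/2s} ‖m‖_∞ ‖u‖²_{2n/(n-2s)} plus
‖m‖_∞² times the seminorm of u. The Sobolev inequality `exists_eLpNorm_sobExp_le` makes this finite.
The computation is legitimate for mollifications of m, with bounds uniform in the mollification
(`exists_eLpNorm_diff_moll_mul_le`). Fatou gives the estimate for m, and weak convergence gives ∫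
((-Δ)^s m) u v = (C/2) ∫∫ δm δ(u v) (`integral_fracLap_mul_mul`).

Test functions. If φ is a test function of Ω, then a φ and φ/a are in H^s with compact support in Ω
but need not be smooth. An H^s limit of test functions, obtained by mollification, shows that
elements of H^{-s} vanishing in Ω also vanish on them (`MemHNeg.eq_zero_of_vanishesIn`). -/

theorem fourierL2_of_memLp {u : Rn n → ℂ} (h : MemLp u 2 volume) :
    fourierL2 u = ((𝓕 (h.toLp u : Lp ℂ 2 (volume : Measure (Rn n))) :
      Lp ℂ 2 (volume : Measure (Rn n))) : Rn n → ℂ) := by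
  rw [fourierL2, dif_pos h]

theorem fourierL2_congr {u v : Rn n → ℂ} (h : u =ᵐ[volume] v) : fourierL2 u = fourierL2 v := by
  by_cases hu : MemLp u 2 volume
  · have hv := (memLp_congr_ae h).1 hu
    rw [fourierL2_of_memLp hu, fourierL2_of_memLp hv, (MemLp.toLp_eq_toLp_iff hu hv).2 h]
  · have hv : ¬ MemLp v 2 volume := fun hv => hu ((memLp_congr_ae h).2 hv)
    rw [fourierL2, fourierL2, dif_neg hu, dif_neg hv]

theorem fourierL2_coe_Lp (f : Lp ℂ 2 (volume : Measure (Rn n))) :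
    fourierL2 (f : Rn n → ℂ) = ((𝓕 f : Lp ℂ 2 (volume : Measure (Rn n))) : Rn n → ℂ) := by
  rw [fourierL2_of_memLp (Lp.memLp f), Lp.toLp_coeFn]

theorem memLp_fourierL2 (u : Rn n → ℂ) : MemLp (fourierL2 u) 2 volume := by
  by_cases hu : MemLp u 2 volume
  · rw [fourierL2_of_memLp hu]; exact Lp.memLp _
  · rw [fourierL2, dif_neg hu]; exact MemLp.zero

theorem aestronglyMeasurable_fourierL2 (u : Rn n → ℂ) :
    AEStronglyMeasurable (fourierL2 u) volume := (memLp_fourierL2 u).1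

theorem eLpNorm_two_sq {α E : Type*} [MeasurableSpace α] [NormedAddCommGroup E] (μ : Measure α)
    (f : α → E) :
    eLpNorm f 2 μ = (∫⁻ x, ‖f x‖ₑ ^ 2 ∂μ) ^ (1 / 2 : ℝ) := by
  rw [eLpNorm_eq_lintegral_rpow_enorm_toReal (by norm_num) (by norm_num)]
  norm_num

theorem memLp_two_iff_lintegral {α E : Type*} [MeasurableSpace α] [NormedAddCommGroup E]
    {μ : Measure α} {f : α → E} (hf : AEStronglyMeasurable f μ) :
    MemLp f 2 μ ↔ ∫⁻ x, ‖f x‖ₑ ^ 2 ∂μ < ∞ := by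
  rw [MemLp, eLpNorm_two_sq, and_iff_right hf]
  simp [ENNReal.rpow_lt_top_iff_of_pos]

theorem lintegral_fourierL2 {u : Rn n → ℂ} (hu : MemLp u 2 volume) :
    ∫⁻ ξ, ‖fourierL2 u ξ‖ₑ ^ 2 = ∫⁻ x, ‖u x‖ₑ ^ 2 := by
  have h1 : eLpNorm (fourierL2 u) 2 volume = eLpNorm u 2 volume := by
    rw [fourierL2_of_memLp hu, ← Lp.enorm_def, ← ofReal_norm, Lp.norm_fourier_eq, ofReal_norm,
      Lp.enorm_toLp]
  rw [eLpNorm_two_sq, eLpNorm_two_sq] at h1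
  exact ENNReal.rpow_left_injective (by norm_num : (1 / 2 : ℝ) ≠ 0) h1

theorem integral_fourierL2_mul_schwartz {u : Rn n → ℂ} (hu : MemLp u 2 volume) (g : 𝓢(Rn n, ℂ)) :
    ∫ ξ, fourierL2 u ξ * g ξ = ∫ x, u x * 𝓕 g x := by
  have h := congrArg (fun T : 𝓢'(Rn n, ℂ) => T g) (Lp.fourier_toTemperedDistribution_eq (hu.toLp u))
  simp only [TemperedDistribution.fourier_apply, Lp.toTemperedDistribution_apply] at h
  rw [fourierL2_of_memLp hu]
  simp only [smul_eq_mul] at h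
  calc _ = _ := by simp_rw [mul_comm _ (g _)]
    _ = _ := h.symm
    _ = _ := by
      refine integral_congr_ae ?_
      filter_upwards [hu.coeFn_toLp] with x hx
      rw [hx, mul_comm]

/-- A function is determined almost everywhere by its integrals against Schwartz functions. -/
theorem ae_eq_of_integral_mul_schwartz {f g : Rn n → ℂ} (hf : LocallyIntegrable f volume)
    (hg : LocallyIntegrable g volume)
    (h : ∀ φ : 𝓢(Rn n, ℂ), HasCompactSupport φ → ∫ x, f x * φ x = ∫ x, g x * φ x) :
    f =ᵐ[volume] g := by
  refine ae_eq_of_integral_contDiff_smul_eq hf hg fun φ hφ hc => ?_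
  have hc' : HasCompactSupport (fun x => (φ x : ℂ)) :=
    hc.comp_left (g := ((↑) : ℝ → ℂ)) Complex.ofReal_zero
  have hφ' : ContDiff ℝ (⊤ : ℕ∞) (fun x => (φ x : ℂ)) := Complex.ofRealCLM.contDiff.comp hφ
  have := h (hc'.toSchwartzMap hφ') hc'
  simpa [mul_comm] using this

theorem _root_.MeasureTheory.MemLp.locallyIntegrable_two {f : Rn n → ℂ} (hf : MemLp f 2 volume) :
    LocallyIntegrable f volume := hf.locallyIntegrable (by norm_num)

theorem fourierL2_ae_eq {u U : Rn n → ℂ} (hu : MemLp u 2 volume) (hU : LocallyIntegrable U volume)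
    (h : ∀ φ : 𝓢(Rn n, ℂ), ∫ ξ, U ξ * φ ξ = ∫ x, u x * 𝓕 φ x) : fourierL2 u =ᵐ[volume] U :=
  ae_eq_of_integral_mul_schwartz (memLp_fourierL2 u).locallyIntegrable_two hU fun φ _ => by
    rw [integral_fourierL2_mul_schwartz hu, h]

theorem fourierL2_add {u v : Rn n → ℂ} (hu : MemLp u 2 volume) (hv : MemLp v 2 volume) :
    fourierL2 (fun x => u x + v x) =ᵐ[volume] fun ξ => fourierL2 u ξ + fourierL2 v ξ := by
  change fourierL2 (u + v) =ᵐ[volume] _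
  rw [fourierL2_of_memLp hu, fourierL2_of_memLp hv, fourierL2_of_memLp (hu.add hv),
    MemLp.toLp_add, FourierTransform.fourier_add]
  exact Lp.coeFn_add _ _

theorem fourierL2_const_mul {u : Rn n → ℂ} (c : ℂ) (hu : MemLp u 2 volume) :
    fourierL2 (fun x => c * u x) =ᵐ[volume] fun ξ => c * fourierL2 u ξ := by
  change fourierL2 (c • u) =ᵐ[volume] _
  rw [fourierL2_of_memLp hu, fourierL2_of_memLp (hu.const_smul c),
    MemLp.toLp_const_smul, FourierTransform.fourier_smul]
  exact Lp.coeFn_smul _ _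

theorem fourierL2_sub {u v : Rn n → ℂ} (hu : MemLp u 2 volume) (hv : MemLp v 2 volume) :
    fourierL2 (fun x => u x - v x) =ᵐ[volume] fun ξ => fourierL2 u ξ - fourierL2 v ξ := by
  have h1 := fourierL2_const_mul (-1) hv
  have h2 := fourierL2_add hu (hv.const_mul (-1))
  simp only [neg_mul, one_mul, ← sub_eq_add_neg] at h1 h2
  filter_upwards [h1, h2] with ξ h1 h2
  rw [h2, h1, sub_eq_add_neg]

theorem integral_fourier_mul_of_integrable {f g : Rn n → ℂ} (hf : Integrable f) (hg : Integrable g) :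
    ∫ ξ, 𝓕 f ξ * g ξ = ∫ x, f x * 𝓕 g x := by
  simpa using! VectorFourier.integral_fourierIntegral_smul_eq_flip (L := innerₗ (Rn n))
    Real.continuous_fourierChar continuous_inner hf hg

theorem continuous_fourier {f : Rn n → ℂ} (hf : Integrable f) : Continuous (𝓕 f) :=
  VectorFourier.fourierIntegral_continuous Real.continuous_fourierChar continuous_inner hf

theorem fourierL2_eq_fourier {u : Rn n → ℂ} (h1 : Integrable u) (h2 : MemLp u 2 volume) :
    fourierL2 u =ᵐ[volume] 𝓕 u := by
  refine fourierL2_ae_eq h2 (continuous_fourier h1).locallyIntegrable fun φ => ?_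
  exact integral_fourier_mul_of_integrable h1 φ.integrable

/-- Every `L²` function is a Fourier transform. -/
theorem exists_fourierL2_eq {v : Rn n → ℂ} (hv : MemLp v 2 volume) :
    ∃ w : Rn n → ℂ, MemLp w 2 volume ∧ fourierL2 w =ᵐ[volume] v := by
  refine ⟨(𝓕⁻ (hv.toLp v : Lp ℂ 2 (volume : Measure (Rn n))) : Lp ℂ 2 (volume : Measure (Rn n))),
    Lp.memLp _, ?_⟩
  rw [fourierL2_coe_Lp, FourierTransform.fourier_fourierInv_eq]
  exact hv.coeFn_toLp

/-- A function whose Fourier transform is integrable is bounded by the integral of the latter. -/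
theorem ae_enorm_le_of_fourierL2 {u v : Rn n → ℂ} (hu : MemLp u 2 volume)
    (huv : fourierL2 u =ᵐ[volume] v) (hv : Integrable v) :
    ∀ᵐ x, ‖u x‖ₑ ≤ ∫⁻ ξ, ‖v ξ‖ₑ := by
  have key : u =ᵐ[volume] 𝓕⁻ v := by
    have hc : Continuous (𝓕⁻ v) := by
      have := (continuous_fourier hv).comp (continuous_neg (G := Rn n))
      refine this.congr fun x => ?_
      rw [Real.fourierInv_eq_fourier_neg]; rfl
    refine ae_eq_of_integral_mul_schwartz hu.locallyIntegrable_two hc.locallyIntegrable fun φ _ => ?_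
    have e := integral_fourierL2_mul_schwartz hu (𝓕⁻ φ)
    rw [FourierTransform.fourier_fourierInv_eq] at e
    rw [← e]
    have h1 : 𝓕⁻ v = 𝓕 (fun x => v (-x)) := by
      ext x; rw [Real.fourierInv_eq_fourier_comp_neg]
    rw [h1, integral_fourier_mul_of_integrable hv.comp_neg φ.integrable,
      ← integral_neg_eq_self (fun x => v (-x) * 𝓕 (φ : Rn n → ℂ) x)]
    refine integral_congr_ae ?_
    filter_upwards [huv] with x hx
    rw [hx, neg_neg, SchwartzMap.fourierInv_coe, Real.fourierInv_eq_fourier_neg]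
  filter_upwards [key] with x hx
  rw [hx, Real.fourierInv_eq]
  refine (enorm_integral_le_lintegral_enorm _).trans (le_of_eq ?_)
  refine lintegral_congr fun ξ => ?_
  rw [← ofReal_norm, Circle.norm_smul, ofReal_norm]

/-! ### Translations and the bilinear Plancherel formula -/

theorem measurePreserving_add_const (h : Rn n) :
    MeasurePreserving (fun x : Rn n => x + h) volume volume :=
  measurePreserving_add_right volume h

theorem MemLp_comp_add {p : ℝ≥0∞} {E : Type*} [NormedAddCommGroup E] {u : Rn n → E}
    (hu : MemLp u p volume) (h : Rn n) : MemLp (fun x => u (x + h)) p volume :=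
  hu.comp_measurePreserving (measurePreserving_add_const h)

/-- `e^{2πi ⟨x, ξ⟩}`. -/
def wave (x ξ : Rn n) : ℂ := (Real.fourierChar (inner ℝ x ξ) : ℂ)

theorem norm_wave (x ξ : Rn n) : ‖wave x ξ‖ = 1 := Circle.norm_coe _

theorem wave_add (x y ξ : Rn n) : wave (x + y) ξ = wave x ξ * wave y ξ := by
  simp [wave, inner_add_left, AddChar.map_add_eq_mul]

theorem wave_comm (x ξ : Rn n) : wave x ξ = wave ξ x := by simp [wave, real_inner_comm]

theorem wave_neg (x ξ : Rn n) : wave (-x) ξ = wave x (-ξ) := by simp [wave]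

theorem wave_mul_neg (x ξ : Rn n) : wave x ξ * wave x (-ξ) = 1 := by
  rw [← wave_neg, ← wave_add, add_neg_cancel]; simp [wave]

theorem wave_add_neg (x ξ : Rn n) :
    wave x ξ + wave x (-ξ) = ((2 * Real.cos (2 * Real.pi * inner ℝ x ξ) : ℝ) : ℂ) := by
  simp only [wave, Real.fourierChar_apply, inner_neg_right]
  push_cast
  rw [Complex.two_cos]
  congr 2
  all_goals ring_nf

theorem continuous_wave : Continuous fun z : Rn n × Rn n => wave z.1 z.2 := by
  unfold wave
  exact continuous_subtype_val.comp (Real.continuous_fourierChar.comp continuous_inner)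

theorem continuous_wave_right (x : Rn n) : Continuous (wave x) :=
  continuous_wave.comp (Continuous.prodMk_right x)

theorem contDiff_wave (x : Rn n) : ContDiff ℝ (⊤ : ℕ∞) (wave x) := by
  have : wave x = fun ξ => Complex.exp (((2 * Real.pi * inner ℝ x ξ : ℝ) : ℂ) * Complex.I) := by
    ext ξ; rw [wave, Real.fourierChar_apply]
  rw [this]
  refine Complex.contDiff_exp.comp (ContDiff.mul (Complex.ofRealCLM.contDiff.comp ?_) contDiff_const)
  exact contDiff_const.mul (contDiff_const.inner ℝ contDiff_id)

theorem memLp_wave_mul {p : ℝ≥0∞} {v : Rn n → ℂ} (hv : MemLp v p volume) (x : Rn n) :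
    MemLp (fun ξ => wave x ξ * v ξ) p volume := by
  refine MemLp.of_le hv ((continuous_wave_right x).aestronglyMeasurable.mul hv.1)
    (.of_forall fun ξ => ?_)
  rw [norm_mul, norm_wave, one_mul]

theorem fourier_eq_wave (u : Rn n → ℂ) (ξ : Rn n) : 𝓕 u ξ = ∫ x, wave x (-ξ) * u x := by
  rw [Real.fourier_eq]
  simp [wave, Circle.smul_def]

theorem fourierInv_eq_wave (u : Rn n → ℂ) (x : Rn n) : 𝓕⁻ u x = ∫ ξ, wave ξ x * u ξ := by
  rw [Real.fourierInv_eq]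
  simp [wave, Circle.smul_def]

theorem fourierL2_comp_add {u : Rn n → ℂ} (hu : MemLp u 2 volume) (h : Rn n) :
    fourierL2 (fun x => u (x + h)) =ᵐ[volume] fun ξ => wave h ξ * fourierL2 u ξ := by
  have hU : MemLp (fun ξ => wave h ξ * fourierL2 u ξ) 2 volume :=
    memLp_wave_mul (memLp_fourierL2 u) h
  refine ae_eq_of_integral_mul_schwartz (memLp_fourierL2 _).locallyIntegrable_two
    hU.locallyIntegrable_two fun φ hφ => ?_
  rw [integral_fourierL2_mul_schwartz (MemLp_comp_add hu h)]
  -- Testing only with compactly supported φ keeps the product with the plane wave a Schwartz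
  -- function.
  have hc : HasCompactSupport (fun ξ => wave h ξ * φ ξ) := hφ.mul_left
  let ψ : 𝓢(Rn n, ℂ) := hc.toSchwartzMap ((contDiff_wave h).mul (φ.smooth ⊤))
  have hψ (ξ : Rn n) : ψ ξ = wave h ξ * φ ξ := rfl
  have e := integral_fourierL2_mul_schwartz hu ψ
  calc _ = ∫ x, u x * 𝓕 φ (x - h) := by
        rw [← integral_add_right_eq_self (fun x => u x * 𝓕 φ (x - h)) h]; simp
    _ = ∫ x, u x * 𝓕 ψ x := by
        refine integral_congr_ae (.of_forall fun x => ?_)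
        beta_reduce
        rw [SchwartzMap.fourier_coe, SchwartzMap.fourier_coe, fourier_eq_wave, fourier_eq_wave]
        congr 1
        refine integral_congr_ae (.of_forall fun y => ?_)
        beta_reduce
        rw [hψ, wave_comm y, wave_comm y, neg_sub, sub_eq_add_neg, wave_add, ← mul_assoc]
        ring
    _ = _ := by rw [← e]; congr 1; ext ξ; rw [hψ]; ring

/-- The pairing is bilinear, without conjugation, hence the reflection of one frequency. Both sides
are continuous in v for the L² norm, so v may be taken in the Schwartz class, where the identity is
the definition of the distributional transform. -/
theorem integral_mul_eq_integral_fourierL2 {u v : Rn n → ℂ} (hu : MemLp u 2 volume)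
    (hv : MemLp v 2 volume) :
    ∫ x, u x * v x = ∫ ξ, fourierL2 u ξ * fourierL2 v (-ξ) := by
  let B := (ContinuousLinearMap.mul ℂ ℂ).lpPairing (volume : Measure (Rn n)) 2 2
  let neg : Lp ℂ 2 (volume : Measure (Rn n)) →ₗᵢ[ℂ] Lp ℂ 2 (volume : Measure (Rn n)) :=
    Lp.compMeasurePreservingₗᵢ ℂ (fun x : Rn n => -x) (Measure.measurePreserving_neg volume)
  have hneg (f : Lp ℂ 2 (volume : Measure (Rn n))) : neg f =ᵐ[volume] fun x => f (-x) :=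
    Lp.coeFn_compMeasurePreserving _ (Measure.measurePreserving_neg volume)
  have key : ∀ g : Lp ℂ 2 (volume : Measure (Rn n)),
      B (hu.toLp u) g = B (𝓕 (hu.toLp u)) (neg (𝓕 g)) := by
    intro g
    refine DenseRange.induction_on
      (SchwartzMap.denseRange_toLpCLM (F := ℂ) (μ := (volume : Measure (Rn n)))
        (p := 2) ENNReal.ofNat_ne_top) g ?_ ?_
    · exact isClosed_eq (by fun_prop) ((B _).continuous.comp (neg.continuous.comp
        (FourierTransform.fourierCLM ℂ (Lp ℂ 2 (volume : Measure (Rn n)))).continuous))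
    intro φ
    simp only [SchwartzMap.toLpCLM_apply, B, ContinuousLinearMap.lpPairing_eq_integral]
    rw [SchwartzMap.toLp_fourier_eq]
    have e := integral_fourierL2_mul_schwartz hu (𝓕⁻ φ)
    rw [FourierTransform.fourier_fourierInv_eq, fourierL2_of_memLp hu] at e
    calc _ = ∫ x, u x * φ x := by
          refine integral_congr_ae ?_
          filter_upwards [hu.coeFn_toLp, φ.coeFn_toLp 2 volume] with x h1 h2
          rw [h1, h2]; rfl
      _ = _ := by
          rw [← e]
          refine integral_congr_ae ?_
          have h3 := (Measure.measurePreserving_neg (volume : Measure (Rn n))).quasiMeasurePreserving.ae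
            ((𝓕 φ).coeFn_toLp 2 volume)
          filter_upwards [hneg ((𝓕 φ).toLp 2), h3] with x h1 h2
          rw [h1, h2, SchwartzMap.fourierInv_coe, Real.fourierInv_eq_fourier_neg]; rfl
  have := key (hv.toLp v)
  simp only [B, ContinuousLinearMap.lpPairing_eq_integral] at this
  rw [fourierL2_of_memLp hu, fourierL2_of_memLp hv]
  calc _ = _ := by
        refine integral_congr_ae ?_
        filter_upwards [hu.coeFn_toLp, hv.coeFn_toLp] with x h1 h2
        rw [← h1, ← h2]; rfl
    _ = _ := this
    _ = _ := by
        refine integral_congr_ae ?_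
        filter_upwards [hneg (𝓕 (hv.toLp v))] with x h1
        rw [h1]; rfl

/-! ### The spaces `H^s` on the Fourier side -/

/-- The weight `(1 + |ξ|²)^s` of `H^s`. -/
def sobWeight (s : ℝ) (ξ : Rn n) : ℝ := (1 + ‖ξ‖ ^ 2) ^ s

/-- The symbol `(1 + |ξ|²)^{s/2}`. -/
def besselSymbol (s : ℝ) (ξ : Rn n) : ℝ := (1 + ‖ξ‖ ^ 2) ^ (s / 2)

theorem hasTemperateGrowth_besselSymbol (s : ℝ) :
    (fun ξ : Rn n => ((besselSymbol s ξ : ℝ) : ℂ)).HasTemperateGrowth := by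
  unfold besselSymbol
  fun_prop

theorem continuous_besselSymbol (s : ℝ) : Continuous (besselSymbol s : Rn n → ℝ) := by
  unfold besselSymbol
  exact Continuous.rpow_const (by fun_prop) fun ξ => Or.inl (by positivity)

theorem besselSymbol_pos (s : ℝ) (ξ : Rn n) : 0 < besselSymbol s ξ := by
  unfold besselSymbol; positivity

theorem besselSymbol_sq (s : ℝ) (ξ : Rn n) : besselSymbol s ξ ^ 2 = sobWeight s ξ := by
  unfold besselSymbol sobWeight
  rw [← Real.rpow_natCast, ← Real.rpow_mul (by positivity)]
  congr 1
  push_cast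
  ring

/-- The Fourier transform is injective on tempered distributions, and two locally integrable
functions that define the same distribution agree almost everywhere. This carries the definition of
H^s over to the Fourier side. -/
theorem besselPotential_eq_iff (s : ℝ) {u : Rn n → ℂ} (hu : MemLp u 2 volume)
    (f : Lp ℂ 2 (volume : Measure (Rn n))) :
    besselPotential (Rn n) ℂ s ((hu.toLp u : Lp ℂ 2 (volume : Measure (Rn n))) : 𝓢'(Rn n, ℂ)) =
      (f : 𝓢'(Rn n, ℂ)) ↔
    (fun ξ => (besselSymbol s ξ : ℂ) * fourierL2 u ξ) =ᵐ[volume] fourierL2 f := by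
  have hL : besselPotential (Rn n) ℂ s
      ((hu.toLp u : Lp ℂ 2 (volume : Measure (Rn n))) : 𝓢'(Rn n, ℂ)) = (f : 𝓢'(Rn n, ℂ)) ↔
      smulLeftCLM ℂ (fun x ↦ ((besselSymbol s x : ℝ) : ℂ))
        ((𝓕 (hu.toLp u) : Lp ℂ 2 (volume : Measure (Rn n))) : 𝓢'(Rn n, ℂ)) =
        ((𝓕 f : Lp ℂ 2 (volume : Measure (Rn n))) : 𝓢'(Rn n, ℂ)) := by
    rw [← Lp.fourier_toTemperedDistribution_eq, ← Lp.fourier_toTemperedDistribution_eq]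
    unfold besselSymbol
    rw [← fourier_besselPotential_eq_smulLeftCLM_fourier_apply]
    exact ⟨fun h => by rw [h], fun h => by
      have := congrArg (fun T : 𝓢'(Rn n, ℂ) => 𝓕⁻ T) h
      simpa only [FourierTransform.fourierInv_fourier_eq] using this⟩
  rw [hL]
  have hg := hasTemperateGrowth_besselSymbol (n := n) s
  rw [fourierL2_coe_Lp, fourierL2_of_memLp hu]
  set U := (𝓕 (hu.toLp u) : Lp ℂ 2 (volume : Measure (Rn n)))
  set F := (𝓕 f : Lp ℂ 2 (volume : Measure (Rn n)))
  have hint (φ : 𝓢(Rn n, ℂ)) : smulLeftCLM ℂ (fun x ↦ ((besselSymbol s x : ℝ) : ℂ))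
      (U : 𝓢'(Rn n, ℂ)) φ = ∫ ξ, (besselSymbol s ξ * U ξ) * φ ξ := by
    rw [TemperedDistribution.smulLeftCLM_apply_apply, Lp.toTemperedDistribution_apply]
    simp only [SchwartzMap.smulLeftCLM_apply_apply hg, smul_eq_mul]
    congr 1; ext ξ; ring
  constructor
  · intro h
    have hcont : Continuous fun ξ : Rn n => (besselSymbol s ξ : ℂ) :=
      Complex.continuous_ofReal.comp (continuous_besselSymbol s)
    refine ae_eq_of_integral_mul_schwartz ?_ (Lp.memLp F).locallyIntegrable_two fun φ _ => ?_
    · rw [← locallyIntegrableOn_univ]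
      exact (((Lp.memLp U).locallyIntegrable_two).locallyIntegrableOn _).continuousOn_mul
        hcont.continuousOn (isOpen_univ.isLocallyClosed)
    · rw [← hint, h, Lp.toTemperedDistribution_apply]
      simp [mul_comm]
  · intro h
    ext φ
    rw [hint, Lp.toTemperedDistribution_apply]
    refine integral_congr_ae ?_
    filter_upwards [h] with ξ hξ
    rw [hξ, smul_eq_mul, mul_comm]

/-- The square of the `H^s` norm. -/
def sobEnergy (s : ℝ) (u : Rn n → ℂ) : ℝ≥0∞ :=
  ∫⁻ ξ, ENNReal.ofReal (sobWeight s ξ) * ‖fourierL2 u ξ‖ₑ ^ 2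

theorem eLpNorm_bessel_mul (s : ℝ) (u : Rn n → ℂ) :
    eLpNorm (fun ξ => (besselSymbol s ξ : ℂ) * fourierL2 u ξ) 2 volume =
      sobEnergy s u ^ (1 / 2 : ℝ) := by
  rw [eLpNorm_two_sq, sobEnergy]
  congr 1
  refine lintegral_congr fun ξ => ?_
  rw [enorm_mul, mul_pow, ← besselSymbol_sq, ENNReal.ofReal_pow (besselSymbol_pos s ξ).le]
  congr 2
  rw [← ofReal_norm, Complex.norm_real, Real.norm_of_nonneg (besselSymbol_pos s ξ).le]

theorem aestronglyMeasurable_bessel_mul (s : ℝ) (u : Rn n → ℂ) :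
    AEStronglyMeasurable (fun ξ => (besselSymbol s ξ : ℂ) * fourierL2 u ξ) volume :=
  (Complex.continuous_ofReal.comp (continuous_besselSymbol s)).aestronglyMeasurable.mul
    (aestronglyMeasurable_fourierL2 u)

theorem memH_iff (s : ℝ) (u : Rn n → ℂ) :
    MemH s u ↔ MemLp u 2 volume ∧ sobEnergy s u < ∞ := by
  have key : sobEnergy s u < ∞ ↔ MemLp (fun ξ => (besselSymbol s ξ : ℂ) * fourierL2 u ξ) 2 volume := by
    rw [MemLp, eLpNorm_bessel_mul, and_iff_right (aestronglyMeasurable_bessel_mul s u)]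
    simp [ENNReal.rpow_lt_top_iff_of_pos]
  rw [MemH, MemW, key]
  constructor
  · rintro ⟨hu, f, hf⟩
    exact ⟨hu, (memLp_congr_ae ((besselPotential_eq_iff s hu f).1 hf)).2 (memLp_fourierL2 _)⟩
  · rintro ⟨hu, h⟩
    obtain ⟨w, hw, hwe⟩ := exists_fourierL2_eq h
    refine ⟨hu, hw.toLp w, (besselPotential_eq_iff s hu _).2 ?_⟩
    rw [fourierL2_congr hw.coeFn_toLp]
    exact hwe.symm

/-- By Plancherel every candidate in the infimum has this norm. If the energy is infinite there is
no candidate, and the empty infimum is `∞`. -/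
theorem wNorm_two {s : ℝ} {u : Rn n → ℂ} (hu : MemLp u 2 volume) :
    wNorm s 2 u = sobEnergy s u ^ (1 / 2 : ℝ) := by
  have aux (f : Lp ℂ 2 (volume : Measure (Rn n)))
      (hf : (fun ξ => (besselSymbol s ξ : ℂ) * fourierL2 u ξ) =ᵐ[volume] fourierL2 f) :
      ‖f‖ₑ = sobEnergy s u ^ (1 / 2 : ℝ) := by
    rw [← eLpNorm_bessel_mul, eLpNorm_congr_ae hf, eLpNorm_two_sq, lintegral_fourierL2 (Lp.memLp f),
      ← eLpNorm_two_sq, Lp.enorm_def]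
  unfold wNorm
  refine le_antisymm ?_ ?_
  · by_cases h : sobEnergy s u < ∞
    · obtain ⟨hu', f, hf⟩ := (memH_iff s u).2 ⟨hu, h⟩
      exact (iInf_le_of_le hu' (iInf_le_of_le f (iInf_le _ hf))).trans
        (aux f ((besselPotential_eq_iff s hu f).1 hf)).le
    · rw [not_lt_top_iff.1 h]; simp
  · refine le_iInf fun hu' => le_iInf fun f => le_iInf fun hf => ?_
    exact (aux f ((besselPotential_eq_iff s hu f).1 hf)).ge

theorem MemH.memLp {s : ℝ} {u : Rn n → ℂ} (hu : MemH s u) : MemLp u 2 volume := hu.1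

/-- The square of the homogeneous `H^s` seminorm. -/
def energy (s : ℝ) (u : Rn n → ℂ) : ℝ≥0∞ :=
  ∫⁻ ξ, ENNReal.ofReal (lapSymbol s ξ) * ‖fourierL2 u ξ‖ₑ ^ 2

theorem lapSymbol_nonneg (s : ℝ) (ξ : Rn n) : 0 ≤ lapSymbol s ξ := by
  unfold lapSymbol; positivity

theorem measurable_lapSymbol (s : ℝ) : Measurable (lapSymbol s : Rn n → ℝ) := by
  unfold lapSymbol
  exact (measurable_const.mul measurable_norm).pow_const _

theorem continuous_lapSymbol {s : ℝ} (hs : 0 ≤ s) : Continuous (lapSymbol s : Rn n → ℝ) := by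
  unfold lapSymbol
  exact Continuous.rpow_const (by fun_prop) fun ξ => Or.inr (by positivity)

theorem lapSymbol_le {s : ℝ} (hs : 0 ≤ s) (ξ : Rn n) :
    lapSymbol s ξ ≤ (2 * Real.pi) ^ (2 * s) * sobWeight s ξ := by
  unfold lapSymbol sobWeight
  rw [Real.mul_rpow (by positivity) (norm_nonneg _), Real.rpow_mul (norm_nonneg ξ)]
  gcongr
  rw [Real.rpow_two]; linarith

/-- Subadditivity of t ↦ t^s for s ≤ 1. Together with `lapSymbol_le`, it makes the H^s norm
equivalent to the L² norm plus the homogeneous seminorm; the factors 2π appear because only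
`lapSymbol` contains them. -/
theorem sobWeight_le {s : ℝ} (hs : 0 ≤ s) (hs1 : s ≤ 1) (ξ : Rn n) :
    sobWeight s ξ ≤ 1 + lapSymbol s ξ := by
  unfold lapSymbol sobWeight
  refine (Real.rpow_add_le_add_rpow (by norm_num) (by positivity) hs hs1).trans ?_
  rw [Real.one_rpow, ← Real.rpow_two, ← Real.rpow_mul (norm_nonneg _)]
  have : (1 : ℝ) ≤ 2 * Real.pi := by linarith [Real.pi_gt_three]
  gcongr
  nlinarith [norm_nonneg ξ]

theorem energy_le_sobEnergy {s : ℝ} (hs : 0 ≤ s) (u : Rn n → ℂ) :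
    energy s u ≤ ENNReal.ofReal ((2 * Real.pi) ^ (2 * s)) * sobEnergy s u := by
  rw [energy, sobEnergy, ← lintegral_const_mul' _ _ ENNReal.ofReal_ne_top]
  refine lintegral_mono fun ξ => ?_
  rw [← mul_assoc, ← ENNReal.ofReal_mul (by positivity)]
  gcongr
  exact lapSymbol_le hs ξ

theorem sobEnergy_le {s : ℝ} (hs : 0 ≤ s) (hs1 : s ≤ 1) {u : Rn n → ℂ} (hu : MemLp u 2 volume) :
    sobEnergy s u ≤ (∫⁻ x, ‖u x‖ₑ ^ 2) + energy s u := by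
  rw [← lintegral_fourierL2 hu, energy, ← lintegral_add_left'
    ((aestronglyMeasurable_fourierL2 u).enorm.pow_const 2), sobEnergy]
  refine lintegral_mono fun ξ => ?_
  refine (mul_le_mul_left (ENNReal.ofReal_le_ofReal (sobWeight_le hs hs1 ξ)) _).trans ?_
  rw [ENNReal.ofReal_add zero_le_one (lapSymbol_nonneg s ξ), add_mul]
  simp

theorem memH_iff_energy {s : ℝ} (hs : 0 ≤ s) (hs1 : s ≤ 1) (u : Rn n → ℂ) :
    MemH s u ↔ MemLp u 2 volume ∧ energy s u < ∞ := by
  rw [memH_iff]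
  refine and_congr_right fun hu => ⟨fun h => ?_, fun h => ?_⟩
  · exact (energy_le_sobEnergy hs u).trans_lt (ENNReal.mul_lt_top ENNReal.ofReal_lt_top h)
  · refine (sobEnergy_le hs hs1 hu).trans_lt (ENNReal.add_lt_top.2 ⟨?_, h⟩)
    exact (memLp_two_iff_lintegral hu.1).1 hu

/-! ### The Lévy measure of the fractional Laplacian -/

/-- The measure `|h|^{-(n+2s)} dh`. -/
def levy (n : ℕ) (s : ℝ) : Measure (Rn n) :=
  volume.withDensity fun h => ENNReal.ofReal (‖h‖ ^ (-((n : ℝ) + 2 * s)))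

theorem measurable_levy_density (s : ℝ) :
    Measurable fun h : Rn n => ENNReal.ofReal (‖h‖ ^ (-((n : ℝ) + 2 * s))) :=
  (measurable_norm.pow_const _).ennreal_ofReal

instance (s : ℝ) : SigmaFinite (levy n s) := by
  unfold levy
  exact SigmaFinite.withDensity_ofReal _

theorem lintegral_levy (s : ℝ) {f : Rn n → ℝ≥0∞} (hf : AEMeasurable f volume) :
    ∫⁻ h, f h ∂levy n s = ∫⁻ h, ENNReal.ofReal (‖h‖ ^ (-((n : ℝ) + 2 * s))) * f h :=
  lintegral_withDensity_eq_lintegral_mul₀ (measurable_levy_density s).aemeasurable hf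

/-- The substitution t ↦ 1/t turns this into the Gamma integral at 1 - s. -/
theorem integral_rpow_mul_exp_neg_div {s r : ℝ} (hs1 : s < 1) (hr : 0 < r) :
    ∫ t in Set.Ioi (0 : ℝ), t ^ (s - 2) * Real.exp (-(r / t)) = r ^ (s - 1) * Real.Gamma (1 - s) := by
  have h := integral_comp_rpow_Ioi (fun τ : ℝ => τ ^ (1 - s - 1) * Real.exp (-(r * τ)))
    (p := -1) (by norm_num)
  rw [Real.integral_rpow_mul_exp_neg_mul_Ioi (by linarith) hr] at h
  rw [one_div, Real.inv_rpow hr.le, ← Real.rpow_neg hr.le, neg_sub] at h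
  rw [← h]
  refine setIntegral_congr_fun measurableSet_Ioi fun t (ht : 0 < t) => ?_
  simp only [abs_neg, abs_one, one_mul, smul_eq_mul]
  rw [← Real.rpow_mul ht.le, ← mul_assoc, ← Real.rpow_add ht, Real.rpow_neg_one, div_eq_mul_inv]
  congr 2
  ring

/-- The Bochner integral of a non-integrable function is 0, so an explicit nonzero value proves
integrability. -/
theorem integrableOn_of_integral_ne_zero {α : Type*} [MeasurableSpace α] {μ : Measure α} {f : α → ℝ}
    (h : ∫ x, f x ∂μ ≠ 0) : Integrable f μ := by
  by_contra hf
  exact h (integral_undef hf)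

theorem lintegral_rpow_mul_exp_neg_div {s r : ℝ} (hs1 : s < 1) (hr : 0 < r) :
    ∫⁻ t in Set.Ioi (0 : ℝ), ENNReal.ofReal (t ^ (s - 2) * Real.exp (-(r / t))) =
      ENNReal.ofReal (r ^ (s - 1) * Real.Gamma (1 - s)) := by
  have h := integral_rpow_mul_exp_neg_div hs1 hr
  have hpos : 0 < r ^ (s - 1) * Real.Gamma (1 - s) :=
    mul_pos (Real.rpow_pos_of_pos hr _) (Real.Gamma_pos_of_pos (by linarith))
  rw [← h, ofReal_integral_eq_lintegral_ofReal
    (integrableOn_of_integral_ne_zero (by rw [h]; exact hpos.ne'))]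
  refine (ae_restrict_iff' measurableSet_Ioi).2 (.of_forall fun t (ht : 0 < t) => ?_)
  have := Real.rpow_nonneg ht.le (s - 2)
  positivity

theorem ofReal_one_sub_exp_neg_div {c t : ℝ} (hc : 0 ≤ c) (ht : 0 < t) :
    ENNReal.ofReal (1 - Real.exp (-(c / t))) =
      ∫⁻ r in Set.Ioc 0 c, ENNReal.ofReal (t⁻¹ * Real.exp (-(r / t))) := by
  have h1 : ∫ r in (0 : ℝ)..c, t⁻¹ * Real.exp (-(r / t)) = 1 - Real.exp (-(c / t)) := by
    have hd : ∀ r ∈ Set.uIcc 0 c,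
        HasDerivAt (fun r => -Real.exp (-(r / t))) (t⁻¹ * Real.exp (-(r / t))) r := fun r _ => by
      have := (((hasDerivAt_id r).div_const t).neg).exp.neg
      refine this.congr_deriv ?_
      simp only [Pi.neg_apply, id]
      ring
    rw [intervalIntegral.integral_eq_sub_of_hasDerivAt hd
      (Continuous.intervalIntegrable (by fun_prop) _ _)]
    simp; ring
  rw [← h1, intervalIntegral.integral_of_le hc, ofReal_integral_eq_lintegral_ofReal]
  · exact ((Continuous.integrableOn_Icc (by fun_prop)).mono_set Set.Ioc_subset_Icc_self)
  · exact .of_forall fun r => by positivity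

/-- Writing 1 - e^{-c/t} as the integral of e^{-r/t}/t over 0 < r ≤ c and exchanging the order
leaves Γ(1-s) ∫_0^c r^{s-1} dr. -/
theorem lintegral_rpow_mul_one_sub_exp {s c : ℝ} (hs0 : 0 < s) (hs1 : s < 1) (hc : 0 ≤ c) :
    ∫⁻ t in Set.Ioi (0 : ℝ), ENNReal.ofReal (t ^ (s - 1) * (1 - Real.exp (-(c / t)))) =
      ENNReal.ofReal (c ^ s / s * Real.Gamma (1 - s)) := by
  calc _ = ∫⁻ t in Set.Ioi (0 : ℝ), ∫⁻ r in Set.Ioc 0 c,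
        ENNReal.ofReal (t ^ (s - 2) * Real.exp (-(r / t))) := by
        refine setLIntegral_congr_fun measurableSet_Ioi fun t (ht : 0 < t) => ?_
        rw [ENNReal.ofReal_mul (by positivity), ofReal_one_sub_exp_neg_div hc ht,
          ← lintegral_const_mul' _ _ ENNReal.ofReal_ne_top]
        refine lintegral_congr fun r => ?_
        rw [← ENNReal.ofReal_mul (by positivity), ← mul_assoc, ← Real.rpow_neg_one t,
          ← Real.rpow_add ht]
        congr 3
        ring
    _ = ∫⁻ r in Set.Ioc 0 c, ∫⁻ t in Set.Ioi (0 : ℝ),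
        ENNReal.ofReal (t ^ (s - 2) * Real.exp (-(r / t))) := by
        rw [lintegral_lintegral_swap]
        refine Measurable.aemeasurable ?_
        unfold Function.uncurry
        fun_prop
    _ = ∫⁻ r in Set.Ioc 0 c, ENNReal.ofReal (r ^ (s - 1) * Real.Gamma (1 - s)) :=
        setLIntegral_congr_fun measurableSet_Ioc fun r hr => lintegral_rpow_mul_exp_neg_div hs1 hr.1
    _ = _ := by
        have hG : 0 < Real.Gamma (1 - s) := Real.Gamma_pos_of_pos (by linarith)
        have hi : IntervalIntegrable (fun r : ℝ => r ^ (s - 1) * Real.Gamma (1 - s)) volume 0 c :=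
          (intervalIntegral.intervalIntegrable_rpow' (by linarith)).mul_const _
        rw [← ofReal_integral_eq_lintegral_ofReal
          ((intervalIntegrable_iff_integrableOn_Ioc_of_le hc).1 hi)]
        · rw [← intervalIntegral.integral_of_le hc, intervalIntegral.integral_mul_const,
            integral_rpow (Or.inl (by linarith))]
          simp [Real.zero_rpow hs0.ne']
        · refine (ae_restrict_iff' measurableSet_Ioc).2 (.of_forall fun r hr => ?_)
          have := Real.rpow_nonneg hr.1.le (s - 1)
          simp only [Pi.zero_apply]
          positivity

theorem ofReal_rpow_neg_eq_lintegral {a : ℝ} (ha : 0 < a) {h : Rn n} (hh : h ≠ 0) :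
    ENNReal.ofReal (‖h‖ ^ (-(2 * a))) = ENNReal.ofReal (Real.Gamma a)⁻¹ *
      ∫⁻ t in Set.Ioi (0 : ℝ), ENNReal.ofReal (t ^ (a - 1) * Real.exp (-(‖h‖ ^ 2 * t))) := by
  have hr : 0 < ‖h‖ := norm_pos_iff.2 hh
  have hG := Real.Gamma_pos_of_pos ha
  have e := Real.integral_rpow_mul_exp_neg_mul_Ioi ha (pow_pos hr 2)
  have hpos : 0 < (1 / ‖h‖ ^ 2) ^ a * Real.Gamma a := by positivity
  rw [← ofReal_integral_eq_lintegral_ofReal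
    (integrableOn_of_integral_ne_zero (by rw [e]; exact hpos.ne')), e,
    ← ENNReal.ofReal_mul (by positivity)]
  · congr 1
    rw [one_div, Real.inv_rpow (by positivity), ← Real.rpow_two, ← Real.rpow_mul hr.le,
      ← Real.rpow_neg hr.le]
    field_simp
  · refine (ae_restrict_iff' measurableSet_Ioi).2 (.of_forall fun t (ht : 0 < t) => ?_)
    simp only [Pi.zero_apply]
    positivity

theorem lintegral_cos_mul_gaussian {t : ℝ} (ht : 0 < t) (ξ : Rn n) :
    ∫⁻ h : Rn n, ENNReal.ofReal (2 - 2 * Real.cos (2 * Real.pi * inner ℝ h ξ)) *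
        ENNReal.ofReal (Real.exp (-(‖h‖ ^ 2 * t))) =
      ENNReal.ofReal (2 * (Real.pi / t) ^ ((n : ℝ) / 2) *
        (1 - Real.exp (-(Real.pi ^ 2 * ‖ξ‖ ^ 2 / t)))) := by
  have hg : Integrable fun h : Rn n => Real.exp (-(‖h‖ ^ 2 * t)) := by
    refine integrableOn_of_integral_ne_zero ?_
    have := GaussianFourier.integral_rexp_neg_mul_sq_norm (V := Rn n) ht
    simp only [neg_mul, mul_comm t] at this
    rw [this]; positivity
  have hgi := GaussianFourier.integral_rexp_neg_mul_sq_norm (V := Rn n) ht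
  simp only [neg_mul, mul_comm t, finrank_euclideanSpace, Fintype.card_fin] at hgi
  have hcb : ∀ h : Rn n, ‖Real.cos (2 * Real.pi * inner ℝ h ξ)‖ ≤ 1 := fun h => Real.abs_cos_le_one _
  have hcm : AEStronglyMeasurable (fun h : Rn n => Real.cos (2 * Real.pi * inner ℝ h ξ)) volume :=
    Continuous.aestronglyMeasurable (by fun_prop)
  have hcg : Integrable fun h : Rn n =>
      Real.cos (2 * Real.pi * inner ℝ h ξ) * Real.exp (-(‖h‖ ^ 2 * t)) :=
    hg.bdd_mul hcm (.of_forall hcb)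
  have hF := fourier_gaussian_innerProductSpace (b := (t : ℂ)) (V := Rn n) (by simpa using ht) ξ
  have hci : ∫ h : Rn n, Real.cos (2 * Real.pi * inner ℝ h ξ) * Real.exp (-(‖h‖ ^ 2 * t)) =
      (Real.pi / t) ^ ((n : ℝ) / 2) * Real.exp (-(Real.pi ^ 2 * ‖ξ‖ ^ 2 / t)) := by
    rw [fourier_eq_wave] at hF
    have hF2 := congrArg Complex.re hF
    have e1 : ((Real.pi : ℂ) / t) ^ ((Module.finrank ℝ (Rn n) : ℂ) / 2) *
        Complex.exp (-(Real.pi : ℂ) ^ 2 * (‖ξ‖ : ℂ) ^ 2 / t) =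
        (((Real.pi / t) ^ ((n : ℝ) / 2) * Real.exp (-(Real.pi ^ 2 * ‖ξ‖ ^ 2 / t)) : ℝ) : ℂ) := by
      rw [finrank_euclideanSpace, Fintype.card_fin]
      push_cast
      rw [Complex.ofReal_cpow (by positivity)]
      push_cast
      congr 2
      ring
    rw [e1, Complex.ofReal_re] at hF2
    rw [← hF2]
    change _ = (RCLike.re : ℂ →+ ℝ) _
    rw [← integral_re]
    · refine integral_congr_ae (.of_forall fun h => ?_)
      have : Complex.exp (-(t : ℂ) * (‖h‖ : ℂ) ^ 2) = ((Real.exp (-(‖h‖ ^ 2 * t)) : ℝ) : ℂ) := by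
        push_cast; congr 1; ring
      simp only [this]
      change _ = Complex.re _
      rw [Complex.re_mul_ofReal]
      congr 1
      rw [wave, Real.fourierChar_apply, Complex.exp_ofReal_mul_I_re, inner_neg_right, mul_neg,
        Real.cos_neg]
    · have h1 : Integrable fun h : Rn n => ((Real.exp (-(‖h‖ ^ 2 * t)) : ℝ) : ℂ) := hg.ofReal
      refine (h1.bdd_mul (c := 1) (f := fun h => wave h (-ξ)) ?_ (.of_forall fun h => (norm_wave _ _).le)).congr
        (.of_forall fun h => ?_)
      · exact (continuous_wave.comp (Continuous.prodMk_left (-ξ))).aestronglyMeasurable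
      · simp only; congr 1; push_cast; congr 1; ring
  have hsub : ∫ h : Rn n, (2 - 2 * Real.cos (2 * Real.pi * inner ℝ h ξ)) *
      Real.exp (-(‖h‖ ^ 2 * t)) = 2 * (Real.pi / t) ^ ((n : ℝ) / 2) *
        (1 - Real.exp (-(Real.pi ^ 2 * ‖ξ‖ ^ 2 / t))) := by
    have : (fun h : Rn n => (2 - 2 * Real.cos (2 * Real.pi * inner ℝ h ξ)) *
      Real.exp (-(‖h‖ ^ 2 * t))) = fun h => 2 * Real.exp (-(‖h‖ ^ 2 * t)) -
        2 * (Real.cos (2 * Real.pi * inner ℝ h ξ) * Real.exp (-(‖h‖ ^ 2 * t))) := by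
      ext h; ring
    rw [this, integral_sub (hg.const_mul 2) (hcg.const_mul 2), integral_const_mul,
      integral_const_mul, hci, hgi]
    ring
  rw [← hsub, ofReal_integral_eq_lintegral_ofReal]
  · refine lintegral_congr fun h => ?_
    rw [ENNReal.ofReal_mul]
    linarith [Real.cos_le_one (2 * Real.pi * inner ℝ h ξ)]
  · refine ((hg.const_mul 2).sub (hcg.const_mul 2)).congr (.of_forall fun h => ?_)
    simp only [Pi.sub_apply]; ring
  · refine .of_forall fun h => mul_nonneg ?_ (Real.exp_pos _).le
    linarith [Real.cos_le_one (2 * Real.pi * inner ℝ h ξ)]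

theorem fracConst_pos (n : ℕ) {s : ℝ} (hs0 : 0 < s) (hs1 : s < 1) : 0 < fracConst n s := by
  unfold fracConst
  have h1 : 0 < Real.Gamma ((n : ℝ) / 2 + s) := Real.Gamma_pos_of_pos (by positivity)
  have h2 : Real.Gamma (-s) ≠ 0 := Real.Gamma_ne_zero fun m hm => by
    rcases Nat.eq_zero_or_pos m with rfl | hm0
    · simp at hm; exact hs0.ne' hm
    · have : (1 : ℝ) ≤ m := by exact_mod_cast hm0
      linarith
  have := abs_pos.2 h2
  positivity

theorem abs_Gamma_neg {s : ℝ} (hs0 : 0 < s) (hs1 : s < 1) :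
    |Real.Gamma (-s)| = Real.Gamma (1 - s) / s := by
  have h := Real.Gamma_add_one (s := -s) (by linarith)
  have hp : 0 < Real.Gamma (1 - s) := Real.Gamma_pos_of_pos (by linarith)
  rw [show -s + 1 = 1 - s by ring] at h
  have hneg : Real.Gamma (-s) < 0 := by nlinarith
  rw [abs_of_neg hneg, h]
  field_simp

/-- The Lévy–Khintchine formula for `|2πξ|^{2s}`. -/
theorem lintegral_cos_levy (hn : 0 < n) {s : ℝ} (hs0 : 0 < s) (hs1 : s < 1) (ξ : Rn n) :
    ∫⁻ h, ENNReal.ofReal (2 - 2 * Real.cos (2 * Real.pi * inner ℝ h ξ)) ∂levy n s =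
      ENNReal.ofReal (2 / fracConst n s * lapSymbol s ξ) := by
  have : NeZero n := ⟨hn.ne'⟩
  set a : ℝ := (n : ℝ) / 2 + s with ha
  have ha0 : 0 < a := by positivity
  have hG := Real.Gamma_pos_of_pos ha0
  rw [lintegral_levy s (by fun_prop)]
  -- Since 2a = n + 2s, the kernel |h|^{-(n+2s)} is Γ(a)^{-1} ∫ t^{a-1} e^{-t|h|²} dt, a
  -- superposition of Gaussians whose cosine transforms are explicit. All integrands are
  -- nonnegative, so the exchange of integrals needs measurability only.
  calc _ = ∫⁻ h : Rn n, ENNReal.ofReal (Real.Gamma a)⁻¹ * ∫⁻ t in Set.Ioi (0 : ℝ),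
        ENNReal.ofReal (t ^ (a - 1) * Real.exp (-(‖h‖ ^ 2 * t))) *
          ENNReal.ofReal (2 - 2 * Real.cos (2 * Real.pi * inner ℝ h ξ)) := by
        refine lintegral_congr_ae ?_
        filter_upwards [Measure.ae_ne volume (0 : Rn n)] with h hh
        rw [lintegral_mul_const' _ _ ENNReal.ofReal_ne_top, ← mul_assoc,
          ← ofReal_rpow_neg_eq_lintegral ha0 hh]
        congr 3
        rw [ha]; ring_nf
    _ = ENNReal.ofReal (Real.Gamma a)⁻¹ * ∫⁻ t in Set.Ioi (0 : ℝ), ∫⁻ h : Rn n,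
        ENNReal.ofReal (t ^ (a - 1) * Real.exp (-(‖h‖ ^ 2 * t))) *
          ENNReal.ofReal (2 - 2 * Real.cos (2 * Real.pi * inner ℝ h ξ)) := by
        rw [lintegral_const_mul' _ _ ENNReal.ofReal_ne_top, lintegral_lintegral_swap]
        refine Measurable.aemeasurable ?_
        unfold Function.uncurry
        fun_prop
    _ = ENNReal.ofReal (Real.Gamma a)⁻¹ * ∫⁻ t in Set.Ioi (0 : ℝ),
        ENNReal.ofReal (2 * Real.pi ^ ((n : ℝ) / 2)) * ENNReal.ofReal (t ^ (s - 1) *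
          (1 - Real.exp (-(Real.pi ^ 2 * ‖ξ‖ ^ 2 / t)))) := by
        congr 1
        refine setLIntegral_congr_fun measurableSet_Ioi fun t (ht : 0 < t) => ?_
        beta_reduce
        have : ∀ h : Rn n, ENNReal.ofReal (t ^ (a - 1) * Real.exp (-(‖h‖ ^ 2 * t))) *
          ENNReal.ofReal (2 - 2 * Real.cos (2 * Real.pi * inner ℝ h ξ)) =
          ENNReal.ofReal (t ^ (a - 1)) * (ENNReal.ofReal (2 - 2 * Real.cos (2 * Real.pi * inner ℝ h ξ)) *
          ENNReal.ofReal (Real.exp (-(‖h‖ ^ 2 * t)))) := fun h => by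
          rw [ENNReal.ofReal_mul (by positivity)]; ring
        simp_rw [this]
        rw [lintegral_const_mul' _ _ ENNReal.ofReal_ne_top, lintegral_cos_mul_gaussian ht,
          ← ENNReal.ofReal_mul (by positivity), ← ENNReal.ofReal_mul (by positivity)]
        congr 1
        rw [Real.div_rpow Real.pi_pos.le ht.le, div_eq_mul_inv, ← Real.rpow_neg ht.le]
        have : t ^ (s - 1) = t ^ (a - 1) * t ^ (-((n : ℝ) / 2)) := by
          rw [← Real.rpow_add ht, ha]; congr 1; ring
        rw [this]; ring
    _ = _ := by
        rw [lintegral_const_mul' _ _ ENNReal.ofReal_ne_top,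
          lintegral_rpow_mul_one_sub_exp hs0 hs1 (by positivity),
          ← ENNReal.ofReal_mul (by positivity), ← ENNReal.ofReal_mul (by positivity)]
        congr 1
        have hp : 0 < Real.Gamma (1 - s) := Real.Gamma_pos_of_pos (by linarith)
        unfold fracConst lapSymbol
        rw [abs_Gamma_neg hs0 hs1, ← ha]
        have e1 : (2 * Real.pi * ‖ξ‖) ^ (2 * s) = 4 ^ s * (Real.pi ^ 2 * ‖ξ‖ ^ 2) ^ s := by
          rw [Real.rpow_mul (by positivity), Real.rpow_two,
            ← Real.mul_rpow (by norm_num) (by positivity)]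
          congr 1; ring
        rw [e1]
        field_simp

/-- In polar coordinates the integrand is r^{1-2s} near the origin, integrable because s < 1, and
r^{-1-2s} at infinity, integrable because s > 0. -/
theorem lintegral_min_levy (hn : 0 < n) {s : ℝ} (hs0 : 0 < s) (hs1 : s < 1) :
    ∫⁻ h, ENNReal.ofReal (min 1 (‖h‖ ^ 2)) ∂levy n s < ∞ := by
  have : NeZero n := ⟨hn.ne'⟩
  rw [lintegral_levy s (by fun_prop)]
  have key : Integrable (fun h : Rn n => ‖h‖ ^ (-((n : ℝ) + 2 * s)) * min 1 (‖h‖ ^ 2)) := by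
    rw [integrable_fun_norm_addHaar (volume : Measure (Rn n))
      (f := fun r : ℝ => r ^ (-((n : ℝ) + 2 * s)) * min 1 (r ^ 2))]
    rw [← Set.Ioc_union_Ioi_eq_Ioi (zero_le_one (α := ℝ))]
    have hpow (y : ℝ) (hy : 0 < y) : y ^ (Module.finrank ℝ (Rn n) - 1) * y ^ (-((n : ℝ) + 2 * s)) =
        y ^ (-1 - 2 * s) := by
      rw [finrank_euclideanSpace, Fintype.card_fin, ← Real.rpow_natCast, ← Real.rpow_add hy,
        Nat.cast_sub hn]
      congr 1; push_cast; ring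
    refine IntegrableOn.union ?_ ?_
    · have h1 : IntegrableOn (fun y : ℝ => y ^ (1 - 2 * s)) (Set.Ioc 0 1) :=
        (intervalIntegrable_iff_integrableOn_Ioc_of_le zero_le_one).1
          (intervalIntegral.intervalIntegrable_rpow' (by linarith))
      refine h1.congr_fun (fun y hy => ?_) measurableSet_Ioc
      beta_reduce
      rw [smul_eq_mul, ← mul_assoc, hpow y hy.1, min_eq_right (pow_le_one₀ hy.1.le hy.2),
        ← Real.rpow_two, ← Real.rpow_add hy.1]
      congr 1; ring
    · have h1 : IntegrableOn (fun y : ℝ => y ^ (-1 - 2 * s)) (Set.Ioi 1) :=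
        integrableOn_Ioi_rpow_of_lt (by linarith) zero_lt_one
      refine h1.congr_fun (fun y (hy : 1 < y) => ?_) measurableSet_Ioi
      beta_reduce
      rw [smul_eq_mul, ← mul_assoc, hpow y (by linarith), min_eq_left (one_le_pow₀ hy.le), mul_one]
  refine lt_of_eq_of_lt (lintegral_congr fun h => ?_) key.lintegral_lt_top
  rw [ENNReal.ofReal_mul (by positivity)]

/-! ### The jump measure and the Gagliardo seminorm -/

/-- The measure `|h|^{-(n+2s)} dh dx` on pairs `(h, x)`. -/
def jump (n : ℕ) (s : ℝ) : Measure (Rn n × Rn n) := (levy n s).prod volume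

/-- The difference `u(x + h) - u(x)` at `z = (h, x)`. -/
def diff {E : Type*} [Sub E] (u : Rn n → E) (z : Rn n × Rn n) : E := u (z.2 + z.1) - u z.2

theorem measurePreserving_shear (s : ℝ) :
    MeasurePreserving (fun z : Rn n × Rn n => (z.1, z.2 + z.1)) (jump n s) (jump n s) := by
  have := measurePreserving_prod_add (levy n s) (volume : Measure (Rn n))
  simp only [jump, add_comm] at this ⊢
  exact this

theorem measurePreserving_neg_levy (s : ℝ) :
    MeasurePreserving (fun h : Rn n => -h) (levy n s) (levy n s) := by
  refine ⟨measurable_neg, ?_⟩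
  ext t ht
  rw [Measure.map_apply measurable_neg ht, levy, withDensity_apply _ (measurable_neg ht),
    withDensity_apply _ ht, ← lintegral_indicator (measurable_neg ht), ← lintegral_indicator ht,
    ← lintegral_neg_eq_self]
  refine lintegral_congr fun x => ?_
  simp only [Set.indicator, norm_neg]
  congr 1
  simp

/-- The exchange of the two points of a pair. -/
theorem measurePreserving_swap_points (s : ℝ) :
    MeasurePreserving (fun z : Rn n × Rn n => (-z.1, z.2 + z.1)) (jump n s) (jump n s) :=
  ((measurePreserving_neg_levy s).prod (MeasurePreserving.id volume)).comp
    (measurePreserving_shear s)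

theorem quasiMeasurePreserving_snd_jump (s : ℝ) :
    Measure.QuasiMeasurePreserving (fun z : Rn n × Rn n => z.2) (jump n s) volume :=
  Measure.quasiMeasurePreserving_snd

theorem quasiMeasurePreserving_add_jump (s : ℝ) :
    Measure.QuasiMeasurePreserving (fun z : Rn n × Rn n => z.2 + z.1) (jump n s) volume :=
  (quasiMeasurePreserving_snd_jump s).comp (measurePreserving_shear s).quasiMeasurePreserving

section Measurability

variable {E : Type*} [NormedAddCommGroup E] {u : Rn n → E}

theorem aesm_snd (s : ℝ) (hu : AEStronglyMeasurable u volume) :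
    AEStronglyMeasurable (fun z : Rn n × Rn n => u z.2) (jump n s) :=
  hu.comp_quasiMeasurePreserving (quasiMeasurePreserving_snd_jump s)

theorem aesm_add (s : ℝ) (hu : AEStronglyMeasurable u volume) :
    AEStronglyMeasurable (fun z : Rn n × Rn n => u (z.2 + z.1)) (jump n s) :=
  hu.comp_quasiMeasurePreserving (quasiMeasurePreserving_add_jump s)

theorem aesm_diff (s : ℝ) (hu : AEStronglyMeasurable u volume) :
    AEStronglyMeasurable (diff u) (jump n s) :=
  (aesm_add s hu).sub (aesm_snd s hu)

end Measurability

theorem lintegral_jump (s : ℝ) {f : Rn n × Rn n → ℝ≥0∞} (hf : AEMeasurable f (jump n s)) :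
    ∫⁻ z, f z ∂jump n s = ∫⁻ h, (∫⁻ x, f (h, x)) ∂levy n s :=
  lintegral_prod _ hf

theorem fourierL2_diff {u : Rn n → ℂ} (hu : MemLp u 2 volume) (h : Rn n) :
    fourierL2 (fun x => u (x + h) - u x) =ᵐ[volume] fun ξ => (wave h ξ - 1) * fourierL2 u ξ := by
  filter_upwards [fourierL2_sub (MemLp_comp_add hu h) hu, fourierL2_comp_add hu h] with ξ h1 h2
  rw [h1, h2]; ring

theorem wave_sub_one_mul (h ξ : Rn n) :
    (wave h ξ - 1) * (wave h (-ξ) - 1) =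
      ((2 - 2 * Real.cos (2 * Real.pi * inner ℝ h ξ) : ℝ) : ℂ) := by
  have h1 := wave_add_neg h ξ
  have h2 := wave_mul_neg h ξ
  push_cast at h1 ⊢
  linear_combination h2 - h1

theorem conj_wave (h ξ : Rn n) : starRingEnd ℂ (wave h ξ) = wave h (-ξ) := by
  simp only [wave, inner_neg_right, AddChar.map_neg_eq_inv, Circle.coe_inv_eq_conj]

theorem enorm_wave_sub_one_sq (h ξ : Rn n) :
    ‖wave h ξ - 1‖ₑ ^ 2 = ENNReal.ofReal (2 - 2 * Real.cos (2 * Real.pi * inner ℝ h ξ)) := by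
  rw [← ofReal_norm, ← ENNReal.ofReal_pow (norm_nonneg _)]
  congr 1
  have := Complex.mul_conj' (wave h ξ - 1)
  rw [map_sub, conj_wave, map_one, wave_sub_one_mul] at this
  exact_mod_cast this.symm

/-- For fixed h, Plancherel turns the translation difference into multiplication by e^{2πi h·ξ} - 1,
whose squared modulus is 2 - 2cos(2π h·ξ). Integrating in h first then gives the symbol, by the
Lévy–Khintchine formula. -/
theorem lintegral_diff_sq (hn : 0 < n) {s : ℝ} (hs0 : 0 < s) (hs1 : s < 1) {u : Rn n → ℂ}
    (hu : MemLp u 2 volume) :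
    ∫⁻ z, ‖diff u z‖ₑ ^ 2 ∂jump n s = ENNReal.ofReal (2 / fracConst n s) * energy s u := by
  rw [lintegral_jump s ((aesm_diff s hu.1).enorm.pow_const 2)]
  calc _ = ∫⁻ h, (∫⁻ ξ, ENNReal.ofReal (2 - 2 * Real.cos (2 * Real.pi * inner ℝ h ξ)) *
        ‖fourierL2 u ξ‖ₑ ^ 2) ∂levy n s := by
        refine lintegral_congr fun h => ?_
        have hd : MemLp (fun x => u (x + h) - u x) 2 volume := (MemLp_comp_add hu h).sub hu
        change ∫⁻ x, ‖u (x + h) - u x‖ₑ ^ 2 = _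
        rw [← lintegral_fourierL2 hd]
        refine lintegral_congr_ae ?_
        filter_upwards [fourierL2_diff hu h] with ξ hξ
        rw [hξ, enorm_mul, mul_pow, enorm_wave_sub_one_sq]
    _ = ∫⁻ ξ, ∫⁻ h, ENNReal.ofReal (2 - 2 * Real.cos (2 * Real.pi * inner ℝ h ξ)) *
        ‖fourierL2 u ξ‖ₑ ^ 2 ∂levy n s := by
        have h1 : AEMeasurable (fun z : Rn n × Rn n =>
            ENNReal.ofReal (2 - 2 * Real.cos (2 * Real.pi * inner ℝ z.1 z.2)))
            ((levy n s).prod volume) := Measurable.aemeasurable (by fun_prop)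
        exact lintegral_lintegral_swap (h1.mul
          (((aestronglyMeasurable_fourierL2 u).comp_snd (μ := levy n s)).enorm.pow_const 2))
    _ = _ := by
        rw [energy, ← lintegral_const_mul' _ _ ENNReal.ofReal_ne_top]
        refine lintegral_congr fun ξ => ?_
        rw [lintegral_mul_const, lintegral_cos_levy hn hs0 hs1, ENNReal.ofReal_mul, mul_assoc]
        · have := fracConst_pos n hs0 hs1; positivity
        · fun_prop

theorem memLp_diff (hn : 0 < n) {s : ℝ} (hs0 : 0 < s) (hs1 : s < 1) {u : Rn n → ℂ}
    (hu : MemH s u) : MemLp (diff u) 2 (jump n s) := by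
  rw [memLp_two_iff_lintegral (aesm_diff s hu.memLp.1), lintegral_diff_sq hn hs0 hs1 hu.memLp]
  exact ENNReal.mul_lt_top ENNReal.ofReal_lt_top ((memH_iff_energy hs0.le hs1.le u).1 hu).2

/-- Membership in H^s without the Fourier transform: this is the form in which products with γ^{1/2}
and γ^{-1/2} can be examined. -/
theorem memH_iff_memLp_diff (hn : 0 < n) {s : ℝ} (hs0 : 0 < s) (hs1 : s < 1) {u : Rn n → ℂ} :
    MemH s u ↔ MemLp u 2 volume ∧ MemLp (diff u) 2 (jump n s) := by
  refine ⟨fun h => ⟨h.memLp, memLp_diff hn hs0 hs1 h⟩, fun ⟨hu, h⟩ => ?_⟩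
  rw [memLp_two_iff_lintegral (aesm_diff s hu.1), lintegral_diff_sq hn hs0 hs1 hu] at h
  refine (memH_iff_energy hs0.le hs1.le u).2 ⟨hu, ?_⟩
  -- Positivity of the constant is essential: it prevents an infinite energy from being multiplied
  -- by 0.
  have hc : 0 < 2 / fracConst n s := div_pos two_pos (fracConst_pos n hs0 hs1)
  by_contra hE
  rw [not_lt_top_iff.1 hE, ENNReal.mul_top (by simpa using hc)] at h
  exact lt_irrefl _ h

theorem integrable_lapSymbol_mul {s : ℝ} {u v : Rn n → ℂ} (hu : energy s u < ∞)
    (hv : energy s v < ∞) :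
    Integrable (fun ξ => (lapSymbol s ξ : ℂ) * fourierL2 u ξ * fourierL2 v (-ξ)) := by
  have key (w : Rn n → ℂ) (hw : energy s w < ∞) :
      MemLp (fun ξ => ((lapSymbol s ξ) ^ (1 / 2 : ℝ) : ℝ) * fourierL2 w ξ) 2 volume := by
    rw [memLp_two_iff_lintegral]
    · refine lt_of_eq_of_lt (lintegral_congr fun ξ => ?_) hw
      rw [enorm_mul, mul_pow]
      congr 1
      rw [← ofReal_norm, Complex.norm_real, ← ENNReal.ofReal_pow (norm_nonneg _), Real.norm_eq_abs,
        sq_abs, ← Real.rpow_natCast, ← Real.rpow_mul (lapSymbol_nonneg s ξ)]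
      norm_num
    · exact ((Complex.continuous_ofReal.measurable.comp
        ((measurable_lapSymbol s).pow_const _)).aestronglyMeasurable).mul
        (aestronglyMeasurable_fourierL2 w)
  have h2 := (key v hv).comp_measurePreserving (Measure.measurePreserving_neg volume)
  refine ((key u hu).integrable_mul h2).congr (.of_forall fun ξ => ?_)
  have hneg : lapSymbol s (-ξ) = lapSymbol s ξ := by simp [lapSymbol]
  simp only [Pi.mul_apply, Function.comp_apply, hneg]
  have : (lapSymbol s ξ : ℂ) = ((lapSymbol s ξ ^ (1 / 2 : ℝ) : ℝ) : ℂ) *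
      ((lapSymbol s ξ ^ (1 / 2 : ℝ) : ℝ) : ℂ) := by
    rw [← Complex.ofReal_mul, ← Real.rpow_add_of_nonneg (lapSymbol_nonneg s ξ) (by norm_num)
      (by norm_num)]
    norm_num
  rw [this]; ring

/-- The form of `(-Δ)^s` in terms of differences. -/
theorem integral_diff_mul_diff (hn : 0 < n) {s : ℝ} (hs0 : 0 < s) (hs1 : s < 1) {u v : Rn n → ℂ}
    (hu : MemH s u) (hv : MemH s v) :
    ∫ z, diff u z * diff v z ∂jump n s = (2 / fracConst n s : ℝ) * fracLapH s u v := by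
  have hC : 0 < 2 / fracConst n s := div_pos two_pos (fracConst_pos n hs0 hs1)
  have hi : Integrable (fun z => diff u z * diff v z) (jump n s) :=
    (memLp_diff hn hs0 hs1 hu).integrable_mul (memLp_diff hn hs0 hs1 hv)
  rw [jump, integral_prod _ hi]
  have hLi := integrable_lapSymbol_mul ((memH_iff_energy hs0.le hs1.le u).1 hu).2
    ((memH_iff_energy hs0.le hs1.le v).1 hv).2
  have hneg : AEStronglyMeasurable (fun ξ => fourierL2 v (-ξ)) volume :=
    (aestronglyMeasurable_fourierL2 v).comp_measurePreserving (Measure.measurePreserving_neg volume)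
  set G : Rn n → ℂ := fun ξ => fourierL2 u ξ * fourierL2 v (-ξ) with hGdef
  have hG : AEStronglyMeasurable G volume := (aestronglyMeasurable_fourierL2 u).mul hneg
  let c : Rn n → Rn n → ℝ := fun h ξ => 2 - 2 * Real.cos (2 * Real.pi * inner ℝ h ξ)
  have hc0 (h ξ : Rn n) : 0 ≤ c h ξ := by
    simp only [c]; linarith [Real.cos_le_one (2 * Real.pi * inner ℝ h ξ)]
  have hcc : Continuous (Function.uncurry c) := by
    simp only [c]; unfold Function.uncurry; fun_prop
  have hcn (h ξ : Rn n) : ‖(c h ξ : ℂ)‖ₑ = ENNReal.ofReal (c h ξ) := by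
    rw [← ofReal_norm, Complex.norm_real, Real.norm_of_nonneg (hc0 h ξ)]
  -- Absolute integrability for Fubini: integrating the modulus in h first gives a multiple of the
  -- symbol times |û(ξ) v̂(-ξ)|, which is integrable by Cauchy–Schwarz since both energies are
  -- finite.
  have hcG : Integrable (Function.uncurry fun h ξ => (c h ξ : ℂ) * G ξ) ((levy n s).prod volume) := by
    have hm : AEStronglyMeasurable (Function.uncurry fun h ξ => (c h ξ : ℂ) * G ξ)
        ((levy n s).prod volume) :=
      (Complex.continuous_ofReal.comp hcc).aestronglyMeasurable.mul (hG.comp_snd (μ := levy n s))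
    refine ⟨hm, ?_⟩
    rw [HasFiniteIntegral, lintegral_prod_symm _ hm.enorm]
    have : ∀ ξ, ∫⁻ h, ‖Function.uncurry (fun h ξ => (c h ξ : ℂ) * G ξ) (h, ξ)‖ₑ ∂levy n s =
        ENNReal.ofReal (2 / fracConst n s) *
          ‖(lapSymbol s ξ : ℂ) * fourierL2 u ξ * fourierL2 v (-ξ)‖ₑ := fun ξ => by
      simp only [Function.uncurry_apply_pair, enorm_mul, hcn]
      rw [lintegral_mul_const, lintegral_cos_levy hn hs0 hs1, ENNReal.ofReal_mul hC.le, mul_assoc,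
        mul_assoc, hGdef, enorm_mul]
      · congr 2
        rw [← ofReal_norm (lapSymbol s ξ : ℂ), Complex.norm_real,
          Real.norm_of_nonneg (lapSymbol_nonneg s ξ)]
      · fun_prop
    simp_rw [this]
    rw [lintegral_const_mul' _ _ ENNReal.ofReal_ne_top]
    exact ENNReal.mul_lt_top ENNReal.ofReal_lt_top hLi.2
  calc _ = ∫ h, (∫ ξ, (c h ξ : ℂ) * G ξ) ∂levy n s := by
        refine integral_congr_ae (.of_forall fun h => ?_)
        change ∫ x, (u (x + h) - u x) * (v (x + h) - v x) = _
        refine (integral_mul_eq_integral_fourierL2 ((MemLp_comp_add hu.memLp h).sub hu.memLp)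
          ((MemLp_comp_add hv.memLp h).sub hv.memLp)).trans (integral_congr_ae ?_)
        have h2 := (Measure.measurePreserving_neg (volume : Measure (Rn n))).quasiMeasurePreserving.ae
          (fourierL2_diff hv.memLp h)
        filter_upwards [fourierL2_diff hu.memLp h, h2] with ξ h1 h2
        change fourierL2 (fun x => u (x + h) - u x) ξ * fourierL2 (fun x => v (x + h) - v x) (-ξ) = _
        rw [h1, h2]
        simp only [c, hGdef]
        rw [← wave_sub_one_mul]; ring
    _ = ∫ ξ, ∫ h, (c h ξ : ℂ) * G ξ ∂levy n s := integral_integral_swap hcG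
    _ = _ := by
        rw [fracLapH, ← integral_const_mul]
        refine integral_congr_ae (.of_forall fun ξ => ?_)
        beta_reduce
        rw [integral_mul_const, integral_complex_ofReal,
          integral_eq_lintegral_of_nonneg_ae (.of_forall fun h => hc0 h ξ), lintegral_cos_levy hn hs0 hs1,
          ENNReal.toReal_ofReal (mul_nonneg hC.le (lapSymbol_nonneg s ξ)), hGdef]
        · push_cast; ring
        · simp only [c]
          exact Continuous.aestronglyMeasurable (by fun_prop)

/-! ### Integrals over pairs of points -/

theorem jump_eq_withDensity (s : ℝ) :
    jump n s = (volume : Measure (Rn n × Rn n)).withDensity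
      fun z => ENNReal.ofReal (‖z.1‖ ^ (-((n : ℝ) + 2 * s))) := by
  rw [jump, levy, prod_withDensity_left (measurable_levy_density s)]
  rfl

/-- The map `(h, x) ↦ (x, x + h)`. -/
def pairEquiv (n : ℕ) : Rn n × Rn n ≃ᵐ Rn n × Rn n where
  toFun z := (z.2, z.2 + z.1)
  invFun z := (z.2 - z.1, z.1)
  left_inv z := by simp
  right_inv z := by simp
  measurable_toFun := measurable_snd.prodMk (measurable_snd.add measurable_fst)
  measurable_invFun := (measurable_snd.sub measurable_fst).prodMk measurable_fst

theorem measurePreserving_pairEquiv : MeasurePreserving (pairEquiv n) volume volume := by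
  have h1 := (measurePreserving_prod_add (volume : Measure (Rn n)) (volume : Measure (Rn n)))
  exact h1.comp Measure.measurePreserving_swap

theorem integral_pair (s : ℝ) (F : Rn n × Rn n → ℂ) :
    ∫ z : Rn n × Rn n, ((‖z.2 - z.1‖ ^ (-((n : ℝ) + 2 * s)) : ℝ) : ℂ) * F z =
      ∫ z, F (z.2, z.2 + z.1) ∂jump n s := by
  rw [jump_eq_withDensity, integral_withDensity_eq_integral_toReal_smul (by fun_prop)
    (.of_forall fun _ => ENNReal.ofReal_lt_top),
    ← measurePreserving_pairEquiv.integral_comp' (g := fun z : Rn n × Rn n =>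
      ((‖z.2 - z.1‖ ^ (-((n : ℝ) + 2 * s)) : ℝ) : ℂ) * F z)]
  refine integral_congr_ae (.of_forall fun z => ?_)
  simp only [pairEquiv, MeasurableEquiv.coe_mk, Equiv.coe_fn_mk, add_sub_cancel_left]
  rw [ENNReal.toReal_ofReal (by positivity)]
  simp

theorem lintegral_pair (s : ℝ) (F : Rn n × Rn n → ℝ≥0∞) :
    ∫⁻ z : Rn n × Rn n, ENNReal.ofReal (‖z.2 - z.1‖ ^ (-((n : ℝ) + 2 * s))) * F z =
      ∫⁻ z, F (z.2, z.2 + z.1) ∂jump n s := by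
  rw [jump_eq_withDensity, lintegral_withDensity_eq_lintegral_mul_non_measurable₀ _ (by fun_prop)
    (.of_forall fun _ => ENNReal.ofReal_lt_top),
    ← measurePreserving_pairEquiv.lintegral_comp_emb (pairEquiv n).measurableEmbedding]
  refine lintegral_congr fun z => ?_
  simp only [pairEquiv, MeasurableEquiv.coe_mk, Equiv.coe_fn_mk, add_sub_cancel_left, Pi.mul_apply]

/-! ### The Sobolev inequality -/

theorem lintegral_mul_sq_le {α : Type*} [MeasurableSpace α] {μ : Measure α} {f g : α → ℝ≥0∞}
    (hf : AEMeasurable f μ) (hg : AEMeasurable g μ) :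
    ∫⁻ x, f x * g x ∂μ ≤ (∫⁻ x, f x ^ 2 ∂μ) ^ (1 / 2 : ℝ) * (∫⁻ x, g x ^ 2 ∂μ) ^ (1 / 2 : ℝ) := by
  have := ENNReal.lintegral_mul_le_Lp_mul_Lq μ Real.HolderConjugate.two_two hf hg
  simpa using this

/-- In polar coordinates this is a multiple of ∫_0^A r^{n-1-2s} dr, finite since 2s < n. The
constant is a square because Cauchy–Schwarz will take its root. -/
theorem exists_lintegral_inv_lapSymbol_le (hn : 0 < n) {s : ℝ} (hsn : 2 * s < n) :
    ∃ c : ℝ, 0 < c ∧ ∀ A : ℝ, 0 < A →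
      ∫⁻ ξ in Metric.closedBall (0 : Rn n) A, ENNReal.ofReal (lapSymbol s ξ)⁻¹ ≤
        ENNReal.ofReal (c ^ 2 * A ^ ((n : ℝ) - 2 * s)) := by
  have : NeZero n := ⟨hn.ne'⟩
  have hlap (ξ : Rn n) : (lapSymbol s ξ)⁻¹ = (2 * Real.pi) ^ (-(2 * s)) * ‖ξ‖ ^ (-(2 * s)) := by
    rw [lapSymbol, ← Real.rpow_neg (by positivity), Real.mul_rpow (by positivity) (norm_nonneg _)]
  have hd : 0 < (n : ℝ) - 2 * s := by linarith
  have hrad (A : ℝ) (ξ : Rn n) : (Metric.closedBall (0 : Rn n) A).indicator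
      (fun ξ => (lapSymbol s ξ)⁻¹) ξ = (Set.Iic A).indicator
        (fun r => (2 * Real.pi) ^ (-(2 * s)) * r ^ (-(2 * s))) ‖ξ‖ := by
    simp only [Set.indicator, hlap]; simp
  have hpow (A : ℝ) (hA : 0 < A) : ∀ y ∈ Set.Ioi (0 : ℝ), y ^ (Module.finrank ℝ (Rn n) - 1) •
      (Set.Iic A).indicator (fun r => (2 * Real.pi) ^ (-(2 * s)) * r ^ (-(2 * s))) y =
      (Set.Ioc 0 A).indicator (fun r => (2 * Real.pi) ^ (-(2 * s)) * r ^ ((n : ℝ) - 1 - 2 * s)) y := by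
    intro y (hy : 0 < y)
    by_cases hyA : y ≤ A
    · simp only [Set.indicator, Set.mem_Iic, Set.mem_Ioc, hy, hyA, and_self, if_true, smul_eq_mul,
        finrank_euclideanSpace, Fintype.card_fin]
      rw [mul_left_comm, ← Real.rpow_natCast, ← Real.rpow_add hy, Nat.cast_sub hn]
      congr 2; push_cast; ring
    · simp [Set.indicator, hyA]
  have hI (A : ℝ) (hA : 0 < A) : IntervalIntegrable
      (fun r : ℝ => (2 * Real.pi) ^ (-(2 * s)) * r ^ ((n : ℝ) - 1 - 2 * s)) volume 0 A :=
    (intervalIntegral.intervalIntegrable_rpow' (by linarith)).const_mul _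
  set V : ℝ := (volume : Measure (Rn n)).real (Metric.ball 0 1)
  set k : ℝ := n * (V * ((2 * Real.pi) ^ (-(2 * s)) / ((n : ℝ) - 2 * s))) with hk
  have hk0 : 0 ≤ k := by have : 0 ≤ V := measureReal_nonneg; positivity
  -- The added 1 gives c > 0 without having to check k > 0.
  refine ⟨Real.sqrt (k + 1), by positivity, fun A hA => ?_⟩
  rw [Real.sq_sqrt (by positivity), ← lintegral_indicator Metric.isClosed_closedBall.measurableSet]
  have hint : Integrable fun ξ : Rn n => (Set.Iic A).indicator
      (fun r => (2 * Real.pi) ^ (-(2 * s)) * r ^ (-(2 * s))) ‖ξ‖ := by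
    rw [integrable_fun_norm_addHaar (volume : Measure (Rn n)) (f := (Set.Iic A).indicator
      (fun r => (2 * Real.pi) ^ (-(2 * s)) * r ^ (-(2 * s))))]
    refine IntegrableOn.congr_fun ?_ (fun y hy => (hpow A hA y hy).symm) measurableSet_Ioi
    rw [IntegrableOn, integrable_indicator_iff measurableSet_Ioc, IntegrableOn,
      Measure.restrict_restrict measurableSet_Ioc, Set.inter_eq_left.2 Set.Ioc_subset_Ioi_self]
    exact (intervalIntegrable_iff_integrableOn_Ioc_of_le hA.le).1 (hI A hA)
  have hval : ∫ ξ : Rn n, (Set.Iic A).indicator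
      (fun r => (2 * Real.pi) ^ (-(2 * s)) * r ^ (-(2 * s))) ‖ξ‖ = k * A ^ ((n : ℝ) - 2 * s) := by
    rw [integral_fun_norm_addHaar (volume : Measure (Rn n)) ((Set.Iic A).indicator
      (fun r => (2 * Real.pi) ^ (-(2 * s)) * r ^ (-(2 * s)))),
      setIntegral_congr_fun measurableSet_Ioi (hpow A hA), setIntegral_indicator measurableSet_Ioc,
      Set.inter_eq_right.2 Set.Ioc_subset_Ioi_self, ← intervalIntegral.integral_of_le hA.le,
      intervalIntegral.integral_const_mul, integral_rpow (Or.inl (by linarith)),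
      show (n : ℝ) - 1 - 2 * s + 1 = n - 2 * s by ring, Real.zero_rpow hd.ne', sub_zero, hk,
      finrank_euclideanSpace, Fintype.card_fin]
    simp only [nsmul_eq_mul, smul_eq_mul, V]
    ring
  calc _ = ∫⁻ ξ : Rn n, ENNReal.ofReal ((Set.Iic A).indicator
        (fun r => (2 * Real.pi) ^ (-(2 * s)) * r ^ (-(2 * s))) ‖ξ‖) := by
        refine lintegral_congr fun ξ => ?_
        rw [← hrad]
        by_cases h : ξ ∈ Metric.closedBall (0 : Rn n) A <;> simp only [Set.indicator, h] <;> simp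
    _ = ENNReal.ofReal (k * A ^ ((n : ℝ) - 2 * s)) := by
        rw [← hval, ofReal_integral_eq_lintegral_ofReal hint]
        refine .of_forall fun ξ => ?_
        beta_reduce
        rw [← hrad]
        exact Set.indicator_nonneg (fun ξ _ => inv_nonneg.2 (lapSymbol_nonneg s ξ)) ξ
    _ ≤ _ := by gcongr; linarith

/-- The frequencies of u are cut at a radius A depending on the level l. The low part is bounded by
l/2 everywhere, so |u| > l forces the high part to exceed l/2, and Chebyshev and Plancherel bound
the measure of that set. The indicator expresses |ξ| > A. -/
theorem meas_lt_norm_le {s : ℝ} {u : Rn n → ℂ} (hu : MemLp u 2 volume)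
    (hn : 0 < n) (hsn : 2 * s < n) {c B l : ℝ} (hc : 0 < c) (hB : 0 < B) (hl : 0 < l)
    (hcA : ∀ A : ℝ, 0 < A → ∫⁻ ξ in Metric.closedBall (0 : Rn n) A,
      ENNReal.ofReal (lapSymbol s ξ)⁻¹ ≤ ENNReal.ofReal (c ^ 2 * A ^ ((n : ℝ) - 2 * s)))
    (hE : energy s u ≤ ENNReal.ofReal (B ^ 2)) :
    volume {x | l < ‖u x‖} ≤ ENNReal.ofReal (4 / l ^ 2) *
      ∫⁻ ξ, {ξ : Rn n | l < 2 * c * B * ‖ξ‖ ^ (((n : ℝ) - 2 * s) / 2)}.indicator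
        (fun ξ => ‖fourierL2 u ξ‖ₑ ^ 2) ξ := by
  have : NeZero n := ⟨hn.ne'⟩
  have hd : 0 < ((n : ℝ) - 2 * s) := by linarith
  -- The radius is chosen so that c A^{(n-2s)/2} B = l/2, the Cauchy–Schwarz bound for the L¹ norm
  -- of the low frequencies.
  set A : ℝ := (l / (2 * c * B)) ^ (2 / ((n : ℝ) - 2 * s)) with hAdef
  have hA : 0 < A := by positivity
  have hAp : A ^ (((n : ℝ) - 2 * s) / 2) = l / (2 * c * B) := by
    rw [hAdef, ← Real.rpow_mul (by positivity)]
    have : 2 / ((n : ℝ) - 2 * s) * (((n : ℝ) - 2 * s) / 2) = 1 := by field_simp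
    rw [this, Real.rpow_one]
  set S := Metric.closedBall (0 : Rn n) A with hS
  have hSm : MeasurableSet S := Metric.isClosed_closedBall.measurableSet
  set v := S.indicator (fourierL2 u) with hv
  have hv2 : MemLp v 2 volume := (memLp_fourierL2 u).indicator hSm
  have hv1 : Integrable v := by
    rw [hv, integrable_indicator_iff hSm]
    have : IsFiniteMeasure (volume.restrict S) :=
      ⟨by simpa using (Metric.isBounded_closedBall).measure_lt_top⟩
    exact ((memLp_fourierL2 u).restrict S).integrable (by norm_num)
  have hvbd : ∫⁻ ξ, ‖v ξ‖ₑ ≤ ENNReal.ofReal (l / 2) := by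
    have e1 : ∫⁻ ξ, ‖v ξ‖ₑ = ∫⁻ ξ in S, ‖fourierL2 u ξ‖ₑ := by
      rw [← lintegral_indicator hSm]
      refine lintegral_congr fun ξ => ?_
      rw [hv, enorm_indicator_eq_indicator_enorm]
    have e2 : ∫⁻ ξ in S, ‖fourierL2 u ξ‖ₑ = ∫⁻ ξ in S,
        ENNReal.ofReal (Real.sqrt (lapSymbol s ξ)⁻¹) *
          (ENNReal.ofReal (Real.sqrt (lapSymbol s ξ)) * ‖fourierL2 u ξ‖ₑ) := by
      refine lintegral_congr_ae (ae_restrict_of_ae ?_)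
      filter_upwards [Measure.ae_ne volume (0 : Rn n)] with ξ hξ
      have hp : 0 < lapSymbol s ξ := by
        have := norm_pos_iff.2 hξ
        unfold lapSymbol; positivity
      rw [← mul_assoc, ← ENNReal.ofReal_mul (Real.sqrt_nonneg _), ← Real.sqrt_mul (by positivity),
        inv_mul_cancel₀ hp.ne', Real.sqrt_one, ENNReal.ofReal_one, one_mul]
    rw [e1, e2]
    refine (lintegral_mul_sq_le ?_ ?_).trans ?_
    · exact ((measurable_lapSymbol s).inv.sqrt.ennreal_ofReal).aemeasurable
    · exact ((measurable_lapSymbol s).sqrt.ennreal_ofReal.aemeasurable).mul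
        (aestronglyMeasurable_fourierL2 u).enorm.restrict
    have e3 : ∫⁻ ξ in S, ENNReal.ofReal (Real.sqrt (lapSymbol s ξ)⁻¹) ^ 2 ≤
        ENNReal.ofReal (c ^ 2 * A ^ ((n : ℝ) - 2 * s)) := by
      refine le_trans (le_of_eq (lintegral_congr fun ξ => ?_)) (hcA A hA)
      rw [← ENNReal.ofReal_pow (Real.sqrt_nonneg _), Real.sq_sqrt (inv_nonneg.2 (lapSymbol_nonneg s ξ))]
    have e4 : ∫⁻ ξ in S, (ENNReal.ofReal (Real.sqrt (lapSymbol s ξ)) * ‖fourierL2 u ξ‖ₑ) ^ 2 ≤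
        ENNReal.ofReal (B ^ 2) := by
      refine le_trans ((setLIntegral_le_lintegral _ _).trans
        (le_of_eq (lintegral_congr fun ξ => ?_))) hE
      rw [mul_pow, ← ENNReal.ofReal_pow (Real.sqrt_nonneg _), Real.sq_sqrt (lapSymbol_nonneg s ξ)]
    refine (mul_le_mul' (ENNReal.rpow_le_rpow e3 (by norm_num))
      (ENNReal.rpow_le_rpow e4 (by norm_num))).trans (le_of_eq ?_)
    rw [ENNReal.ofReal_rpow_of_nonneg (by positivity) (by norm_num),
      ENNReal.ofReal_rpow_of_nonneg (by positivity) (by norm_num),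
      ← ENNReal.ofReal_mul (by positivity)]
    congr 1
    rw [Real.mul_rpow (by positivity) (by positivity), ← Real.rpow_mul hA.le, mul_one_div, hAp,
      ← Real.sqrt_eq_rpow, ← Real.sqrt_eq_rpow, Real.sqrt_sq hc.le, Real.sqrt_sq hB.le]
    field_simp
  obtain ⟨w, hw, hwv⟩ := exists_fourierL2_eq hv2
  have hwb := ae_enorm_le_of_fourierL2 hw hwv hv1
  have hsub : ∫⁻ x, ‖u x - w x‖ₑ ^ 2 ≤
      ∫⁻ ξ, {ξ : Rn n | l < 2 * c * B * ‖ξ‖ ^ (((n : ℝ) - 2 * s) / 2)}.indicator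
        (fun ξ => ‖fourierL2 u ξ‖ₑ ^ 2) ξ := by
    have := lintegral_fourierL2 (hu.sub hw)
    change _ = ∫⁻ x, ‖u x - w x‖ₑ ^ 2 at this
    rw [← this]
    refine lintegral_mono_ae ?_
    filter_upwards [fourierL2_sub hu hw, hwv] with ξ h1 h2
    change ‖fourierL2 (fun x => u x - w x) ξ‖ₑ ^ 2 ≤ _
    rw [h1, h2, hv]
    by_cases hξ : ξ ∈ S
    · simp [hξ]
    · have hξ' : A < ‖ξ‖ := by simpa [hS] using hξ
      have h3 : l < 2 * c * B * ‖ξ‖ ^ (((n : ℝ) - 2 * s) / 2) := by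
        have := Real.rpow_lt_rpow hA.le hξ' (z := ((n : ℝ) - 2 * s) / 2) (by positivity)
        rw [hAp, div_lt_iff₀' (by positivity)] at this
        exact this
      simp [hξ, h3]
  have hl2 : ENNReal.ofReal (l / 2) ≠ 0 := by simpa using hl
  calc volume {x | l < ‖u x‖} ≤ volume {x | ENNReal.ofReal ((l / 2) ^ 2) ≤ ‖u x - w x‖ₑ ^ 2} := by
        refine measure_mono_ae ?_
        filter_upwards [hwb] with x hx (hlx : l < ‖u x‖)
        have h1 : ‖w x‖ ≤ l / 2 := by
          have := hx.trans hvbd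
          rwa [← ofReal_norm, ENNReal.ofReal_le_ofReal_iff (by positivity)] at this
        have h2 : l / 2 ≤ ‖u x - w x‖ := by linarith [norm_sub_norm_le (u x) (w x)]
        change _ ≤ _
        rw [← ofReal_norm, ← ENNReal.ofReal_pow (norm_nonneg _)]
        exact ENNReal.ofReal_le_ofReal (by gcongr)
    _ ≤ ENNReal.ofReal (4 / l ^ 2) * ∫⁻ x, ‖u x - w x‖ₑ ^ 2 := by
        have := mul_meas_ge_le_lintegral₀ (μ := (volume : Measure (Rn n)))
          (((hu.sub hw).1.enorm.pow_const 2)) (ENNReal.ofReal ((l / 2) ^ 2))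
        have h4 : ENNReal.ofReal (4 / l ^ 2) * ENNReal.ofReal ((l / 2) ^ 2) = 1 := by
          rw [← ENNReal.ofReal_mul (by positivity)]
          have : 4 / l ^ 2 * (l / 2) ^ 2 = 1 := by field_simp; norm_num
          rw [this, ENNReal.ofReal_one]
        calc _ = ENNReal.ofReal (4 / l ^ 2) * (ENNReal.ofReal ((l / 2) ^ 2) *
              volume {x | ENNReal.ofReal ((l / 2) ^ 2) ≤ ‖u x - w x‖ₑ ^ 2}) := by
              rw [← mul_assoc, h4, one_mul]
          _ ≤ _ := by gcongr; exact this
    _ ≤ _ := by gcongr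

/-- The Sobolev exponent `2n/(n-2s)`. -/
def sobExp (n : ℕ) (s : ℝ) : ℝ := 2 * n / ((n : ℝ) - 2 * s)

theorem two_lt_sobExp {s : ℝ} (hs0 : 0 < s) (hsn : 2 * s < n) : 2 < sobExp n s := by
  unfold sobExp
  rw [lt_div_iff₀ (by linarith)]
  linarith

/-- The layer-cake formula with the level-dependent cut of `meas_lt_norm_le`. Exchanging the
integrals in l and ξ leaves T(ξ)^{q-2}, where T is proportional to |ξ|^{(n-2s)/2}; as (q-2)(n-2s)/2
= 2s, this is the symbol of the energy. -/
theorem lintegral_sobExp_le_of_energy_le (hn : 0 < n) {s : ℝ} (hs0 : 0 < s) (hsn : 2 * s < n) :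
    ∃ K : ℝ, 0 < K ∧ ∀ (u : Rn n → ℂ) (B : ℝ), MemLp u 2 volume → 0 < B →
      energy s u ≤ ENNReal.ofReal (B ^ 2) →
      ∫⁻ x, ‖u x‖ₑ ^ sobExp n s ≤ ENNReal.ofReal (K * B ^ sobExp n s) := by
  obtain ⟨c, hc, hcA⟩ := exists_lintegral_inv_lapSymbol_le hn hsn
  set q := sobExp n s with hq
  have hq2 : 2 < q := two_lt_sobExp hs0 hsn
  have hd : 0 < ((n : ℝ) - 2 * s) := by linarith
  refine ⟨q * (4 / (q - 2) * (2 * c) ^ (q - 2)), by have := sub_pos.2 hq2; positivity,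
    fun u B hu hB hE => ?_⟩
  set T : Rn n → ℝ := fun ξ => 2 * c * B * ‖ξ‖ ^ (((n : ℝ) - 2 * s) / 2) with hT
  have hT0 (ξ : Rn n) : 0 ≤ T ξ := by simp only [hT]; positivity
  have hTm : Measurable T := by simp only [hT]; fun_prop
  have hTq (ξ : Rn n) : T ξ ^ (q - 2) = (2 * c * B) ^ (q - 2) * ‖ξ‖ ^ (2 * s) := by
    simp only [hT]
    rw [Real.mul_rpow (by positivity) (by positivity), ← Real.rpow_mul (norm_nonneg _)]
    congr 2
    rw [hq, sobExp]; field_simp; ring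
  have e0 : ∫⁻ x, ‖u x‖ₑ ^ q = ∫⁻ x, ENNReal.ofReal (‖u x‖ ^ q) := lintegral_congr fun x => by
    rw [← ofReal_norm, ENNReal.ofReal_rpow_of_nonneg (norm_nonneg _) (by linarith)]
  rw [e0, lintegral_rpow_eq_lintegral_meas_lt_mul volume (.of_forall fun x => norm_nonneg _)
    hu.1.norm.aemeasurable (by linarith)]
  have hFm := (aestronglyMeasurable_fourierL2 u).enorm.pow_const 2
  calc _ ≤ ENNReal.ofReal q * ∫⁻ l in Set.Ioi (0 : ℝ), ∫⁻ ξ,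
        ENNReal.ofReal (4 * l ^ (q - 3)) * ({z : ℝ × Rn n | z.1 < T z.2}.indicator
          (fun z => ‖fourierL2 u z.2‖ₑ ^ 2) (l, ξ)) := by
        refine mul_le_mul' le_rfl
          (setLIntegral_mono_ae' measurableSet_Ioi (.of_forall fun l (hl : 0 < l) => ?_))
        rw [lintegral_const_mul' _ _ ENNReal.ofReal_ne_top]
        refine (mul_le_mul_left (meas_lt_norm_le hu hn hsn hc hB hl hcA hE) _).trans (le_of_eq ?_)
        rw [mul_right_comm, ← ENNReal.ofReal_mul (by positivity)]
        congr 2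
        rw [div_eq_mul_inv, mul_assoc, ← Real.rpow_two, ← Real.rpow_neg hl.le, ← Real.rpow_add hl]
        congr 2; ring
    _ = ENNReal.ofReal q * ∫⁻ ξ, ∫⁻ l in Set.Ioi (0 : ℝ),
        ENNReal.ofReal (4 * l ^ (q - 3)) * ({z : ℝ × Rn n | z.1 < T z.2}.indicator
          (fun z => ‖fourierL2 u z.2‖ₑ ^ 2) (l, ξ)) := by
        congr 1
        refine lintegral_lintegral_swap ?_
        refine AEMeasurable.mul (Measurable.aemeasurable (by fun_prop)) ?_
        refine AEMeasurable.indicator ?_ (measurableSet_lt measurable_fst (hTm.comp measurable_snd))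
        exact ((aestronglyMeasurable_fourierL2 u).comp_snd).enorm.pow_const 2
    _ ≤ ENNReal.ofReal q * ∫⁻ ξ, ENNReal.ofReal (4 / (q - 2) * (2 * c * B) ^ (q - 2)) *
        (ENNReal.ofReal (lapSymbol s ξ) * ‖fourierL2 u ξ‖ₑ ^ 2) := by
        gcongr with ξ
        have e1 : ∫⁻ l in Set.Ioi (0 : ℝ), ENNReal.ofReal (4 * l ^ (q - 3)) *
            ({z : ℝ × Rn n | z.1 < T z.2}.indicator (fun z => ‖fourierL2 u z.2‖ₑ ^ 2) (l, ξ)) ≤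
            (∫⁻ l in Set.Ioc (0 : ℝ) (T ξ), ENNReal.ofReal (4 * l ^ (q - 3))) *
              ‖fourierL2 u ξ‖ₑ ^ 2 := by
          rw [← lintegral_mul_const _ (by fun_prop), ← lintegral_indicator measurableSet_Ioi,
            ← lintegral_indicator measurableSet_Ioc]
          refine lintegral_mono fun l => ?_
          by_cases h1 : 0 < l <;> by_cases h2 : l < T ξ <;> simp [Set.indicator, h1, h2, le_of_lt]
        refine e1.trans ?_
        have hi : IntervalIntegrable (fun l : ℝ => 4 * l ^ (q - 3)) volume 0 (T ξ) :=
          (intervalIntegral.intervalIntegrable_rpow' (by linarith)).const_mul _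
        rw [← ofReal_integral_eq_lintegral_ofReal
          ((intervalIntegrable_iff_integrableOn_Ioc_of_le (hT0 ξ)).1 hi)]
        · rw [← intervalIntegral.integral_of_le (hT0 ξ), intervalIntegral.integral_const_mul,
            integral_rpow (Or.inl (by linarith)), ← mul_assoc, ← ENNReal.ofReal_mul (by
              have := sub_pos.2 hq2; positivity)]
          refine mul_le_mul' (ENNReal.ofReal_le_ofReal ?_) le_rfl
          rw [show q - 3 + 1 = q - 2 by ring, Real.zero_rpow (by linarith), sub_zero, hTq]
          have h3 : ‖ξ‖ ^ (2 * s) ≤ lapSymbol s ξ := by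
            unfold lapSymbol
            gcongr
            nlinarith [norm_nonneg ξ, Real.pi_gt_three]
          have h4 := sub_pos.2 hq2
          calc _ = 4 / (q - 2) * (2 * c * B) ^ (q - 2) * ‖ξ‖ ^ (2 * s) := by ring
            _ ≤ _ := by gcongr
        · refine (ae_restrict_iff' measurableSet_Ioc).2 (.of_forall fun r hr => ?_)
          have := Real.rpow_nonneg hr.1.le (q - 3)
          simp only [Pi.zero_apply]
          positivity
    _ ≤ _ := by
        have h4 := sub_pos.2 hq2
        rw [lintegral_const_mul' _ _ ENNReal.ofReal_ne_top]
        calc _ ≤ ENNReal.ofReal q * (ENNReal.ofReal (4 / (q - 2) * (2 * c * B) ^ (q - 2)) *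
              ENNReal.ofReal (B ^ 2)) := by gcongr; exact hE
          _ = _ := by
            rw [← ENNReal.ofReal_mul (by positivity), ← ENNReal.ofReal_mul (by positivity)]
            congr 1
            have : B ^ q = B ^ (q - 2) * B ^ 2 := by
              rw [← Real.rpow_two, ← Real.rpow_add hB]; congr 1; ring
            rw [Real.mul_rpow (by positivity) hB.le, this]
            ring

/-- The fractional Sobolev inequality. -/
theorem exists_eLpNorm_sobExp_le (hn : 0 < n) {s : ℝ} (hs0 : 0 < s) (hsn : 2 * s < n) :
    ∃ K : NNReal, ∀ u : Rn n → ℂ, MemLp u 2 volume →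
      eLpNorm u (ENNReal.ofReal (sobExp n s)) volume ≤ K * energy s u ^ (1 / 2 : ℝ) := by
  obtain ⟨K, hK, H⟩ := lintegral_sobExp_le_of_energy_le hn hs0 hsn
  set q := sobExp n s with hq
  have hq0 : 0 < q := by linarith [two_lt_sobExp (n := n) hs0 hsn]
  refine ⟨(K ^ (1 / q)).toNNReal, fun u hu => ?_⟩
  have hKp : 0 < K ^ (1 / q) := by positivity
  have key : ∀ B : ℝ, 0 < B → energy s u ≤ ENNReal.ofReal (B ^ 2) →
      eLpNorm u (ENNReal.ofReal q) volume ≤ ENNReal.ofReal (K ^ (1 / q)) * ENNReal.ofReal B := by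
    intro B hB hE
    rw [eLpNorm_eq_lintegral_rpow_enorm_toReal (by simpa using hq0) (by simp),
      ENNReal.toReal_ofReal hq0.le]
    refine (ENNReal.rpow_le_rpow (H u B hu hB hE) (by positivity)).trans (le_of_eq ?_)
    rw [ENNReal.ofReal_rpow_of_nonneg (by positivity) (by positivity),
      ← ENNReal.ofReal_mul (by positivity), Real.mul_rpow (by positivity) (by positivity),
      ← Real.rpow_mul hB.le, mul_one_div_cancel hq0.ne', Real.rpow_one]
  by_cases hE : energy s u = ∞
  · rw [hE, ENNReal.top_rpow_of_pos (by norm_num), ENNReal.mul_top]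
    · exact le_top
    · exact (ENNReal.ofReal_pos.2 hKp).ne'
  change _ ≤ ENNReal.ofReal (K ^ (1 / q)) * _
  -- The previous bound needs B > 0, while the energy may vanish; hence B is the root of the energy
  -- plus a small positive amount.
  refine ENNReal.le_of_forall_pos_le_add fun ε hε _ => ?_
  set b := (energy s u ^ (1 / 2 : ℝ)).toReal with hb
  have hEb : energy s u ^ (1 / 2 : ℝ) = ENNReal.ofReal b :=
    (ENNReal.ofReal_toReal (ENNReal.rpow_ne_top_of_nonneg (by norm_num) hE)).symm
  have hδ : 0 < (ε : ℝ) / K ^ (1 / q) := by positivity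
  have hb0 : 0 ≤ b := ENNReal.toReal_nonneg
  refine (key (b + ε / K ^ (1 / q)) (by positivity) ?_).trans (le_of_eq ?_)
  · have : energy s u = ENNReal.ofReal (b ^ 2) := by
      rw [ENNReal.ofReal_pow hb0, ← hEb, ← ENNReal.rpow_natCast, ← ENNReal.rpow_mul]
      norm_num
    rw [this]
    exact ENNReal.ofReal_le_ofReal (by gcongr; linarith)
  · rw [hEb, ENNReal.ofReal_add hb0 hδ.le, mul_add, ← ENNReal.ofReal_mul hKp.le (q := ε / _),
      mul_div_cancel₀ _ hKp.ne', ENNReal.ofReal_coe_nnreal]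

/-! ### Second differences and the pointwise formula for `(-Δ)^s` -/

/-- The second difference `2 u(x) - u(x + h) - u(x - h)` at `z = (h, x)`. -/
def sdiff (u : Rn n → ℂ) (z : Rn n × Rn n) : ℂ := 2 * u z.2 - u (z.2 + z.1) - u (z.2 - z.1)

/-- The difference is the integral of the directional derivative along the segment from x to x + h,
and the L¹ norm of that derivative is invariant under translation. -/
theorem lintegral_enorm_sub_le {ψ : Rn n → ℂ} (hψ : ContDiff ℝ 1 ψ) (h : Rn n) :
    ∫⁻ x, ‖ψ (x + h) - ψ x‖ₑ ≤ ∫⁻ x, ‖fderiv ℝ ψ x h‖ₑ := by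
  have hc : Continuous fun x => fderiv ℝ ψ x h := (hψ.continuous_fderiv one_ne_zero).clm_apply
    continuous_const
  have key (x : Rn n) : ‖ψ (x + h) - ψ x‖ₑ ≤ ∫⁻ t in Set.Ioc (0 : ℝ) 1, ‖fderiv ℝ ψ (x + t • h) h‖ₑ := by
    have hd : ∀ t ∈ Set.uIcc (0 : ℝ) 1,
        HasDerivAt (fun t : ℝ => ψ (x + t • h)) (fderiv ℝ ψ (x + t • h) h) t := fun t _ => by
      have h1 : HasDerivAt (fun t : ℝ => x + t • h) h t := by
        simpa using ((hasDerivAt_id t).smul_const h).const_add x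
      exact ((hψ.differentiable one_ne_zero).differentiableAt.hasFDerivAt).comp_hasDerivAt t h1
    have e := intervalIntegral.integral_eq_sub_of_hasDerivAt hd
      (Continuous.intervalIntegrable (hc.comp (by fun_prop)) _ _)
    simp only [one_smul, zero_smul, add_zero] at e
    rw [← e, intervalIntegral.integral_of_le zero_le_one]
    exact enorm_integral_le_lintegral_enorm _
  calc _ ≤ ∫⁻ x, ∫⁻ t in Set.Ioc (0 : ℝ) 1, ‖fderiv ℝ ψ (x + t • h) h‖ₑ := lintegral_mono key
    _ = ∫⁻ t in Set.Ioc (0 : ℝ) 1, ∫⁻ x, ‖fderiv ℝ ψ (x + t • h) h‖ₑ := by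
        refine lintegral_lintegral_swap (Continuous.aemeasurable ?_)
        exact (hc.comp (by fun_prop)).enorm
    _ = _ := by
        have (t : ℝ) : ∫⁻ x, ‖fderiv ℝ ψ (x + t • h) h‖ₑ = ∫⁻ x, ‖fderiv ℝ ψ x h‖ₑ :=
          lintegral_add_right_eq_self (fun x => ‖fderiv ℝ ψ x h‖ₑ) (t • h)
        simp [this]

/-- The `L¹` norm of a Schwartz function and of its first two derivatives. -/
def derivSize (φ : 𝓢(Rn n, ℂ)) : ℝ≥0∞ :=
  4 * (∫⁻ x, ‖φ x‖ₑ) + (∫⁻ x, ‖fderiv ℝ φ x‖ₑ) +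
    ∫⁻ x, ‖fderiv ℝ (fun y => fderiv ℝ φ y) x‖ₑ

theorem derivSize_lt_top (φ : 𝓢(Rn n, ℂ)) : derivSize φ < ∞ := by
  let D := SchwartzMap.fderivCLM ℝ (Rn n) ℂ φ
  let D2 := SchwartzMap.fderivCLM ℝ (Rn n) (Rn n →L[ℝ] ℂ) D
  have h0 := (φ.integrable (μ := volume)).2
  have h1 := (D.integrable (μ := volume)).2
  have h2 := (D2.integrable (μ := volume)).2
  exact ENNReal.add_lt_top.2 ⟨ENNReal.add_lt_top.2 ⟨ENNReal.mul_lt_top (by norm_num) h0, h1⟩, h2⟩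

theorem lintegral_comp_add_right (f : Rn n → ℝ≥0∞) (h : Rn n) :
    ∫⁻ x, f (x + h) = ∫⁻ x, f x := lintegral_add_right_eq_self f h

theorem lintegral_comp_sub_right (f : Rn n → ℝ≥0∞) (h : Rn n) :
    ∫⁻ x, f (x - h) = ∫⁻ x, f x := by
  simp_rw [sub_eq_add_neg]; exact lintegral_add_right_eq_self f (-h)

theorem lintegral_diff_schwartz_le (φ : 𝓢(Rn n, ℂ)) (h : Rn n) :
    ∫⁻ x, ‖diff φ (h, x)‖ₑ ≤ derivSize φ * ENNReal.ofReal (min 1 ‖h‖) := by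
  have h1 : ∫⁻ x, ‖diff φ (h, x)‖ₑ ≤ derivSize φ * 1 := by
    calc _ ≤ ∫⁻ x, (‖φ (x + h)‖ₑ + ‖φ x‖ₑ) := lintegral_mono fun x => enorm_sub_le
      _ = (∫⁻ x, ‖φ x‖ₑ) + ∫⁻ x, ‖φ x‖ₑ := by
        rw [lintegral_add_right _ (by fun_prop), lintegral_comp_add_right (fun x => ‖φ x‖ₑ)]
      _ = 2 * ∫⁻ x, ‖φ x‖ₑ := (two_mul _).symm
      _ ≤ 4 * ∫⁻ x, ‖φ x‖ₑ := by gcongr; norm_num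
      _ ≤ _ := by rw [mul_one, derivSize, add_assoc]; exact le_self_add
  have h2 : ∫⁻ x, ‖diff φ (h, x)‖ₑ ≤ derivSize φ * ‖h‖ₑ := by
    refine (lintegral_enorm_sub_le (φ.smooth 1) h).trans ?_
    calc _ ≤ ∫⁻ x, ‖fderiv ℝ φ x‖ₑ * ‖h‖ₑ := lintegral_mono fun x =>
          ContinuousLinearMap.le_opENorm _ _
      _ = (∫⁻ x, ‖fderiv ℝ φ x‖ₑ) * ‖h‖ₑ := lintegral_mul_const' _ _ enorm_ne_top
      _ ≤ _ := by
        gcongr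
        rw [derivSize, add_assoc, add_left_comm]; exact le_self_add
  rcases min_cases 1 ‖h‖ with ⟨e, _⟩ | ⟨e, _⟩
  · rw [e, ENNReal.ofReal_one]; exact h1
  · rw [e, ofReal_norm]; exact h2

/-- The second difference is, up to sign, a first difference of ψ = φ - φ(· - h), so the segment
estimate applies twice and produces |h|². For large h the triangle inequality suffices. The result
is integrable for the Lévy measure. -/
theorem lintegral_sdiff_schwartz_le (φ : 𝓢(Rn n, ℂ)) (h : Rn n) :
    ∫⁻ x, ‖sdiff φ (h, x)‖ₑ ≤ derivSize φ * ENNReal.ofReal (min 1 (‖h‖ ^ 2)) := by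
  have h1 : ∫⁻ x, ‖sdiff φ (h, x)‖ₑ ≤ derivSize φ * 1 := by
    calc _ ≤ ∫⁻ x, (2 * ‖φ x‖ₑ + ‖φ (x + h)‖ₑ + ‖φ (x - h)‖ₑ) := lintegral_mono fun x => by
          refine enorm_sub_le.trans (add_le_add (enorm_sub_le.trans (add_le_add ?_ le_rfl)) le_rfl)
          rw [enorm_mul]; simp [← ofReal_norm]
      _ = 4 * ∫⁻ x, ‖φ x‖ₑ := by
        have hφm : Continuous fun x => ‖φ x‖ₑ := φ.continuous.enorm
        have hp : Measurable fun x => ‖φ (x + h)‖ₑ := (hφm.comp (continuous_add_const h)).measurable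
        have hm : Measurable fun x => ‖φ (x - h)‖ₑ := (hφm.comp (continuous_sub_right h)).measurable
        rw [lintegral_add_right _ hm, lintegral_add_right _ hp, lintegral_comp_add_right (fun x => ‖φ x‖ₑ), lintegral_comp_sub_right (fun x => ‖φ x‖ₑ),
          lintegral_const_mul' _ _ (by norm_num)]
        ring
      _ ≤ _ := by rw [mul_one, derivSize, add_assoc]; exact le_self_add
  have h2 : ∫⁻ x, ‖sdiff φ (h, x)‖ₑ ≤ derivSize φ * ‖h‖ₑ ^ 2 := by
    let D : Rn n → (Rn n →L[ℝ] ℂ) := fun y => fderiv ℝ φ y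
    have hD : ContDiff ℝ 1 D := (φ.smooth 2).fderiv_right (by norm_num)
    let χ : Rn n → ℂ := fun y => D y h
    have hχ : ContDiff ℝ 1 χ := hD.clm_apply contDiff_const
    let ψ : Rn n → ℂ := fun x => φ x - φ (x - h)
    have hψ : ContDiff ℝ 1 ψ := (φ.smooth 1).sub ((φ.smooth 1).comp (by fun_prop))
    have hdφ : Differentiable ℝ φ := (φ.smooth 1).differentiable one_ne_zero
    have hdψ (x : Rn n) : fderiv ℝ ψ x h = χ x - χ (x - h) := by
      simp only [ψ, χ, D]
      have h2 : DifferentiableAt ℝ (fun x => φ (x - h)) x :=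
        hdφ.differentiableAt.comp x (by fun_prop : DifferentiableAt ℝ (fun x => x - h) x)
      rw [fderiv_fun_sub hdφ.differentiableAt h2]
      simp only [sub_eq_add_neg, fderiv_comp_add_right]
      rfl
    calc _ = ∫⁻ x, ‖ψ (x + h) - ψ x‖ₑ := lintegral_congr fun x => by
          rw [← enorm_neg]; congr 1; simp only [ψ, sdiff, add_sub_cancel_right]; ring
      _ ≤ ∫⁻ x, ‖fderiv ℝ ψ x h‖ₑ := lintegral_enorm_sub_le hψ h
      _ = ∫⁻ x, ‖χ (x + h) - χ x‖ₑ := by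
          rw [← lintegral_comp_add_right _ h]
          refine lintegral_congr fun x => ?_
          rw [hdψ, add_sub_cancel_right]
      _ ≤ ∫⁻ x, ‖fderiv ℝ χ x h‖ₑ := lintegral_enorm_sub_le hχ h
      _ ≤ ∫⁻ x, ‖fderiv ℝ D x‖ₑ * ‖h‖ₑ ^ 2 := lintegral_mono fun x => by
          have : fderiv ℝ χ x h = fderiv ℝ D x h h := by
            simp only [χ]
            rw [fderiv_clm_apply (hD.differentiable one_ne_zero).differentiableAt
              (differentiableAt_const _)]
            simp
          rw [this, pow_two, ← mul_assoc]
          refine (ContinuousLinearMap.le_opENorm _ _).trans ?_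
          gcongr
          exact ContinuousLinearMap.le_opENorm _ _
      _ = (∫⁻ x, ‖fderiv ℝ D x‖ₑ) * ‖h‖ₑ ^ 2 := lintegral_mul_const' _ _ (by finiteness)
      _ ≤ _ := by gcongr; rw [derivSize]; exact le_add_self
  rcases min_cases 1 (‖h‖ ^ 2) with ⟨e, _⟩ | ⟨e, _⟩
  · rw [e, ENNReal.ofReal_one]; exact h1
  · rw [e, ENNReal.ofReal_pow (norm_nonneg _), ofReal_norm]; exact h2

theorem aesm_sdiff (s : ℝ) {u : Rn n → ℂ} (hu : AEStronglyMeasurable u volume) :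
    AEStronglyMeasurable (sdiff u) (jump n s) := by
  have h3 : AEStronglyMeasurable (fun z : Rn n × Rn n => u (z.2 - z.1)) (jump n s) := by
    have h := (aesm_add s hu).comp_measurePreserving
      (((measurePreserving_neg_levy s).prod (MeasurePreserving.id volume)))
    refine h.congr (.of_forall fun z => ?_)
    simp [sub_eq_add_neg]
  exact (((aesm_snd s hu).const_mul 2).sub (aesm_add s hu)).sub h3

theorem integrable_sdiff_schwartz (hn : 0 < n) {s : ℝ} (hs0 : 0 < s) (hs1 : s < 1) (φ : 𝓢(Rn n, ℂ)) :
    Integrable (sdiff φ) (jump n s) := by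
  have hm := aesm_sdiff s (φ.continuous.aestronglyMeasurable (μ := volume))
  refine ⟨hm, ?_⟩
  rw [HasFiniteIntegral, lintegral_jump s hm.enorm]
  refine (lintegral_mono (lintegral_sdiff_schwartz_le φ)).trans_lt ?_
  rw [lintegral_const_mul' _ _ (derivSize_lt_top φ).ne]
  exact ENNReal.mul_lt_top (derivSize_lt_top φ) (lintegral_min_levy hn hs0 hs1)

theorem integrable_lapSymbol_mul_schwartz {s : ℝ} (hs : 0 ≤ s) (φ : 𝓢(Rn n, ℂ)) :
    Integrable fun ξ => (lapSymbol s ξ : ℂ) * φ ξ := by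
  have hg := hasTemperateGrowth_besselSymbol (n := n) (2 * s)
  have h := ((SchwartzMap.smulLeftCLM ℂ (fun ξ : Rn n => ((besselSymbol (2 * s) ξ : ℝ) : ℂ)) φ).integrable
    (μ := volume)).const_mul (((2 * Real.pi) ^ (2 * s) : ℝ) : ℂ)
  refine h.mono ((Complex.continuous_ofReal.comp (continuous_lapSymbol hs)).mul
    φ.continuous).aestronglyMeasurable (.of_forall fun ξ => ?_)
  rw [SchwartzMap.smulLeftCLM_apply_apply hg, smul_eq_mul, norm_mul, norm_mul, norm_mul, ← mul_assoc]
  gcongr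
  rw [Complex.norm_real, Complex.norm_real, Complex.norm_real, Real.norm_of_nonneg (lapSymbol_nonneg s ξ),
    Real.norm_of_nonneg (by positivity), Real.norm_of_nonneg (besselSymbol_pos _ ξ).le]
  refine (lapSymbol_le hs ξ).trans (le_of_eq ?_)
  rw [sobWeight, besselSymbol]
  congr 2; ring

/-- The pointwise formula for the fractional Laplacian of a Schwartz function. -/
theorem fracLapSchwartz_eq_integral_sdiff (hn : 0 < n) {s : ℝ} (hs0 : 0 < s) (hs1 : s < 1)
    (φ : 𝓢(Rn n, ℂ)) (x : Rn n) :
    fracLapSchwartz s φ x = (fracConst n s / 2 : ℝ) * ∫ h, sdiff φ (h, x) ∂levy n s := by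
  have hC := fracConst_pos n hs0 hs1
  let c : Rn n → Rn n → ℝ := fun h ξ => 2 - 2 * Real.cos (2 * Real.pi * inner ℝ h ξ)
  have hc0 (h ξ : Rn n) : 0 ≤ c h ξ := by
    simp only [c]; linarith [Real.cos_le_one (2 * Real.pi * inner ℝ h ξ)]
  have hcc : Continuous (Function.uncurry c) := by
    simp only [c]; unfold Function.uncurry; fun_prop
  set G : Rn n → ℂ := fun ξ => wave ξ x * 𝓕 φ ξ with hG
  have hGc : Continuous G := (continuous_wave.comp (Continuous.prodMk_left x)).mul (𝓕 φ).continuous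
  have hGn (ξ : Rn n) : ‖G ξ‖ₑ = ‖𝓕 φ ξ‖ₑ := by
    rw [← ofReal_norm, ← ofReal_norm, hG, norm_mul, norm_wave, one_mul]
  have hcn (h ξ : Rn n) : ‖(c h ξ : ℂ)‖ₑ = ENNReal.ofReal (c h ξ) := by
    rw [← ofReal_norm, Complex.norm_real, Real.norm_of_nonneg (hc0 h ξ)]
  have hLi := integrable_lapSymbol_mul_schwartz hs0.le (𝓕 φ)
  -- Fubini holds because integrating the modulus in h first gives a multiple of |2πξ|^{2s} |𝓕
  -- φ(ξ)|.
  have hcG : Integrable (Function.uncurry fun h ξ => (c h ξ : ℂ) * G ξ) ((levy n s).prod volume) := by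
    have hm : AEStronglyMeasurable (Function.uncurry fun h ξ => (c h ξ : ℂ) * G ξ)
        ((levy n s).prod volume) :=
      ((Complex.continuous_ofReal.comp hcc).mul (hGc.comp continuous_snd)).aestronglyMeasurable
    refine ⟨hm, ?_⟩
    rw [HasFiniteIntegral, lintegral_prod_symm _ hm.enorm]
    have : ∀ ξ, ∫⁻ h, ‖Function.uncurry (fun h ξ => (c h ξ : ℂ) * G ξ) (h, ξ)‖ₑ ∂levy n s =
        ENNReal.ofReal (2 / fracConst n s) * ‖(lapSymbol s ξ : ℂ) * 𝓕 φ ξ‖ₑ := fun ξ => by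
      simp only [Function.uncurry_apply_pair, enorm_mul, hcn, hGn]
      rw [lintegral_mul_const, lintegral_cos_levy hn hs0 hs1, ENNReal.ofReal_mul (by positivity),
        mul_assoc]
      · congr 2
        rw [← ofReal_norm (lapSymbol s ξ : ℂ), Complex.norm_real,
          Real.norm_of_nonneg (lapSymbol_nonneg s ξ)]
      · fun_prop
    simp_rw [this]
    rw [lintegral_const_mul' _ _ ENNReal.ofReal_ne_top]
    exact ENNReal.mul_lt_top ENNReal.ofReal_lt_top hLi.2
  have hinv (y : Rn n) : φ y = ∫ ξ, wave ξ y * 𝓕 φ ξ := by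
    rw [← fourierInv_eq_wave, ← SchwartzMap.fourierInv_coe, FourierTransform.fourierInv_fourier_eq]
  have hwi (y : Rn n) : Integrable fun ξ => wave ξ y * 𝓕 φ ξ := by
    have := ((𝓕 φ).memLp 1 volume)
    have h2 := memLp_one_iff_integrable.1 (memLp_wave_mul this y)
    simpa only [wave_comm y] using h2
  have hs (h : Rn n) : sdiff φ (h, x) = ∫ ξ, (c h ξ : ℂ) * G ξ := by
    have h2 : Integrable fun ξ => 2 * (wave ξ x * 𝓕 φ ξ) - wave ξ (x + h) * 𝓕 φ ξ :=
      ((hwi x).const_mul 2).sub (hwi _)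
    rw [sdiff, hinv x, hinv (x + h), hinv (x - h), ← integral_const_mul, ← integral_sub
      ((hwi x).const_mul 2) (hwi _), ← integral_sub h2 (hwi _)]
    refine integral_congr_ae (.of_forall fun ξ => ?_)
    have e := wave_add_neg h ξ
    simp only [c, hG]
    rw [wave_comm ξ (x + h), wave_comm ξ (x - h), sub_eq_add_neg x h, wave_add, wave_add, wave_neg,
      wave_comm ξ x]
    push_cast at e ⊢
    linear_combination (-wave x ξ * 𝓕 φ ξ) * e
  calc _ = ∫ ξ, (lapSymbol s ξ : ℂ) * G ξ := by
        rw [fracLapSchwartz, fourierInv_eq_wave]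
        refine integral_congr_ae (.of_forall fun ξ => ?_)
        simp only [hG, SchwartzMap.fourier_coe]; ring
    _ = (fracConst n s / 2 : ℝ) * ∫ ξ, ∫ h, (c h ξ : ℂ) * G ξ ∂levy n s := by
        rw [← integral_const_mul]
        refine integral_congr_ae (.of_forall fun ξ => ?_)
        beta_reduce
        rw [integral_mul_const, integral_complex_ofReal,
          integral_eq_lintegral_of_nonneg_ae (.of_forall fun h => hc0 h ξ), lintegral_cos_levy hn hs0 hs1,
          ENNReal.toReal_ofReal (mul_nonneg (by positivity) (lapSymbol_nonneg s ξ))]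
        · push_cast
          have : (fracConst n s : ℂ) ≠ 0 := by exact_mod_cast hC.ne'
          field_simp
        · simp only [c]
          exact Continuous.aestronglyMeasurable (by fun_prop)
    _ = (fracConst n s / 2 : ℝ) * ∫ h, (∫ ξ, (c h ξ : ℂ) * G ξ) ∂levy n s := by
        rw [integral_integral_swap hcG]
    _ = _ := by simp_rw [hs]

/-! ### Mollification -/

/-- The convolution of `f` and `ρ`. -/
def moll (f ρ : Rn n → ℂ) (x : Rn n) : ℂ := ∫ z, f z * ρ (x - z)

theorem continuous_moll {f ρ : Rn n → ℂ} (hf : LocallyIntegrable f volume) (hρ : Continuous ρ)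
    (hc : HasCompactSupport ρ) : Continuous (moll f ρ) :=
  hc.continuous_convolution_right (L := ContinuousLinearMap.mul ℂ ℂ) hf hρ

/-- The Schwartz function `z ↦ ρ(x - z)`. -/
def reflect (ρ : 𝓢(Rn n, ℂ)) (x : Rn n) : 𝓢(Rn n, ℂ) :=
  SchwartzMap.compSubConstCLM ℂ x
    (SchwartzMap.compCLMOfContinuousLinearEquiv ℂ (ContinuousLinearEquiv.neg ℝ (M := Rn n)) ρ)

theorem reflect_apply (ρ : 𝓢(Rn n, ℂ)) (x z : Rn n) : reflect ρ x z = ρ (x - z) := by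
  show ρ (-(z - x)) = ρ (x - z)
  rw [neg_sub]

theorem integral_sub_sub {α : Type*} [MeasurableSpace α] {μ : Measure α} {f g k : α → ℂ}
    (hf : Integrable f μ) (hg : Integrable g μ) (hk : Integrable k μ) :
    ∫ x, (f x - g x - k x) ∂μ = (∫ x, f x ∂μ) - (∫ x, g x ∂μ) - ∫ x, k x ∂μ := by
  rw [← integral_sub hf hg]
  exact integral_sub (hf.sub hg) hk

theorem sdiff_reflect (ρ : 𝓢(Rn n, ℂ)) (x h z : Rn n) :
    sdiff (reflect ρ x) (h, z) = sdiff ρ (h, x - z) := by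
  simp only [sdiff, reflect_apply]
  rw [show x - (z + h) = x - z - h by abel, show x - (z - h) = x - z + h by abel]
  ring

theorem enorm_moll_le {f : Rn n → ℂ} {M : ℝ≥0∞} (hM : M ≠ ∞) (hf : ∀ᵐ z, ‖f z‖ₑ ≤ M)
    (ρ : Rn n → ℂ) (x : Rn n) : ‖moll f ρ x‖ₑ ≤ M * ∫⁻ z, ‖ρ z‖ₑ := by
  refine (enorm_integral_le_lintegral_enorm _).trans ?_
  calc _ ≤ ∫⁻ z, M * ‖ρ (x - z)‖ₑ := lintegral_mono_ae (by
        filter_upwards [hf] with z hz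
        rw [enorm_mul]
        exact mul_le_mul' hz le_rfl)
    _ = M * ∫⁻ z, ‖ρ z‖ₑ := by
        rw [lintegral_const_mul' _ _ hM, lintegral_sub_left_eq_self (fun z => ‖ρ z‖ₑ) x]

theorem integrable_mul_comp_sub {f : Rn n → ℂ} {M : ℝ} (hfm : AEStronglyMeasurable f volume)
    (hf : ∀ᵐ z, ‖f z‖ ≤ M) (ρ : 𝓢(Rn n, ℂ)) (x : Rn n) :
    Integrable fun z => f z * ρ (x - z) := by
  have : Integrable (fun z => ρ (x - z)) :=
    ((reflect ρ x).integrable (μ := volume)).congr (.of_forall (reflect_apply ρ x))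
  exact this.bdd_mul hfm hf

section Bounded

variable {f : Rn n → ℂ} {M : ℝ} (hfm : AEStronglyMeasurable f volume) (hf : ∀ᵐ z, ‖f z‖ ≤ M)

include hfm hf

theorem diff_moll (ρ : 𝓢(Rn n, ℂ)) (h x : Rn n) :
    diff (moll f ρ) (h, x) = moll f (fun y => diff ρ (h, y)) x := by
  simp only [diff, moll]
  rw [← integral_sub (integrable_mul_comp_sub hfm hf ρ _) (integrable_mul_comp_sub hfm hf ρ _)]
  refine integral_congr_ae (.of_forall fun z => ?_)
  simp only
  rw [show x + h - z = x - z + h by abel]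
  ring

theorem sdiff_moll (ρ : 𝓢(Rn n, ℂ)) (h x : Rn n) :
    sdiff (moll f ρ) (h, x) = moll f (fun y => sdiff ρ (h, y)) x := by
  simp only [sdiff, moll]
  rw [← integral_const_mul, ← integral_sub_sub ((integrable_mul_comp_sub hfm hf ρ _).const_mul 2)
    (integrable_mul_comp_sub hfm hf ρ _) (integrable_mul_comp_sub hfm hf ρ _)]
  refine integral_congr_ae (.of_forall fun z => ?_)
  simp only
  rw [show x + h - z = x - z + h by abel, show x - h - z = x - z - h by abel]
  ring

omit hfm in
theorem enorm_le_ofReal : ∀ᵐ z, ‖f z‖ₑ ≤ ENNReal.ofReal M := by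
  filter_upwards [hf] with z hz
  rw [← ofReal_norm]
  exact ENNReal.ofReal_le_ofReal hz

/-- The difference can be moved from the merely bounded f to the smooth ρ, whose differences are
small in L¹. -/
theorem enorm_diff_moll_le (ρ : 𝓢(Rn n, ℂ)) (h x : Rn n) :
    ‖diff (moll f ρ) (h, x)‖ₑ ≤
      ENNReal.ofReal M * derivSize ρ * ENNReal.ofReal (min 1 ‖h‖) := by
  rw [diff_moll hfm hf, mul_assoc]
  exact (enorm_moll_le ENNReal.ofReal_ne_top (enorm_le_ofReal hf) _ x).trans
    (mul_le_mul' le_rfl (lintegral_diff_schwartz_le ρ h))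

theorem enorm_sdiff_moll_le (ρ : 𝓢(Rn n, ℂ)) (h x : Rn n) :
    ‖sdiff (moll f ρ) (h, x)‖ₑ ≤
      ENNReal.ofReal M * derivSize ρ * ENNReal.ofReal (min 1 (‖h‖ ^ 2)) := by
  rw [sdiff_moll hfm hf, mul_assoc]
  exact (enorm_moll_le ENNReal.ofReal_ne_top (enorm_le_ofReal hf) _ x).trans
    (mul_le_mul' le_rfl (lintegral_sdiff_schwartz_le ρ h))

end Bounded

/-- Discrete integration by parts: after translating the terms, the second difference of F against g
becomes the product of the first differences. With F bounded and g in L¹ every term is integrable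
for fixed h. -/
theorem integral_sdiff_mul {F g : Rn n → ℂ} {M : ℝ} (hFm : AEStronglyMeasurable F volume)
    (hF : ∀ᵐ x, ‖F x‖ ≤ M) (hg : Integrable g) (h : Rn n) :
    ∫ x, sdiff F (h, x) * g x = ∫ x, diff F (h, x) * diff g (h, x) := by
  have hFp : AEStronglyMeasurable (fun x => F (x + h)) volume :=
    hFm.comp_measurePreserving (measurePreserving_add_right volume h)
  have hFq : AEStronglyMeasurable (fun x => F (x - h)) volume :=
    hFm.comp_measurePreserving (measurePreserving_sub_right volume h)
  have hp : ∀ᵐ x, ‖F (x + h)‖ ≤ M :=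
    (measurePreserving_add_right volume h).quasiMeasurePreserving.ae hF
  have hq : ∀ᵐ x, ‖F (x - h)‖ ≤ M :=
    (measurePreserving_sub_right volume h).quasiMeasurePreserving.ae hF
  have i1 : Integrable fun x => F x * g x := hg.bdd_mul hFm hF
  have i2 : Integrable fun x => F (x + h) * g x := hg.bdd_mul hFp hp
  have i3 : Integrable fun x => F (x - h) * g x := hg.bdd_mul hFq hq
  have i4 : Integrable fun x => F (x + h) * g (x + h) := (hg.comp_add_right h).bdd_mul hFp hp
  have i5 : Integrable fun x => F x * g (x + h) := (hg.comp_add_right h).bdd_mul hFm hF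
  have e4 : ∫ x, F (x + h) * g (x + h) = ∫ x, F x * g x :=
    integral_add_right_eq_self (fun x => F x * g x) h
  have e5 : ∫ x, F x * g (x + h) = ∫ x, F (x - h) * g x := by
    rw [← integral_add_right_eq_self (fun x => F (x - h) * g x) h]
    simp
  calc _ = ∫ x, (2 * (F x * g x) - F (x + h) * g x - F (x - h) * g x) :=
        integral_congr_ae (.of_forall fun x => by simp only [sdiff]; ring)
    _ = 2 * (∫ x, F x * g x) - (∫ x, F (x + h) * g x) - ∫ x, F (x - h) * g x := by
        rw [integral_sub_sub (i1.const_mul 2) i2 i3, integral_const_mul]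
    _ = ∫ x, (F (x + h) * g (x + h) - F x * g (x + h) - (F (x + h) * g x - F x * g x)) := by
        have i6 : Integrable fun x => F (x + h) * g x - F x * g x := i2.sub i1
        rw [integral_sub_sub i4 i5 i6, integral_sub i2 i1, e4, e5]
        ring
    _ = _ := integral_congr_ae (.of_forall fun x => by simp only [diff]; ring)

/-- The distributional identity for L is tested with z ↦ ρ(x - z), for which the pointwise formula
holds. Fubini then moves the second difference outside the convolution. -/
theorem moll_fracLap (hn : 0 < n) {s : ℝ} (hs0 : 0 < s) (hs1 : s < 1) {p : ℝ≥0∞} {m L : Rn n → ℝ}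
    (hL : IsFracLap s p m L) {M : ℝ} (hmm : AEStronglyMeasurable (fun x => (m x : ℂ)) volume)
    (hM : ∀ᵐ z, ‖(m z : ℂ)‖ ≤ M) (ρ : 𝓢(Rn n, ℂ)) (x : Rn n) :
    moll (fun z => (L z : ℂ)) ρ x =
      (fracConst n s / 2 : ℝ) * ∫ h, sdiff (moll (fun z => (m z : ℂ)) ρ) (h, x) ∂levy n s := by
  have hint : Integrable (fun w : Rn n × Rn n => (m w.2 : ℂ) * sdiff (reflect ρ x) w) (jump n s) :=
    (integrable_sdiff_schwartz hn hs0 hs1 (reflect ρ x)).bdd_mul (aesm_snd s hmm)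
      ((quasiMeasurePreserving_snd_jump s).ae hM)
  have h1 : moll (fun z => (L z : ℂ)) ρ x = ∫ z, (L z : ℂ) * reflect ρ x z := by
    simp only [moll, reflect_apply]
  rw [h1, (hL.2 (reflect ρ x)).2]
  calc _ = ∫ z, ((fracConst n s / 2 : ℝ) : ℂ) *
        ∫ h, (m z : ℂ) * sdiff (reflect ρ x) (h, z) ∂levy n s := by
        refine integral_congr_ae (.of_forall fun z => ?_)
        simp only
        rw [fracLapSchwartz_eq_integral_sdiff hn hs0 hs1, integral_const_mul]
        ring
    _ = _ := by
        rw [integral_const_mul, ← integral_integral_swap hint]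
        congr 1
        refine integral_congr_ae (.of_forall fun h => ?_)
        simp only
        rw [sdiff_moll hmm hM, moll]
        simp only [sdiff_reflect]

/-- Weak formulation for the mollified m. The side with second differences converges absolutely,
thanks to the bound min(1, |h|²). The side with first differences need not do so for g merely in L¹,
hence the hypothesis `hint`. -/
theorem integral_moll_fracLap_mul (hn : 0 < n) {s : ℝ} (hs0 : 0 < s) (hs1 : s < 1) {p : ℝ≥0∞}
    {m L : Rn n → ℝ} (hL : IsFracLap s p m L) {M : ℝ}
    (hmm : AEStronglyMeasurable (fun x => (m x : ℂ)) volume)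
    (hM : ∀ᵐ z, ‖(m z : ℂ)‖ ≤ M) (ρ : 𝓢(Rn n, ℂ)) (hρ : HasCompactSupport ρ) {g : Rn n → ℂ}
    (hg : Integrable g)
    (hint : Integrable (fun z => diff (moll (fun z => (m z : ℂ)) ρ) z * diff g z) (jump n s)) :
    ∫ x, moll (fun z => (L z : ℂ)) ρ x * g x =
      (fracConst n s / 2 : ℝ) *
        ∫ z, diff (moll (fun z => (m z : ℂ)) ρ) z * diff g z ∂jump n s := by
  set F := moll (fun z => (m z : ℂ)) ρ with hFdef
  have hloc : LocallyIntegrable (fun z => (m z : ℂ)) volume :=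
    (memLp_top_of_bound hmm M hM).locallyIntegrable le_top
  have hFc : Continuous F := continuous_moll hloc ρ.continuous hρ
  have hFm : AEStronglyMeasurable F volume := hFc.aestronglyMeasurable
  have hB : ENNReal.ofReal M * derivSize ρ < ∞ :=
    ENNReal.mul_lt_top ENNReal.ofReal_lt_top (derivSize_lt_top ρ)
  have hFb : ∃ M', ∀ᵐ x, ‖F x‖ ≤ M' := by
    refine ⟨(ENNReal.ofReal M * ∫⁻ z, ‖ρ z‖ₑ).toReal, .of_forall fun x => ?_⟩
    have := enorm_moll_le ENNReal.ofReal_ne_top (enorm_le_ofReal hM) ρ x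
    rw [← toReal_enorm]
    exact ENNReal.toReal_mono (ENNReal.mul_ne_top ENNReal.ofReal_ne_top
      (ρ.integrable (μ := volume)).2.ne) this
  obtain ⟨M', hM'⟩ := hFb
  have hint2 : Integrable (fun z : Rn n × Rn n => sdiff F z * g z.2) (jump n s) := by
    have hm2 : AEStronglyMeasurable (fun z : Rn n × Rn n => sdiff F z * g z.2) (jump n s) :=
      (aesm_sdiff s hFm).mul (aesm_snd s hg.1)
    refine ⟨hm2, ?_⟩
    rw [HasFiniteIntegral, lintegral_jump s hm2.enorm]
    calc _ ≤ ∫⁻ h, (ENNReal.ofReal M * derivSize ρ * ∫⁻ x, ‖g x‖ₑ) *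
          ENNReal.ofReal (min 1 (‖h‖ ^ 2)) ∂levy n s := by
          refine lintegral_mono fun h => ?_
          calc _ ≤ ∫⁻ x, (ENNReal.ofReal M * derivSize ρ * ENNReal.ofReal (min 1 (‖h‖ ^ 2))) *
                ‖g x‖ₑ := lintegral_mono fun x => by
                rw [enorm_mul]
                exact mul_le_mul' (enorm_sdiff_moll_le hmm hM ρ h x) le_rfl
            _ = _ := by
                rw [lintegral_const_mul' _ _ (ENNReal.mul_lt_top hB ENNReal.ofReal_lt_top).ne]
                ring
      _ = (ENNReal.ofReal M * derivSize ρ * ∫⁻ x, ‖g x‖ₑ) *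
          ∫⁻ h, ENNReal.ofReal (min 1 (‖h‖ ^ 2)) ∂levy n s :=
          lintegral_const_mul' _ _ (ENNReal.mul_lt_top hB hg.2).ne
      _ < ∞ := ENNReal.mul_lt_top (ENNReal.mul_lt_top hB hg.2) (lintegral_min_levy hn hs0 hs1)
  calc _ = ∫ x, ((fracConst n s / 2 : ℝ) : ℂ) * ∫ h, sdiff F (h, x) * g x ∂levy n s := by
        refine integral_congr_ae (.of_forall fun x => ?_)
        simp only
        rw [moll_fracLap hn hs0 hs1 hL hmm hM, integral_mul_const, mul_assoc]
    _ = (fracConst n s / 2 : ℝ) * ∫ h, (∫ x, sdiff F (h, x) * g x) ∂levy n s := by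
        rw [integral_const_mul, ← integral_integral_swap hint2]
    _ = (fracConst n s / 2 : ℝ) * ∫ h, (∫ x, diff F (h, x) * diff g (h, x)) ∂levy n s := by
        congr 1
        exact integral_congr_ae (.of_forall fun h => integral_sdiff_mul hFm hM' hg h)
    _ = _ := by
        rw [jump, integral_prod _ hint]

/-- Averaging against the probability measure |ρ(z)| dz does not increase the p-th power, by Jensen;
integrating in x and using translation invariance gives the bound. -/
theorem eLpNorm_moll_le {f ρ : Rn n → ℂ} (hf : AEStronglyMeasurable f volume)
    (hρ : AEStronglyMeasurable ρ volume) (h1 : ∫⁻ z, ‖ρ z‖ₑ = 1) {p : ℝ≥0∞} (hp : 1 ≤ p) (hp' : p ≠ ∞) :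
    eLpNorm (moll f ρ) p volume ≤ eLpNorm f p volume := by
  have hp0 : p ≠ 0 := (zero_lt_one.trans_le hp).ne'
  have hr : 0 < p.toReal := ENNReal.toReal_pos hp0 hp'
  have hρm : AEMeasurable (fun z => ‖ρ z‖ₑ) volume := hρ.enorm
  let ν : Measure (Rn n) := volume.withDensity fun z => ‖ρ z‖ₑ
  have hν : IsProbabilityMeasure ν := ⟨by
    rw [withDensity_apply _ MeasurableSet.univ, Measure.restrict_univ, h1]⟩
  have hac : ν ≪ volume := withDensity_absolutelyContinuous _ _
  have hx (x : Rn n) : AEStronglyMeasurable (fun z => f (x - z)) volume :=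
    hf.comp_quasiMeasurePreserving (quasiMeasurePreserving_sub_left volume x)
  have key (x : Rn n) : ‖moll f ρ x‖ₑ ^ p.toReal ≤
      ∫⁻ z, ‖ρ z‖ₑ * ‖f (x - z)‖ₑ ^ p.toReal := by
    have e1 : ‖moll f ρ x‖ₑ ≤ eLpNorm (fun z => f (x - z)) 1 ν := by
      rw [eLpNorm_one_eq_lintegral_enorm, lintegral_withDensity_eq_lintegral_mul₀ hρm
        (hx x).enorm]
      refine (enorm_integral_le_lintegral_enorm _).trans_eq ?_
      rw [← lintegral_sub_left_eq_self _ x]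
      refine lintegral_congr fun z => ?_
      rw [enorm_mul, sub_sub_cancel, mul_comm, Pi.mul_apply]
    have e2 := e1.trans (eLpNorm_le_eLpNorm_of_exponent_le hp ((hx x).mono_ac hac))
    rw [eLpNorm_eq_lintegral_rpow_enorm_toReal hp0 hp',
      lintegral_withDensity_eq_lintegral_mul₀ hρm ((hx x).enorm.pow_const _)] at e2
    have e3 := ENNReal.rpow_le_rpow e2 hr.le
    rwa [← ENNReal.rpow_mul, one_div, inv_mul_cancel₀ hr.ne', ENNReal.rpow_one] at e3
  rw [eLpNorm_eq_lintegral_rpow_enorm_toReal hp0 hp', eLpNorm_eq_lintegral_rpow_enorm_toReal hp0 hp']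
  refine ENNReal.rpow_le_rpow ?_ (by positivity)
  have hjm : AEMeasurable (fun w : Rn n × Rn n => ‖ρ w.2‖ₑ * ‖f (w.1 - w.2)‖ₑ ^ p.toReal)
      (volume.prod volume) := by
    refine (hρm.comp_quasiMeasurePreserving Measure.quasiMeasurePreserving_snd).mul (AEMeasurable.pow_const ?_ _)
    exact (hf.comp_quasiMeasurePreserving
      (quasiMeasurePreserving_sub_of_right_invariant volume volume)).enorm
  calc _ ≤ ∫⁻ x, ∫⁻ z, ‖ρ z‖ₑ * ‖f (x - z)‖ₑ ^ p.toReal := lintegral_mono key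
    _ = ∫⁻ z, ∫⁻ x, ‖ρ z‖ₑ * ‖f (x - z)‖ₑ ^ p.toReal := lintegral_lintegral_swap hjm
    _ = ∫⁻ z, ‖ρ z‖ₑ * ∫⁻ x, ‖f x‖ₑ ^ p.toReal := by
        refine lintegral_congr fun z => ?_
        rw [lintegral_const_mul' _ _ enorm_ne_top,
          lintegral_comp_sub_right (fun x => ‖f x‖ₑ ^ p.toReal) z]
    _ = _ := by rw [lintegral_mul_const'' _ hρm, h1, one_mul]

/-- A standard mollifier: smooth densities whose supports shrink to the origin. -/
structure IsMollifier (ρ : ℕ → 𝓢(Rn n, ℂ)) : Prop where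
  compact (k : ℕ) : HasCompactSupport (ρ k)
  real (k : ℕ) : ∃ r : Rn n → ℝ, (∀ x, 0 ≤ r x) ∧ ∀ x, ρ k x = r x
  mass (k : ℕ) : ∫⁻ z, ‖ρ k z‖ₑ = 1
  integral (k : ℕ) : ∫ z, ρ k z = 1
  support (k : ℕ) : Function.support (ρ k) ⊆ Metric.ball 0 (1 / ((k : ℝ) + 1))
  tendsto {f : Rn n → ℂ} (hf : LocallyIntegrable f volume) :
    ∀ᵐ x, Filter.Tendsto (fun k => moll f (ρ k) x) Filter.atTop (nhds (f x))

theorem exists_isMollifier (n : ℕ) : ∃ ρ : ℕ → 𝓢(Rn n, ℂ), IsMollifier ρ := by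
  have hpos (k : ℕ) : 0 < 1 / ((k : ℝ) + 1) := by positivity
  let B (k : ℕ) : ContDiffBump (0 : Rn n) := ⟨1 / ((k : ℝ) + 1) / 2, 1 / ((k : ℝ) + 1),
    half_pos (hpos k), half_lt_self (hpos k)⟩
  let r (k : ℕ) : Rn n → ℝ := (B k).normed volume
  have hc (k : ℕ) : HasCompactSupport fun x => (r k x : ℂ) :=
    (B k).hasCompactSupport_normed.comp_left (g := fun t : ℝ => (t : ℂ)) Complex.ofReal_zero
  have hs (k : ℕ) : ContDiff ℝ (↑(⊤ : ℕ∞)) fun x => (r k x : ℂ) :=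
    Complex.ofRealCLM.contDiff.comp (B k).contDiff_normed
  have hint (k : ℕ) : ∫ x, (r k x : ℂ) = 1 := by
    rw [integral_complex_ofReal, (B k).integral_normed, Complex.ofReal_one]
  have happ (k : ℕ) (x : Rn n) : (hc k).toSchwartzMap (hs k) x = r k x := rfl
  refine ⟨fun k => (hc k).toSchwartzMap (hs k), hc, fun k => ⟨r k, (B k).nonneg_normed, happ k⟩,
    fun k => ?_, hint, fun k => ?_, fun {f} hf => ?_⟩
  · have h1 : ∫⁻ x, ENNReal.ofReal (r k x) = ENNReal.ofReal 1 := by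
      rw [← (B k).integral_normed (μ := (volume : Measure (Rn n))),
        ofReal_integral_eq_lintegral_ofReal (B k).integrable_normed
          (.of_forall (B k).nonneg_normed)]
    rw [← ENNReal.ofReal_one, ← h1]
    refine lintegral_congr fun x => ?_
    rw [happ, ← ofReal_norm, Complex.norm_real, Real.norm_of_nonneg ((B k).nonneg_normed x)]
  · intro x hx
    have : r k x ≠ 0 := fun h0 => hx (by rw [happ, h0, Complex.ofReal_zero])
    have h2 : x ∈ Function.support ((B k).normed volume) := this
    rwa [(B k).support_normed_eq] at h2
  · have h1 : Filter.Tendsto (fun k => (B k).rOut) Filter.atTop (nhds 0) :=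
      tendsto_one_div_add_atTop_nhds_zero_nat
    -- The inner radius is half the outer one. A bounded ratio of radii is what almost everywhere
    -- convergence requires for f merely locally integrable.
    have h2 : ∀ᶠ k in Filter.atTop, (B k).rOut ≤ 2 * (B k).rIn :=
      .of_forall fun k => by show 1 / ((k : ℝ) + 1) ≤ 2 * (1 / ((k : ℝ) + 1) / 2); linarith
    filter_upwards [ContDiffBump.ae_convolution_tendsto_right_of_locallyIntegrable
      (K := 2) h1 h2 hf] with x hx
    refine hx.congr fun k => ?_
    simp only [moll, happ]
    rw [convolution_def, ← integral_sub_left_eq_self _ volume x]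
    refine integral_congr_ae (.of_forall fun z => ?_)
    simp only [ContinuousLinearMap.lsmul_apply, sub_sub_cancel, Complex.real_smul]
    rw [mul_comm]

theorem ofReal_moll {ρ : ℕ → 𝓢(Rn n, ℂ)} (hρ : IsMollifier ρ) (f : Rn n → ℝ) (k : ℕ) (x : Rn n) :
    (((moll (fun z => (f z : ℂ)) (ρ k) x).re : ℝ) : ℂ) = moll (fun z => (f z : ℂ)) (ρ k) x := by
  obtain ⟨r, -, hr⟩ := hρ.real k
  have : moll (fun z => (f z : ℂ)) (ρ k) x = ((∫ z, f z * r (x - z) : ℝ) : ℂ) := by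
    rw [moll, ← integral_complex_ofReal]
    simp [hr]
  rw [this, Complex.ofReal_re]

theorem memLp_of_tendsto_of_le {α : Type*} [MeasurableSpace α] {μ : Measure α} {p C : ℝ≥0∞}
    (hC : C ≠ ∞) {f : ℕ → α → ℂ} {g : α → ℂ} (hf : ∀ k, AEStronglyMeasurable (f k) μ)
    (hb : ∀ k, eLpNorm (f k) p μ ≤ C)
    (hlim : ∀ᵐ x ∂μ, Filter.Tendsto (fun k => f k x) Filter.atTop (nhds (g x))) : MemLp g p μ :=
  ⟨aestronglyMeasurable_of_tendsto_ae _ hf hlim,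
    (Lp.eLpNorm_le_of_ae_tendsto (.of_forall hb) hf hlim).trans_lt hC.lt_top⟩

/-- A bounded sequence in `L^p` that converges almost everywhere converges weakly. -/
theorem tendsto_integral_mul_of_bounded {α : Type*} [MeasurableSpace α] {μ : Measure α}
    {p q C : ℝ≥0∞} [ENNReal.HolderTriple p q 1] (hq1 : 1 ≤ q) (hq : q ≠ ∞) (hC : C ≠ ∞)
    {f : ℕ → α → ℂ} {f₀ g : α → ℂ} (hf : ∀ k, AEStronglyMeasurable (f k) μ)
    (hb : ∀ k, eLpNorm (f k) p μ ≤ C)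
    (hlim : ∀ᵐ x ∂μ, Filter.Tendsto (fun k => f k x) Filter.atTop (nhds (f₀ x)))
    (hg : MemLp g q μ) :
    Filter.Tendsto (fun k => ∫ x, f k x * g x ∂μ) Filter.atTop (nhds (∫ x, f₀ x * g x ∂μ)) := by
  have hf₀ : MemLp f₀ p μ := memLp_of_tendsto_of_le hC hf hb hlim
  have hfk (k : ℕ) : MemLp (f k) p μ := ⟨hf k, (hb k).trans_lt hC.lt_top⟩
  have hprod (k : ℕ) : MemLp (fun x => f k x * g x) 1 μ := hg.mul' (hfk k)
  have hprod₀ : MemLp (fun x => f₀ x * g x) 1 μ := hg.mul' hf₀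
  have hbound (k : ℕ) (S : Set α) (hS : MeasurableSet S) :
      eLpNorm (S.indicator fun x => f k x * g x) 1 μ ≤ C * eLpNorm (S.indicator g) q μ := by
    have : (S.indicator fun x => f k x * g x) = f k • S.indicator g := by
      ext x
      by_cases hx : x ∈ S <;> simp [hx]
    rw [this]
    exact (eLpNorm_smul_le_mul_eLpNorm (p := p) (q := q) (hg.1.indicator hS) (hf k)).trans
      (mul_le_mul' (hb k) le_rfl)
  have hCpos : 0 < C.toReal + 1 := by positivity
  have hCle : C ≤ ENNReal.ofReal (C.toReal + 1) := by
    rw [← ENNReal.ofReal_toReal hC]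
    exact ENNReal.ofReal_le_ofReal (by simp)
  -- Vitali's theorem applies to the products: by Hölder their mass on a set S is at most C times
  -- the L^q norm of g on S. As q < ∞, this is small on small sets and outside a suitable set of
  -- finite measure, uniformly in k.
  have hui : UnifIntegrable (fun k x => f k x * g x) 1 μ := by
    intro ε hε
    obtain ⟨δ, hδ, h⟩ := hg.eLpNorm_indicator_le hq1 hq (div_pos hε hCpos)
    refine ⟨δ, hδ, fun k S hS hμ => (hbound k S hS).trans ((mul_le_mul' hCle (h S hS hμ)).trans ?_)⟩
    rw [← ENNReal.ofReal_mul hCpos.le, mul_div_cancel₀ _ hCpos.ne']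
  have hut : UnifTight (fun k x => f k x * g x) 1 μ := by
    intro ε hε
    obtain ⟨S, hS, hμ, h⟩ := hg.exists_eLpNorm_indicator_compl_lt hq
      (ε := ENNReal.ofReal (ε / (C.toReal + 1))) (by
        rw [Ne, ENNReal.ofReal_eq_zero, not_le]; exact div_pos hε hCpos)
    refine ⟨S, hμ.ne, fun k => (hbound k _ hS.compl).trans ((mul_le_mul' hCle h.le).trans ?_)⟩
    rw [← ENNReal.ofReal_mul hCpos.le, mul_div_cancel₀ _ hCpos.ne', ENNReal.ofReal_coe_nnreal]
  have hL := tendsto_Lp_of_tendsto_ae le_rfl ENNReal.one_ne_top (fun k => (hprod k).1) hprod₀ hui hut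
    (by filter_upwards [hlim] with x hx using hx.mul_const _)
  exact tendsto_integral_of_L1' _ (memLp_one_iff_integrable.1 hprod₀).1 
    (.of_forall fun k => memLp_one_iff_integrable.1 (hprod k)) hL

/-! ### The Caccioppoli inequality -/

theorem holderTriple_sobExp {s : ℝ} (hs0 : 0 < s) (hsn : 2 * s < (n : ℝ)) :
    ENNReal.HolderTriple (ENNReal.ofReal (sobExp n s)) (ENNReal.ofReal (sobExp n s))
      (ENNReal.ofReal ((n : ℝ) / (n - 2 * s))) := by
  have hn : (0 : ℝ) < n := by linarith
  have h1 : 0 < (n : ℝ) - 2 * s := by linarith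
  refine ⟨?_⟩
  unfold sobExp
  rw [← ENNReal.ofReal_inv_of_pos (by positivity), ← ENNReal.ofReal_inv_of_pos (by positivity),
    ← ENNReal.ofReal_add (by positivity) (by positivity)]
  congr 1
  field_simp
  norm_num

theorem holderTriple_fracLap {s : ℝ} (hs0 : 0 < s) (hsn : 2 * s < (n : ℝ)) :
    ENNReal.HolderTriple (ENNReal.ofReal ((n : ℝ) / (2 * s)))
      (ENNReal.ofReal ((n : ℝ) / (n - 2 * s))) 1 := by
  have hn : (0 : ℝ) < n := by linarith
  have h1 : 0 < (n : ℝ) - 2 * s := by linarith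
  refine ⟨?_⟩
  rw [← ENNReal.ofReal_inv_of_pos (by positivity), ← ENNReal.ofReal_inv_of_pos (by positivity),
    ← ENNReal.ofReal_add (by positivity) (by positivity), inv_one, ← ENNReal.ofReal_one]
  congr 1
  field_simp
  ring

theorem MemH.memLp_sobExp {s : ℝ} (hs0 : 0 < s) (hs1 : s < 1) (hsn : 2 * s < (n : ℝ)) {u : Rn n → ℂ}
    (hu : MemH s u) : MemLp u (ENNReal.ofReal (sobExp n s)) volume := by
  have hn : 0 < n := by
    have : (0 : ℝ) < n := by linarith
    exact_mod_cast this
  obtain ⟨K, hK⟩ := exists_eLpNorm_sobExp_le hn hs0 hsn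
  refine ⟨hu.memLp.1, (hK u hu.memLp).trans_lt (ENNReal.mul_lt_top ENNReal.coe_lt_top ?_)⟩
  exact ENNReal.rpow_lt_top_of_nonneg (by norm_num) ((memH_iff_energy hs0.le hs1.le u).1 hu).2.ne

theorem MemH.memLp_mul {s : ℝ} (hs0 : 0 < s) (hs1 : s < 1) (hsn : 2 * s < (n : ℝ)) {u v : Rn n → ℂ}
    (hu : MemH s u) (hv : MemH s v) :
    MemLp (fun x => u x * v x) (ENNReal.ofReal ((n : ℝ) / (n - 2 * s))) volume := by
  have := holderTriple_sobExp hs0 hsn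
  exact (hv.memLp_sobExp hs0 hs1 hsn).mul' (hu.memLp_sobExp hs0 hs1 hsn)

theorem MemH.memLp_norm_sq {s : ℝ} (hs0 : 0 < s) (hs1 : s < 1) (hsn : 2 * s < (n : ℝ))
    {u : Rn n → ℂ} (hu : MemH s u) :
    MemLp (fun x => ((‖u x‖ ^ 2 : ℝ) : ℂ)) (ENNReal.ofReal ((n : ℝ) / (n - 2 * s))) volume := by
  refine (hu.memLp_mul hs0 hs1 hsn hu).congr_norm ?_ (.of_forall fun x => ?_)
  · exact (Complex.continuous_ofReal.comp (by fun_prop : Continuous fun t : ℂ => ‖t‖ ^ 2)).comp_aestronglyMeasurable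
      hu.memLp.1
  · simp [pow_two]

/-- Split m₂b² - m₁a² as (m₂-m₁)(a²+b²)/2 + (m₁+m₂)(b²-a²)/2. The first part yields the good term
(m₂-m₁)²(a²+b²)/2; by Young's inequality the second costs at most half of it plus 2M²δ². The lower
bound is the Caccioppoli estimate, the upper one gives integrability. -/
theorem caccioppoli_pointwise {a b m₁ m₂ M δ : ℝ} (h₁ : |m₁| ≤ M)
    (h₂ : |m₂| ≤ M) (hδ : |b - a| ≤ δ) :
    (m₂ - m₁) ^ 2 * a ^ 2 / 4 ≤ (m₂ - m₁) * (m₂ * b ^ 2 - m₁ * a ^ 2) + 2 * M ^ 2 * δ ^ 2 ∧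
    |(m₂ - m₁) * (m₂ * b ^ 2 - m₁ * a ^ 2)| ≤
      (m₂ - m₁) ^ 2 * a ^ 2 + (m₂ - m₁) ^ 2 * b ^ 2 + 2 * M ^ 2 * δ ^ 2 := by
  have hM : 0 ≤ M := (abs_nonneg _).trans h₁
  have hE : (m₂ - m₁) * (m₂ * b ^ 2 - m₁ * a ^ 2) =
      (m₂ - m₁) ^ 2 * (a ^ 2 + b ^ 2) / 2 + (m₁ + m₂) / 2 * (b - a) * ((m₂ - m₁) * (a + b)) := by
    ring
  have hS : |(m₁ + m₂) / 2| ≤ M := by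
    rw [abs_div, abs_two]
    linarith [abs_add_le m₁ m₂]
  have hY : |(m₁ + m₂) / 2 * (b - a)| ≤ M * δ := by
    rw [abs_mul]
    exact mul_le_mul hS hδ (abs_nonneg _) hM
  set Y := (m₁ + m₂) / 2 * (b - a)
  set X := (m₂ - m₁) * (a + b) with hX
  have hX2 : X ^ 2 ≤ 2 * ((m₂ - m₁) ^ 2 * (a ^ 2 + b ^ 2)) := by
    rw [hX]
    nlinarith [mul_nonneg (sq_nonneg (m₂ - m₁)) (sq_nonneg (a - b))]
  have hY2 : Y ^ 2 ≤ (M * δ) ^ 2 := sq_le_sq' (abs_le.1 hY).1 (abs_le.1 hY).2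
  have hXY : |Y * X| ≤ X ^ 2 / 8 + 2 * (M * δ) ^ 2 := by
    rw [abs_le]
    constructor <;> nlinarith [sq_nonneg (X + 4 * Y), sq_nonneg (X - 4 * Y)]
  have hpos : 0 ≤ (m₂ - m₁) ^ 2 * b ^ 2 := by positivity
  have hpos' : 0 ≤ (m₂ - m₁) ^ 2 * a ^ 2 := by positivity
  rw [hE]
  obtain ⟨h3, h4⟩ := abs_le.1 hXY
  constructor
  · nlinarith
  · rw [abs_le]
    constructor <;> nlinarith

theorem sq_min_one_le (h : Rn n) :
    ENNReal.ofReal (min 1 ‖h‖) ^ 2 ≤ ENNReal.ofReal (min 1 (‖h‖ ^ 2)) := by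
  rw [← ENNReal.ofReal_pow (le_min zero_le_one (norm_nonneg h))]
  refine ENNReal.ofReal_le_ofReal (le_min ?_ ?_)
  · exact pow_le_one₀ (le_min zero_le_one (norm_nonneg h)) (min_le_left _ _)
  · exact pow_le_pow_left₀ (le_min zero_le_one (norm_nonneg h)) (min_le_right _ _) 2

/-- A difference bounded by `min 1 |h|` is a Carleson-type multiplier from `L²` to `L²(jump)`. -/
theorem memLp_diff_mul (hn : 0 < n) {s : ℝ} (hs0 : 0 < s) (hs1 : s < 1) {F u : Rn n → ℂ}
    (hF : AEStronglyMeasurable F volume) {K : ℝ≥0∞} (hK : K ≠ ∞)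
    (hb : ∀ h x, ‖diff F (h, x)‖ₑ ≤ K * ENNReal.ofReal (min 1 ‖h‖)) (hu : MemLp u 2 volume) :
    MemLp (fun z => diff F z * u z.2) 2 (jump n s) := by
  have hm : AEStronglyMeasurable (fun z : Rn n × Rn n => diff F z * u z.2) (jump n s) :=
    (aesm_diff s hF).mul (aesm_snd s hu.1)
  rw [memLp_two_iff_lintegral hm, lintegral_jump s (hm.enorm.pow_const 2)]
  have hu2 := (memLp_two_iff_lintegral hu.1).1 hu
  calc _ ≤ ∫⁻ h, (K ^ 2 * ∫⁻ x, ‖u x‖ₑ ^ 2) * ENNReal.ofReal (min 1 (‖h‖ ^ 2)) ∂levy n s := by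
        refine lintegral_mono fun h => ?_
        calc _ ≤ ∫⁻ x, (K ^ 2 * ENNReal.ofReal (min 1 (‖h‖ ^ 2))) * ‖u x‖ₑ ^ 2 := by
              refine lintegral_mono fun x => ?_
              rw [enorm_mul, mul_pow]
              refine mul_le_mul' ?_ le_rfl
              calc _ ≤ (K * ENNReal.ofReal (min 1 ‖h‖)) ^ 2 := pow_le_pow_left' (hb h x) 2
                _ ≤ _ := by
                  rw [mul_pow]
                  exact mul_le_mul' le_rfl (sq_min_one_le h)
          _ = _ := by
              rw [lintegral_const_mul' _ _ (ENNReal.mul_lt_top (ENNReal.pow_lt_top hK.lt_top)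
                ENNReal.ofReal_lt_top).ne]
              ring
    _ < ∞ := by
        have h1 : K ^ 2 * ∫⁻ x, ‖u x‖ₑ ^ 2 < ∞ := ENNReal.mul_lt_top (ENNReal.pow_lt_top hK.lt_top) hu2
        rw [lintegral_const_mul' _ _ h1.ne]
        exact ENNReal.mul_lt_top h1 (lintegral_min_levy hn hs0 hs1)

/-- Passing from the value of `u` at `x` to its value at `x + h`. -/
theorem memLp_diff_mul_add {s : ℝ} {F u : Rn n → ℂ}
    (h : MemLp (fun z => diff F z * u z.2) 2 (jump n s)) :
    MemLp (fun z => diff F z * u (z.2 + z.1)) 2 (jump n s) := by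
  refine (h.comp_measurePreserving (measurePreserving_swap_points s)).neg.ae_eq
    (.of_forall fun z => ?_)
  simp only [diff, Pi.neg_apply, Function.comp_apply, add_neg_cancel_right]
  ring

theorem one_le_ofReal_div {s : ℝ} (hs0 : 0 < s) (hsn : 2 * s < (n : ℝ)) :
    1 ≤ ENNReal.ofReal ((n : ℝ) / (2 * s)) := by
  rw [← ENNReal.ofReal_one]
  refine ENNReal.ofReal_le_ofReal ?_
  rw [le_div_iff₀ (by positivity)]
  linarith

section Mollified

variable {s : ℝ} (hn : 0 < n) (hs0 : 0 < s) (hs1 : s < 1) (hsn : 2 * s < (n : ℝ))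
  {m L : Rn n → ℝ} (hL : IsFracLap s (ENNReal.ofReal ((n : ℝ) / (2 * s))) m L) {M : ℝ}
  (hmm : AEStronglyMeasurable (fun x => (m x : ℂ)) volume) (hM : ∀ᵐ z, ‖(m z : ℂ)‖ ≤ M)
  {ρ : ℕ → 𝓢(Rn n, ℂ)} (hρ : IsMollifier ρ)

include hmm hM hρ in
theorem continuous_moll_of_bounded (k : ℕ) : Continuous (moll (fun z => (m z : ℂ)) (ρ k)) :=
  continuous_moll ((memLp_top_of_bound hmm M hM).locallyIntegrable le_top) (ρ k).continuous
    (hρ.compact k)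

include hM hρ in
theorem norm_moll_le (k : ℕ) (x : Rn n) : ‖moll (fun z => (m z : ℂ)) (ρ k) x‖ ≤ M := by
  have hM0 : 0 ≤ M := by
    by_contra hneg
    obtain ⟨z, hz⟩ := hM.exists
    exact hneg ((norm_nonneg _).trans hz)
  have h := enorm_moll_le ENNReal.ofReal_ne_top (enorm_le_ofReal hM) (ρ k) x
  rw [hρ.mass k, mul_one, ← ofReal_norm] at h
  exact (ENNReal.ofReal_le_ofReal_iff hM0).1 h

include hmm hM hρ in
theorem tendsto_moll_of_bounded : ∀ᵐ x, Filter.Tendsto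
    (fun k => moll (fun z => (m z : ℂ)) (ρ k) x) Filter.atTop (nhds (m x : ℂ)) :=
  hρ.tendsto ((memLp_top_of_bound hmm M hM).locallyIntegrable le_top)

include hmm hM hρ in
theorem tendsto_diff_moll : ∀ᵐ z ∂jump n s, Filter.Tendsto
    (fun k => diff (moll (fun z => (m z : ℂ)) (ρ k)) z) Filter.atTop
      (nhds (diff (fun z => (m z : ℂ)) z)) := by
  have h := tendsto_moll_of_bounded hmm hM hρ
  filter_upwards [(quasiMeasurePreserving_snd_jump s).ae h,
    (quasiMeasurePreserving_add_jump s).ae h] with z h1 h2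
  exact h2.sub h1

include hs0 hsn hL hρ in
theorem eLpNorm_moll_fracLap_le (k : ℕ) :
    eLpNorm (moll (fun z => (L z : ℂ)) (ρ k)) (ENNReal.ofReal ((n : ℝ) / (2 * s))) volume ≤
      eLpNorm L (ENNReal.ofReal ((n : ℝ) / (2 * s))) volume := by
  refine (eLpNorm_moll_le hL.1.ofReal.1 (ρ k).continuous.aestronglyMeasurable (hρ.mass k) (one_le_ofReal_div hs0 hsn)
    ENNReal.ofReal_ne_top).trans_eq (eLpNorm_congr_norm_ae (.of_forall fun x => ?_))
  simp

include hs0 hsn hL hρ in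
theorem aesm_moll_fracLap (k : ℕ) :
    AEStronglyMeasurable (moll (fun z => (L z : ℂ)) (ρ k)) volume :=
  (continuous_moll (hL.1.ofReal.locallyIntegrable (one_le_ofReal_div hs0 hsn)) (ρ k).continuous
    (hρ.compact k)).aestronglyMeasurable

include hn hs0 hs1 hsn hL hmm hM hρ in
/-- The Caccioppoli inequality, uniformly for the mollifications of `m`. -/
theorem exists_eLpNorm_diff_moll_mul_le {u : Rn n → ℂ} (hu : MemH s u) :
    ∃ C : ℝ≥0∞, C ≠ ∞ ∧ ∀ k, eLpNorm
      (fun z => diff (moll (fun z => (m z : ℂ)) (ρ k)) z * u z.2) 2 (jump n s) ≤ C := by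
  have hq := hu.memLp_norm_sq hs0 hs1 hsn
  set p := ENNReal.ofReal ((n : ℝ) / (2 * s)) with hp
  set q := ENNReal.ofReal ((n : ℝ) / (n - 2 * s)) with hqdef
  have hpq : ENNReal.HolderTriple p q 1 := holderTriple_fracLap hs0 hsn
  set U : Rn n → ℂ := fun x => ((‖u x‖ ^ 2 : ℝ) : ℂ) with hU
  set N : ℝ≥0∞ := eLpNorm L p volume * (ENNReal.ofReal M * eLpNorm U q volume) with hN
  have hNtop : N ≠ ∞ := ENNReal.mul_ne_top hL.1.2.ne
    (ENNReal.mul_ne_top ENNReal.ofReal_ne_top hq.2.ne)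
  have hdu := memLp_diff hn hs0 hs1 hu
  have hdu2 : Integrable (fun z => ‖diff u z‖ ^ 2) (jump n s) :=
    (memLp_two_iff_integrable_sq_norm hdu.1).1 hdu
  set E : ℝ := ∫ z, ‖diff u z‖ ^ 2 ∂jump n s with hE
  have hC := fracConst_pos n hs0 hs1
  -- `N` bounds the pairing of the mollified (-Δ)^s m with m_k|u|² by Hölder and Sobolev, `E` is the
  -- seminorm of u, and the factor 4 undoes the quarter in `caccioppoli_pointwise`. Nothing here
  -- depends on k.
  refine ⟨(4 * ENNReal.ofReal (2 / fracConst n s * N.toReal + 2 * M ^ 2 * E)) ^ (1 / 2 : ℝ),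
    ENNReal.rpow_ne_top_of_nonneg (by norm_num) (ENNReal.mul_ne_top (by norm_num)
      ENNReal.ofReal_ne_top), fun k => ?_⟩
  rw [eLpNorm_two_sq]
  refine ENNReal.rpow_le_rpow ?_ (by norm_num)
  set F := moll (fun z => (m z : ℂ)) (ρ k) with hF
  let f : Rn n → ℝ := fun x => (F x).re
  have hfF (x : Rn n) : (f x : ℂ) = F x := ofReal_moll hρ m k x
  have hFM (x : Rn n) : ‖F x‖ ≤ M := norm_moll_le hM hρ k x
  have hfM (x : Rn n) : |f x| ≤ M := by
    rw [← Real.norm_eq_abs, ← Complex.norm_real, hfF]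
    exact hFM x
  have hFc : Continuous F := continuous_moll_of_bounded hmm hM hρ k
  have hFm : AEStronglyMeasurable F volume := hFc.aestronglyMeasurable
  -- Only qualitative: the bound obtained here depends on k, and serves to make the integrals below
  -- finite before the uniform estimate is read off.
  have hL2 : MemLp (fun z => diff F z * u z.2) 2 (jump n s) :=
    memLp_diff_mul hn hs0 hs1 hFm (ENNReal.mul_lt_top ENNReal.ofReal_lt_top
      (derivSize_lt_top (ρ k))).ne (enorm_diff_moll_le hmm hM (ρ k)) hu.memLp
  have hL2' := memLp_diff_mul_add hL2
  have i1 : Integrable (fun z => ‖diff F z * u z.2‖ ^ 2) (jump n s) :=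
    (memLp_two_iff_integrable_sq_norm hL2.1).1 hL2
  have i2 : Integrable (fun z => ‖diff F z * u (z.2 + z.1)‖ ^ 2) (jump n s) :=
    (memLp_two_iff_integrable_sq_norm hL2'.1).1 hL2'
  have hnd (z : Rn n × Rn n) : ‖diff F z‖ ^ 2 = (f (z.2 + z.1) - f z.2) ^ 2 := by
    have : diff F z = ((f (z.2 + z.1) - f z.2 : ℝ) : ℂ) := by
      simp only [diff, Complex.ofReal_sub, hfF]
    rw [this, Complex.norm_real, Real.norm_eq_abs, sq_abs]
  let g : Rn n → ℂ := fun x => F x * U x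
  have hUint : Integrable U := by
    have : Integrable (fun x => ‖u x‖ ^ 2) := (memLp_two_iff_integrable_sq_norm hu.memLp.1).1 hu.memLp
    exact this.ofReal
  have hg : Integrable g := hUint.bdd_mul hFm (.of_forall hFM)
  let P : Rn n × Rn n → ℝ := fun z =>
    (f (z.2 + z.1) - f z.2) * (f (z.2 + z.1) * ‖u (z.2 + z.1)‖ ^ 2 - f z.2 * ‖u z.2‖ ^ 2)
  have hPc (z : Rn n × Rn n) : ((P z : ℝ) : ℂ) = diff F z * diff g z := by
    simp only [P, diff, g, hU, ← hfF]
    push_cast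
    ring
  -- The pointwise inequality is used with a = |u(x)| and b = |u(x+h)|, so that δ = |δu| is
  -- admissible by the reverse triangle inequality.
  have hpt (z : Rn n × Rn n) := caccioppoli_pointwise (δ := ‖diff u z‖)
    (hfM z.2) (hfM (z.2 + z.1)) (abs_norm_sub_norm_le (u (z.2 + z.1)) (u z.2))
  have hPm : AEStronglyMeasurable P (jump n s) := by
    have h1 : AEStronglyMeasurable (fun z => diff F z * diff g z) (jump n s) :=
      (aesm_diff s hFm).mul (aesm_diff s hg.1)
    refine (Complex.continuous_re.comp_aestronglyMeasurable h1).congr (.of_forall fun z => ?_)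
    simp only [← hPc, Complex.ofReal_re]
  have hPi : Integrable P (jump n s) := by
    refine ((i1.add i2).add (hdu2.const_mul (2 * M ^ 2))).mono' hPm (.of_forall fun z => ?_)
    simp only [Pi.add_apply, norm_mul, mul_pow, hnd]
    exact (hpt z).2
  have hid := integral_moll_fracLap_mul hn hs0 hs1 hL hmm hM (ρ k) (hρ.compact k) hg
    (hPi.ofReal.congr (.of_forall hPc))
  have hupper : ∫ z, P z ∂jump n s ≤ 2 / fracConst n s * N.toReal := by
    have h1 : ‖∫ x, moll (fun z => (L z : ℂ)) (ρ k) x * g x‖ ≤ N.toReal := by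
      rw [← toReal_enorm]
      refine ENNReal.toReal_mono hNtop ((enorm_integral_le_lintegral_enorm _).trans ?_)
      rw [← eLpNorm_one_eq_lintegral_enorm]
      refine (eLpNorm_smul_le_mul_eLpNorm (p := p) (q := q) (r := 1)
        (φ := moll (fun z => (L z : ℂ)) (ρ k)) hg.1
        (aesm_moll_fracLap hs0 hsn hL hρ k)).trans ?_
      refine mul_le_mul' (eLpNorm_moll_fracLap_le hs0 hsn hL hρ k) ?_
      refine eLpNorm_le_mul_eLpNorm_of_ae_le_mul (.of_forall fun x => ?_) q
      rw [norm_mul]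
      exact mul_le_mul_of_nonneg_right (hFM x) (norm_nonneg _)
    have h2 : ((∫ z, P z ∂jump n s : ℝ) : ℂ) = ((2 / fracConst n s : ℝ) : ℂ) *
        ∫ x, moll (fun z => (L z : ℂ)) (ρ k) x * g x := by
      rw [hid, ← mul_assoc, ← Complex.ofReal_mul, ← integral_complex_ofReal]
      rw [show (2 / fracConst n s * (fracConst n s / 2) : ℝ) = 1 by field_simp, Complex.ofReal_one,
        one_mul]
      exact integral_congr_ae (.of_forall hPc)
    calc _ ≤ ‖((∫ z, P z ∂jump n s : ℝ) : ℂ)‖ := by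
          rw [Complex.norm_real]
          exact le_abs_self _
      _ ≤ _ := by
          rw [h2, norm_mul, Complex.norm_real, Real.norm_of_nonneg (by positivity)]
          exact mul_le_mul_of_nonneg_left h1 (by positivity)
  have hlow (z : Rn n × Rn n) : ‖diff F z * u z.2‖ₑ ^ 2 ≤
      4 * ENNReal.ofReal (P z + 2 * M ^ 2 * ‖diff u z‖ ^ 2) := by
    rw [← ofReal_norm, ← ENNReal.ofReal_pow (norm_nonneg _),
      show (4 : ℝ≥0∞) = ENNReal.ofReal 4 by norm_num, ← ENNReal.ofReal_mul (by norm_num)]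
    refine ENNReal.ofReal_le_ofReal ?_
    rw [norm_mul, mul_pow, hnd]
    linarith [(hpt z).1]
  have hnn (z : Rn n × Rn n) : 0 ≤ P z + 2 * M ^ 2 * ‖diff u z‖ ^ 2 :=
    le_trans (by positivity) (hpt z).1
  calc _ ≤ ∫⁻ z, 4 * ENNReal.ofReal (P z + 2 * M ^ 2 * ‖diff u z‖ ^ 2) ∂jump n s :=
        lintegral_mono hlow
    _ = 4 * ENNReal.ofReal (∫ z, (P z + 2 * M ^ 2 * ‖diff u z‖ ^ 2) ∂jump n s) := by
        have hi : Integrable (fun z => P z + 2 * M ^ 2 * ‖diff u z‖ ^ 2) (jump n s) :=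
          hPi.add (hdu2.const_mul _)
        rw [lintegral_const_mul' _ _ (by norm_num),
          ofReal_integral_eq_lintegral_ofReal hi (.of_forall hnn)]
    _ ≤ _ := by
        rw [integral_add hPi (hdu2.const_mul _), integral_const_mul]
        gcongr

include hn hs0 hs1 hsn hL hmm hM in
-- The uniform Caccioppoli bound passes to m by Fatou, since the mollifications converge almost
-- everywhere at both points of a pair.
theorem memLp_diff_mul_of_fracLap {u : Rn n → ℂ} (hu : MemH s u) :
    MemLp (fun z => diff (fun z => (m z : ℂ)) z * u z.2) 2 (jump n s) := by
  obtain ⟨ρ, hρ⟩ := exists_isMollifier n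
  obtain ⟨C, hC, hb⟩ := exists_eLpNorm_diff_moll_mul_le hn hs0 hs1 hsn hL hmm hM hρ hu
  refine memLp_of_tendsto_of_le hC (fun k => ?_) hb ?_
  · exact (aesm_diff s (continuous_moll_of_bounded hmm hM hρ k).aestronglyMeasurable).mul
      (aesm_snd s hu.memLp.1)
  · filter_upwards [tendsto_diff_moll (s := s) hmm hM hρ] with z hz using hz.mul_const _

include hn hs0 hs1 hsn hL hmm hM in
/-- A bounded function whose differences are controlled by those of `m` is a multiplier on `H^s`. -/
theorem MemH.mulFun {b : Rn n → ℝ} (hbm : AEStronglyMeasurable (fun x => (b x : ℂ)) volume) {B K : ℝ}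
    (hB : ∀ᵐ x, ‖(b x : ℂ)‖ ≤ B)
    (hK : ∀ᵐ z ∂jump n s, ‖diff (fun x => (b x : ℂ)) z‖ ≤ K * ‖diff (fun z => (m z : ℂ)) z‖)
    {u : Rn n → ℂ} (hu : MemH s u) : MemH s (mulFun b u) := by
  refine (memH_iff_memLp_diff hn hs0 hs1).2 ⟨?_, ?_⟩
  · exact hu.memLp.of_le_mul (hbm.mul hu.memLp.1) (by
      filter_upwards [hB] with x hx
      rw [FracCond.mulFun, norm_mul]
      exact mul_le_mul_of_nonneg_right hx (norm_nonneg _))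
  · have h1 : MemLp (fun z : Rn n × Rn n => (b (z.2 + z.1) : ℂ) * diff u z) 2 (jump n s) :=
      (memLp_diff hn hs0 hs1 hu).of_le_mul ((aesm_add s hbm).mul (aesm_diff s hu.memLp.1)) (by
        filter_upwards [(quasiMeasurePreserving_add_jump s).ae hB] with x hx
        rw [norm_mul]
        exact mul_le_mul_of_nonneg_right hx (norm_nonneg _))
    have h2 : MemLp (fun z : Rn n × Rn n => diff (fun x => (b x : ℂ)) z * u z.2) 2 (jump n s) :=
      (memLp_diff_mul_of_fracLap hn hs0 hs1 hsn hL hmm hM hu).of_le_mul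
        ((aesm_diff s hbm).mul (aesm_snd s hu.memLp.1)) (by
          filter_upwards [hK] with z hz
          rw [norm_mul, norm_mul, ← mul_assoc]
          exact mul_le_mul_of_nonneg_right hz (norm_nonneg _))
    -- Product rule: δ(b u) = b(x+h) δu + δb · u(x).
    refine (h1.add h2).ae_eq (.of_forall fun z => ?_)
    simp only [Pi.add_apply, diff, FracCond.mulFun]
    ring

end Mollified

/-! ### Integration by parts against `(-Δ)^s m` -/

theorem holderTriple_two : ENNReal.HolderTriple 2 2 1 := ⟨by
  rw [← two_mul, ENNReal.mul_inv_cancel (by norm_num) (by norm_num), inv_one]⟩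

theorem eLpNorm_diff_mul_add (s : ℝ) {F u : Rn n → ℂ} (hF : AEStronglyMeasurable F volume)
    (hu : AEStronglyMeasurable u volume) :
    eLpNorm (fun z => diff F z * u (z.2 + z.1)) 2 (jump n s) =
      eLpNorm (fun z => diff F z * u z.2) 2 (jump n s) := by
  rw [← eLpNorm_comp_measurePreserving (g := fun z : Rn n × Rn n => diff F z * u z.2)
    ((aesm_diff s hF).mul (aesm_snd s hu)) (measurePreserving_swap_points s)]
  refine eLpNorm_congr_norm_ae (.of_forall fun z => ?_)
  simp only [diff, Function.comp_apply, add_neg_cancel_right, norm_mul]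
  rw [norm_sub_rev]

section ByParts

variable {s : ℝ} (hn : 0 < n) (hs0 : 0 < s) (hs1 : s < 1) (hsn : 2 * s < (n : ℝ))
  {m L : Rn n → ℝ} (hL : IsFracLap s (ENNReal.ofReal ((n : ℝ) / (2 * s))) m L) {M : ℝ}
  (hmm : AEStronglyMeasurable (fun x => (m x : ℂ)) volume) (hM : ∀ᵐ z, ‖(m z : ℂ)‖ ≤ M)
  {u v : Rn n → ℂ} (hu : MemH s u) (hv : MemH s v)

include hn hs0 hs1 hsn hL hmm hM hu hv

/-- With δ(uv) = v(x+h) δu + u(x) δv, each term is a product of two functions in L²(jump): one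
factor carries δm and is covered by the Caccioppoli estimate, the other is δu or δv. -/
theorem integrable_diff_mul_diff_mul :
    Integrable (fun z => diff (fun x => (m x : ℂ)) z * diff (fun x => u x * v x) z)
      (jump n s) := by
  have := holderTriple_two
  have h1 : MemLp (fun z => (diff (fun x => (m x : ℂ)) z * v (z.2 + z.1)) * diff u z) 1 (jump n s) :=
    (memLp_diff hn hs0 hs1 hu).mul' (memLp_diff_mul_add
      (memLp_diff_mul_of_fracLap hn hs0 hs1 hsn hL hmm hM hv))
  have h2 : MemLp (fun z => (diff (fun x => (m x : ℂ)) z * u z.2) * diff v z) 1 (jump n s) :=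
    (memLp_diff hn hs0 hs1 hv).mul' (memLp_diff_mul_of_fracLap hn hs0 hs1 hsn hL hmm hM hu)
  refine (memLp_one_iff_integrable.1 (h1.add h2)).congr (.of_forall fun z => ?_)
  simp only [Pi.add_apply, diff]
  ring

/-- The identity holds for each mollification. The limits `t1` and `t2` use that δm_k times u or v
is bounded in L²(jump); `t3` uses that the mollified L is bounded in L^{n/2s}, dual to the space
L^{n/(n-2s)} containing uv. -/
theorem integral_fracLap_mul_mul :
    ∫ x, (L x : ℂ) * (u x * v x) = (fracConst n s / 2 : ℝ) *
      ∫ z, diff (fun x => (m x : ℂ)) z * diff (fun x => u x * v x) z ∂jump n s := by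
  have h22 := holderTriple_two
  have hpq := holderTriple_fracLap hs0 hsn
  obtain ⟨ρ, hρ⟩ := exists_isMollifier n
  obtain ⟨Cu, hCu, hbu⟩ := exists_eLpNorm_diff_moll_mul_le hn hs0 hs1 hsn hL hmm hM hρ hu
  obtain ⟨Cv, hCv, hbv⟩ := exists_eLpNorm_diff_moll_mul_le hn hs0 hs1 hsn hL hmm hM hρ hv
  have hdu := memLp_diff hn hs0 hs1 hu
  have hdv := memLp_diff hn hs0 hs1 hv
  have hum := hu.memLp.1
  have hvm := hv.memLp.1
  let F (k : ℕ) : Rn n → ℂ := moll (fun z => (m z : ℂ)) (ρ k)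
  have hFm (k : ℕ) : AEStronglyMeasurable (F k) volume :=
    (continuous_moll_of_bounded hmm hM hρ k).aestronglyMeasurable
  have hFu (k : ℕ) : MemLp (fun z => diff (F k) z * u z.2) 2 (jump n s) :=
    ⟨(aesm_diff s (hFm k)).mul (aesm_snd s hum), (hbu k).trans_lt hCu.lt_top⟩
  have hFv (k : ℕ) : MemLp (fun z => diff (F k) z * v (z.2 + z.1)) 2 (jump n s) :=
    memLp_diff_mul_add ⟨(aesm_diff s (hFm k)).mul (aesm_snd s hvm), (hbv k).trans_lt hCv.lt_top⟩
  have i1 (k : ℕ) : Integrable (fun z => (diff (F k) z * v (z.2 + z.1)) * diff u z) (jump n s) :=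
    memLp_one_iff_integrable.1 (hdu.mul' (hFv k))
  have i2 (k : ℕ) : Integrable (fun z => (diff (F k) z * u z.2) * diff v z) (jump n s) :=
    memLp_one_iff_integrable.1 (hdv.mul' (hFu k))
  have hmu := memLp_diff_mul_of_fracLap hn hs0 hs1 hsn hL hmm hM hu
  have hmv := memLp_diff_mul_add (memLp_diff_mul_of_fracLap hn hs0 hs1 hsn hL hmm hM hv)
  have hsplit (G : Rn n → ℂ) (z : Rn n × Rn n) : (diff G z * v (z.2 + z.1)) * diff u z +
      (diff G z * u z.2) * diff v z = diff G z * diff (fun x => u x * v x) z := by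
    simp only [diff]
    ring
  have hlim := tendsto_diff_moll (s := s) hmm hM hρ
  have t1 : Filter.Tendsto (fun k => ∫ z, (diff (F k) z * v (z.2 + z.1)) * diff u z ∂jump n s)
      Filter.atTop (nhds (∫ z, (diff (fun x => (m x : ℂ)) z * v (z.2 + z.1)) * diff u z
        ∂jump n s)) := by
    refine tendsto_integral_mul_of_bounded (p := 2) (q := 2) one_le_two (by norm_num) hCv
      (fun k => (hFv k).1) (fun k => ?_) ?_ hdu
    · rw [eLpNorm_diff_mul_add s (hFm k) hvm]
      exact hbv k
    · filter_upwards [hlim] with z hz using hz.mul_const _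
  have t2 : Filter.Tendsto (fun k => ∫ z, (diff (F k) z * u z.2) * diff v z ∂jump n s)
      Filter.atTop (nhds (∫ z, (diff (fun x => (m x : ℂ)) z * u z.2) * diff v z ∂jump n s)) := by
    refine tendsto_integral_mul_of_bounded (p := 2) (q := 2) one_le_two (by norm_num) hCu
      (fun k => (hFu k).1) hbu ?_ hdv
    filter_upwards [hlim] with z hz using hz.mul_const _
  have hn0 : (0 : ℝ) < n := by exact_mod_cast hn
  have hns : 0 < (n : ℝ) - 2 * s := by linarith
  have hq1 : 1 ≤ ENNReal.ofReal ((n : ℝ) / (n - 2 * s)) := by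
    rw [← ENNReal.ofReal_one]
    refine ENNReal.ofReal_le_ofReal ?_
    rw [le_div_iff₀ hns]
    linarith
  have t3 : Filter.Tendsto (fun k => ∫ x, moll (fun z => (L z : ℂ)) (ρ k) x * (u x * v x))
      Filter.atTop (nhds (∫ x, (L x : ℂ) * (u x * v x))) :=
    tendsto_integral_mul_of_bounded hq1 ENNReal.ofReal_ne_top hL.1.2.ne
      (aesm_moll_fracLap hs0 hsn hL hρ) (eLpNorm_moll_fracLap_le hs0 hsn hL hρ)
      (hρ.tendsto (hL.1.ofReal.locallyIntegrable (one_le_ofReal_div hs0 hsn)))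
      (hu.memLp_mul hs0 hs1 hsn hv)
  have t4 := (t1.add t2).const_mul ((fracConst n s / 2 : ℝ) : ℂ)
  have hguv : Integrable (fun x => u x * v x) :=
    memLp_one_iff_integrable.1 (hv.memLp.mul' hu.memLp)
  have hk (k : ℕ) : ((fracConst n s / 2 : ℝ) : ℂ) *
      ((∫ z, (diff (F k) z * v (z.2 + z.1)) * diff u z ∂jump n s) +
        ∫ z, (diff (F k) z * u z.2) * diff v z ∂jump n s) =
      ∫ x, moll (fun z => (L z : ℂ)) (ρ k) x * (u x * v x) := by
    rw [integral_moll_fracLap_mul hn hs0 hs1 hL hmm hM (ρ k) (hρ.compact k) hguv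
      (((i1 k).add (i2 k)).congr (.of_forall (hsplit (F k)))), ← integral_add (i1 k) (i2 k)]
    congr 1
    exact integral_congr_ae (.of_forall (hsplit (F k)))
  simp only [hk] at t4
  rw [tendsto_nhds_unique t3 t4, ← integral_add (memLp_one_iff_integrable.1 (hdu.mul' hmv))
    (memLp_one_iff_integrable.1 (hdv.mul' hmu))]
  congr 1
  exact integral_congr_ae (.of_forall (hsplit _))

end ByParts

/-! ### The conductivity operator in the coordinates `(h, x)` -/

/-- The two kernels contribute r^{-(n+2s+2)} and the vector y - x contributes r², leaving
r^{-(n+2s)}. On the diagonal both sides vanish with the differences, whatever the value of the power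
at 0. -/
theorem sum_fracGrad_mul {s : ℝ} (hs0 : 0 < s) (hs1 : s < 1) (u φ : Rn n → ℂ)
    (z : Rn n × Rn n) : ∑ i, fracGrad s u z i * fracGrad s φ z i =
      ((‖z.2 - z.1‖ ^ (-((n : ℝ) + 2 * s)) : ℝ) : ℂ) *
        ((fracConst n s / 2 : ℝ) * ((u z.2 - u z.1) * (φ z.2 - φ z.1))) := by
  have hC := fracConst_pos n hs0 hs1
  rcases eq_or_ne z.2 z.1 with h | h
  · simp [fracGrad, h]
  have hr : 0 < ‖z.2 - z.1‖ := norm_pos_iff.2 (sub_ne_zero.2 h)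
  set r := ‖z.2 - z.1‖ with hrdef
  have hsum : ∑ i, (((z.2 i - z.1 i : ℝ) : ℂ)) ^ 2 = ((r ^ 2 : ℝ) : ℂ) := by
    rw [hrdef, EuclideanSpace.real_norm_sq_eq]
    simp
  have hterm (i : Fin n) : fracGrad s u z i * fracGrad s φ z i =
      ((fracConst n s / 2 : ℝ) : ℂ) * ((u z.2 - u z.1) * (φ z.2 - φ z.1)) *
        (((r ^ ((n : ℝ) / 2 + s + 1))⁻¹ ^ 2 : ℝ) : ℂ) * ((z.2 i - z.1 i : ℝ) : ℂ) ^ 2 := by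
    have h2 : ((fracConst n s / 2 : ℝ) : ℂ) =
        ((Real.sqrt (fracConst n s) / Real.sqrt 2 : ℝ) : ℂ) ^ 2 := by
      rw [← Complex.ofReal_pow, div_pow, Real.sq_sqrt hC.le, Real.sq_sqrt (by norm_num)]
    rw [h2]
    simp only [fracGrad]
    push_cast
    ring
  simp only [hterm]
  rw [← Finset.mul_sum, hsum]
  have hpow : r ^ (-((n : ℝ) + 2 * s)) = (r ^ ((n : ℝ) / 2 + s + 1))⁻¹ ^ 2 * r ^ 2 := by
    rw [← Real.rpow_neg hr.le, ← Real.rpow_natCast, ← Real.rpow_natCast, ← Real.rpow_mul hr.le,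
      ← Real.rpow_add hr]
    congr 1
    push_cast
    ring
  rw [hpow]
  push_cast
  ring

theorem condOp_eq {s : ℝ} (hs0 : 0 < s) (hs1 : s < 1) (γ : Rn n → ℝ) (u φ : Rn n → ℂ) :
    condOp s γ u φ = ∫ z, ((fracConst n s / 2 : ℝ) : ℂ) *
      ((sqrtCond γ z.2 : ℂ) * (sqrtCond γ (z.2 + z.1) : ℂ) * diff u z) * diff φ z ∂jump n s := by
  have := integral_pair s (fun z : Rn n × Rn n => ((fracConst n s / 2 : ℝ) : ℂ) *
    ((sqrtCond γ z.1 : ℂ) * (sqrtCond γ z.2 : ℂ) * (u z.2 - u z.1)) * (φ z.2 - φ z.1))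
  simp only [diff]
  rw [← this, condOp, fracDiv]
  refine integral_congr_ae (.of_forall fun z => ?_)
  simp only [flux, PiLp.smul_apply, smul_eq_mul, mul_assoc]
  rw [← Finset.mul_sum, sum_fracGrad_mul hs0 hs1]
  push_cast
  ring

theorem memLp_flux (hn : 0 < n) {s : ℝ} (hs0 : 0 < s) (hs1 : s < 1) {γ : Rn n → ℝ} {B : ℝ}
    (hγ : Measurable γ) (hB : ∀ᵐ x, ‖(sqrtCond γ x : ℂ)‖ ≤ B) {u : Rn n → ℂ} (hu : MemH s u) :
    MemLp (flux s γ u) 2 volume := by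
  refine MemLp.of_eval_piLp fun i => ?_
  have q1 : Measure.QuasiMeasurePreserving (Prod.fst : Rn n × Rn n → Rn n) volume volume :=
    Measure.quasiMeasurePreserving_fst
  have q2 : Measure.QuasiMeasurePreserving (Prod.snd : Rn n × Rn n → Rn n) volume volume :=
    Measure.quasiMeasurePreserving_snd
  have hum := hu.memLp.1
  have ham : Measurable (sqrtCond γ) := hγ.sqrt
  have hm : AEStronglyMeasurable (fun z => flux s γ u z i) volume := by
    simp only [flux, fracGrad, PiLp.smul_apply, smul_eq_mul]
    have m1 : Measurable fun z : Rn n × Rn n => ((sqrtCond γ z.1 * sqrtCond γ z.2 : ℝ) : ℂ) := by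
      fun_prop
    have m2 : Measurable fun z : Rn n × Rn n =>
        ((‖z.2 - z.1‖ ^ ((n : ℝ) / 2 + s + 1) : ℝ) : ℂ) := by
      fun_prop
    have m3 : Measurable fun z : Rn n × Rn n => ((z.2 i - z.1 i : ℝ) : ℂ) := by
      fun_prop
    have m4 : AEStronglyMeasurable (fun z : Rn n × Rn n => u z.2 - u z.1) volume :=
      (hum.comp_quasiMeasurePreserving q2).sub (hum.comp_quasiMeasurePreserving q1)
    exact m1.aestronglyMeasurable.mul ((aestronglyMeasurable_const.mul
      (m4.div₀ m2.aestronglyMeasurable)).mul m3.aestronglyMeasurable)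
  rw [memLp_two_iff_lintegral hm]
  have hdu := (memLp_two_iff_lintegral (memLp_diff hn hs0 hs1 hu).1).1 (memLp_diff hn hs0 hs1 hu)
  set c : ℝ≥0∞ := ENNReal.ofReal ((B * B) ^ 2 * (fracConst n s / 2)) with hc
  have hpair := lintegral_pair s fun z : Rn n × Rn n => c * ‖u z.2 - u z.1‖ₑ ^ 2
  refine lt_of_le_of_lt ?_ (hpair.trans_lt ?_)
  · refine lintegral_mono_ae ?_
    filter_upwards [q1.ae hB, q2.ae hB] with z h1 h2
    have hC := fracConst_pos n hs0 hs1
    rw [hc, ← ofReal_norm, ← ofReal_norm, ← ENNReal.ofReal_pow (norm_nonneg _),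
      ← ENNReal.ofReal_pow (norm_nonneg _), ← ENNReal.ofReal_mul (by positivity),
      ← ENNReal.ofReal_mul (by positivity)]
    refine ENNReal.ofReal_le_ofReal ?_
    rcases eq_or_ne z.2 z.1 with h | h
    · simp only [flux, fracGrad, PiLp.smul_apply, h, sub_self]
      simp
    have hr : 0 < ‖z.2 - z.1‖ := norm_pos_iff.2 (sub_ne_zero.2 h)
    have hi : ‖((z.2 i - z.1 i : ℝ) : ℂ)‖ ≤ ‖z.2 - z.1‖ := by
      rw [Complex.norm_real]
      exact PiLp.norm_apply_le (z.2 - z.1) i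
    set r := ‖z.2 - z.1‖ with hrdef
    have hB0 : 0 ≤ B := (norm_nonneg _).trans h1
    have hpow : r ^ (-((n : ℝ) + 2 * s)) = (r ^ ((n : ℝ) / 2 + s + 1))⁻¹ ^ 2 * r ^ 2 := by
      rw [← Real.rpow_neg hr.le, ← Real.rpow_natCast, ← Real.rpow_natCast, ← Real.rpow_mul hr.le,
        ← Real.rpow_add hr]
      congr 1
      push_cast
      ring
    have hval : ‖flux s γ u z i‖ ^ 2 = (‖(sqrtCond γ z.1 : ℂ)‖ * ‖(sqrtCond γ z.2 : ℂ)‖) ^ 2 *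
        (fracConst n s / 2) * ((r ^ ((n : ℝ) / 2 + s + 1))⁻¹ ^ 2 *
          ‖((z.2 i - z.1 i : ℝ) : ℂ)‖ ^ 2) * ‖u z.2 - u z.1‖ ^ 2 := by
      have h2 : fracConst n s / 2 = (Real.sqrt (fracConst n s) / Real.sqrt 2) ^ 2 := by
        rw [div_pow, Real.sq_sqrt hC.le, Real.sq_sqrt (by norm_num)]
      rw [h2]
      simp only [flux, fracGrad, PiLp.smul_apply, smul_eq_mul, norm_mul, norm_neg, norm_div,
        Complex.norm_real, ← hrdef, Real.norm_of_nonneg (Real.rpow_nonneg hr.le _),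
        Real.norm_of_nonneg (Real.sqrt_nonneg _)]
      ring
    rw [hval, hpow]
    calc _ ≤ (B * B) ^ 2 * (fracConst n s / 2) * ((r ^ ((n : ℝ) / 2 + s + 1))⁻¹ ^ 2 * r ^ 2) *
          ‖u z.2 - u z.1‖ ^ 2 := by
          gcongr
      _ = _ := by ring
  · rw [lintegral_const_mul' _ _ ENNReal.ofReal_ne_top]
    exact ENNReal.mul_lt_top ENNReal.ofReal_lt_top hdu

/-! ### The kernel with Fourier transform `(1 + |ξ|²)^s - |ξ|^{2s}` -/

/-- The Gaussian with Fourier transform `exp(-|ξ|² / t)`. -/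
def gaussKernel (t : ℝ) (y : Rn n) : ℝ :=
  (Real.pi * t) ^ ((n : ℝ) / 2) * Real.exp (-(Real.pi ^ 2 * t) * ‖y‖ ^ 2)

theorem gaussKernel_nonneg {t : ℝ} (ht : 0 < t) (y : Rn n) : 0 ≤ gaussKernel t y := by
  unfold gaussKernel
  positivity

theorem measurable_gaussKernel : Measurable fun q : ℝ × Rn n => gaussKernel q.1 q.2 := by
  unfold gaussKernel
  fun_prop

theorem gaussKernel_neg (t : ℝ) (y : Rn n) : gaussKernel t (-y) = gaussKernel t y := by
  simp [gaussKernel]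

theorem integral_wave_mul_gaussKernel {t : ℝ} (ht : 0 < t) (ξ : Rn n) :
    ∫ y, wave y (-ξ) * (gaussKernel t y : ℂ) = (Real.exp (-(‖ξ‖ ^ 2 / t)) : ℂ) := by
  have hb : 0 < ((Real.pi ^ 2 * t : ℝ) : ℂ).re := by
    rw [Complex.ofReal_re]
    positivity
  have h := fourier_gaussian_innerProductSpace hb ξ
  rw [fourier_eq_wave, finrank_euclideanSpace_fin] at h
  calc _ = (((Real.pi * t) ^ ((n : ℝ) / 2) : ℝ) : ℂ) *
        ∫ y, wave y (-ξ) * Complex.exp (-((Real.pi ^ 2 * t : ℝ) : ℂ) * (‖y‖ : ℂ) ^ 2) := by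
        rw [← integral_const_mul]
        refine integral_congr_ae (.of_forall fun y => ?_)
        simp only [gaussKernel]
        push_cast
        ring
    _ = _ := by
        rw [h]
        have e1 : ((Real.pi : ℂ) / ((Real.pi ^ 2 * t : ℝ) : ℂ)) ^ ((n : ℂ) / 2) =
            (((1 / (Real.pi * t)) ^ ((n : ℝ) / 2) : ℝ) : ℂ) := by
          rw [Complex.ofReal_cpow (by positivity)]
          push_cast
          congr 1
          field_simp
        have e2 : (-(Real.pi : ℂ) ^ 2 * (‖ξ‖ : ℂ) ^ 2 / ((Real.pi ^ 2 * t : ℝ) : ℂ)) =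
            ((-(‖ξ‖ ^ 2 / t) : ℝ) : ℂ) := by
          push_cast
          have : (t : ℂ) ≠ 0 := by exact_mod_cast ht.ne'
          field_simp
        rw [e1, e2, ← Complex.ofReal_exp, ← Complex.ofReal_mul, ← Complex.ofReal_mul, ← mul_assoc,
          ← Real.mul_rpow (by positivity) (by positivity), mul_one_div_cancel (by positivity),
          Real.one_rpow, one_mul]

theorem integral_gaussKernel {t : ℝ} (ht : 0 < t) : ∫ y : Rn n, gaussKernel t y = 1 := by
  have h := integral_wave_mul_gaussKernel ht (0 : Rn n)
  simp only [wave, neg_zero, inner_zero_right, AddChar.map_zero_eq_one, Circle.coe_one, one_mul,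
    norm_zero] at h
  rw [integral_complex_ofReal] at h
  have h2 : Real.exp (-((0 : ℝ) ^ 2 / t)) = 1 := by simp
  rw [h2] at h
  exact_mod_cast h

theorem lintegral_gaussKernel {t : ℝ} (ht : 0 < t) :
    ∫⁻ y : Rn n, ‖gaussKernel t y‖ₑ = 1 := by
  have h := integral_gaussKernel (n := n) ht
  have hi : Integrable (gaussKernel t : Rn n → ℝ) :=
    integrableOn_of_integral_ne_zero (by rw [h]; exact one_ne_zero)
  rw [← ENNReal.ofReal_one, ← h, ofReal_integral_eq_lintegral_ofReal hi
    (.of_forall (gaussKernel_nonneg ht))]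
  exact lintegral_congr fun y => Real.enorm_of_nonneg (gaussKernel_nonneg ht y)

/-- The law of the parameter of the Gaussian mixture. -/
def mixing (s : ℝ) : Measure (ℝ × ℝ) :=
  (((volume : Measure ℝ).restrict (Set.Ioc 0 1)).prod
    ((volume : Measure ℝ).restrict (Set.Ioi 0))).withDensity fun r =>
      ENNReal.ofReal (s / Real.Gamma (1 - s)) *
        ENNReal.ofReal (r.2 ^ (s - 2) * Real.exp (-(r.1 / r.2)))

theorem ae_mixing_pos (s : ℝ) : ∀ᵐ r ∂mixing s, 0 < r.2 := by
  refine (withDensity_absolutelyContinuous _ _).ae_le ?_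
  rw [Measure.prod_restrict]
  filter_upwards [ae_restrict_mem (measurableSet_Ioc.prod measurableSet_Ioi)] with r hr using hr.2

/-- (1+a)^s - a^s = s ∫_0^1 (a+τ)^{s-1} dτ, and (a+τ)^{s-1} is Γ(1-s)^{-1} times the integral of
t^{s-2} e^{-(a+τ)/t}. The mixing density is read off from these two formulas, and a = 0 shows that
its total mass is 1. -/
theorem lintegral_mixing {s : ℝ} (hs0 : 0 < s) (hs1 : s < 1) {a : ℝ} (ha : 0 ≤ a) :
    ∫⁻ r, ENNReal.ofReal (Real.exp (-(a / r.2))) ∂mixing s =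
      ENNReal.ofReal ((1 + a) ^ s - a ^ s) := by
  have hG : 0 < Real.Gamma (1 - s) := Real.Gamma_pos_of_pos (by linarith)
  rw [mixing, lintegral_withDensity_eq_lintegral_mul _ (by fun_prop) (by fun_prop),
    lintegral_prod _ (by fun_prop)]
  calc _ = ∫⁻ τ in Set.Ioc (0 : ℝ) 1, ENNReal.ofReal (s * (a + τ) ^ (s - 1)) := by
        refine setLIntegral_congr_fun measurableSet_Ioc fun τ hτ => ?_
        have h0 : 0 < a + τ := by linarith [hτ.1]
        calc _ = ∫⁻ t in Set.Ioi (0 : ℝ), ENNReal.ofReal (s / Real.Gamma (1 - s)) *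
              ENNReal.ofReal (t ^ (s - 2) * Real.exp (-((a + τ) / t))) := by
              refine setLIntegral_congr_fun measurableSet_Ioi fun t (ht : 0 < t) => ?_
              simp only [Pi.mul_apply]
              rw [mul_assoc, ← ENNReal.ofReal_mul (by positivity), mul_assoc, ← Real.exp_add]
              congr 4
              ring
          _ = _ := by
              rw [lintegral_const_mul' _ _ ENNReal.ofReal_ne_top,
                lintegral_rpow_mul_exp_neg_div hs1 h0, ← ENNReal.ofReal_mul (by positivity)]
              congr 1
              field_simp
    _ = ENNReal.ofReal (∫ τ in (0 : ℝ)..1, s * (a + τ) ^ (s - 1)) := by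
        have hi : IntervalIntegrable (fun τ : ℝ => s * (a + τ) ^ (s - 1)) volume 0 1 := by
          refine IntervalIntegrable.const_mul ?_ s
          have := (intervalIntegral.intervalIntegrable_rpow' (a := a) (b := a + 1)
            (show -1 < s - 1 by linarith)).comp_add_left a
          simpa using this
        rw [intervalIntegral.integral_of_le zero_le_one, ofReal_integral_eq_lintegral_ofReal
          ((intervalIntegrable_iff_integrableOn_Ioc_of_le zero_le_one).1 hi)]
        refine (ae_restrict_iff' measurableSet_Ioc).2 (.of_forall fun τ hτ => ?_)
        have h0 : 0 < a + τ := by linarith [hτ.1]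
        positivity
    _ = _ := by
        congr 1
        rw [intervalIntegral.integral_const_mul,
          intervalIntegral.integral_comp_add_left (fun x => x ^ (s - 1)) a,
          integral_rpow (Or.inl (by linarith))]
        rw [add_zero, sub_add_cancel, mul_div_cancel₀ _ hs0.ne', add_comm a 1]

theorem isProbabilityMeasure_mixing {s : ℝ} (hs0 : 0 < s) (hs1 : s < 1) :
    IsProbabilityMeasure (mixing s) := ⟨by
  have := lintegral_mixing hs0 hs1 le_rfl
  simpa [Real.zero_rpow hs0.ne'] using this⟩

theorem integral_mixing {s : ℝ} (hs0 : 0 < s) (hs1 : s < 1) {a : ℝ} (ha : 0 ≤ a) :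
    ∫ r, Real.exp (-(a / r.2)) ∂mixing s = (1 + a) ^ s - a ^ s := by
  rw [integral_eq_lintegral_of_nonneg_ae (.of_forall fun r => (Real.exp_pos _).le)
    (by fun_prop : Measurable fun r : ℝ × ℝ => Real.exp (-(a / r.2))).aestronglyMeasurable,
    lintegral_mixing hs0 hs1 ha, ENNReal.toReal_ofReal]
  exact sub_nonneg.2 (Real.rpow_le_rpow ha (by linarith) hs0.le)

/-- The Gaussian mixture with Fourier transform `(1 + |ξ|²)^s - |ξ|^{2s}`. -/
def mixKernel (s : ℝ) (y : Rn n) : ℝ := ∫ r, gaussKernel r.2 y ∂mixing s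

theorem mixKernel_neg (s : ℝ) (y : Rn n) : mixKernel s (-y) = mixKernel s y := by
  simp only [mixKernel, gaussKernel_neg]

section Kernel

variable {s : ℝ} (hs0 : 0 < s) (hs1 : s < 1)

include hs0 hs1

theorem integrable_gaussKernel_mixing :
    Integrable (fun q : (ℝ × ℝ) × Rn n => gaussKernel q.1.2 q.2) ((mixing s).prod volume) := by
  have := isProbabilityMeasure_mixing hs0 hs1
  have hm : Measurable (fun q : (ℝ × ℝ) × Rn n => gaussKernel q.1.2 q.2) :=
    measurable_gaussKernel.comp ((measurable_snd.comp measurable_fst).prodMk measurable_snd)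
  refine ⟨hm.aestronglyMeasurable, ?_⟩
  rw [HasFiniteIntegral, lintegral_prod _ hm.enorm.aemeasurable]
  have h1 : ∫⁻ r, (∫⁻ y : Rn n, ‖gaussKernel r.2 y‖ₑ) ∂mixing s = ∫⁻ r, 1 ∂mixing s := by
    refine lintegral_congr_ae ?_
    filter_upwards [ae_mixing_pos s] with r hr using lintegral_gaussKernel hr
  rw [h1]
  simp

theorem integrable_mixKernel : Integrable (mixKernel s : Rn n → ℝ) := by
  have := isProbabilityMeasure_mixing hs0 hs1
  exact (integrable_gaussKernel_mixing hs0 hs1).integral_prod_right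

theorem integral_wave_mul_mixKernel (ξ : Rn n) :
    ∫ y, wave y (-ξ) * (mixKernel s y : ℂ) = (((1 + ‖ξ‖ ^ 2) ^ s - (‖ξ‖ ^ 2) ^ s : ℝ) : ℂ) := by
  have := isProbabilityMeasure_mixing hs0 hs1
  have hw : Continuous fun y : Rn n => wave y (-ξ) := by
    simp only [fun y : Rn n => wave_comm y (-ξ)]
    exact continuous_wave_right (-ξ)
  have hi : Integrable (fun q : (ℝ × ℝ) × Rn n => wave q.2 (-ξ) * (gaussKernel q.1.2 q.2 : ℂ))
      ((mixing s).prod volume) :=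
    (integrable_gaussKernel_mixing hs0 hs1).ofReal.bdd_mul (c := 1)
      (hw.comp continuous_snd).aestronglyMeasurable (.of_forall fun q => (norm_wave _ _).le)
  calc _ = ∫ y, ∫ r, wave y (-ξ) * (gaussKernel r.2 y : ℂ) ∂mixing s := by
        refine integral_congr_ae (.of_forall fun y => ?_)
        simp only [mixKernel]
        rw [integral_const_mul, integral_complex_ofReal]
    _ = ∫ r, (∫ y, wave y (-ξ) * (gaussKernel r.2 y : ℂ)) ∂mixing s :=
        (integral_integral_swap hi).symm
    _ = ∫ r, (Real.exp (-(‖ξ‖ ^ 2 / r.2)) : ℂ) ∂mixing s := by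
        refine integral_congr_ae ?_
        filter_upwards [ae_mixing_pos s] with r hr using integral_wave_mul_gaussKernel hr ξ
    _ = _ := by
        rw [integral_complex_ofReal, integral_mixing hs0 hs1 (by positivity)]

theorem lintegral_enorm_mixKernel : ∫⁻ y : Rn n, ‖(mixKernel s y : ℂ)‖ₑ = 1 := by
  have h := integral_wave_mul_mixKernel hs0 hs1 (0 : Rn n)
  simp only [wave, neg_zero, inner_zero_right, AddChar.map_zero_eq_one, Circle.coe_one, one_mul,
    norm_zero] at h
  rw [integral_complex_ofReal] at h
  have h2 : ((1 + (0 : ℝ) ^ 2) ^ s - ((0 : ℝ) ^ 2) ^ s : ℝ) = 1 := by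
    simp [Real.zero_rpow hs0.ne']
  rw [h2] at h
  have h3 : ∫ y : Rn n, mixKernel s y = 1 := by exact_mod_cast h
  have hnn (y : Rn n) : 0 ≤ mixKernel s y := integral_nonneg_of_ae (by
    filter_upwards [ae_mixing_pos s] with r hr using gaussKernel_nonneg hr y)
  rw [← ENNReal.ofReal_one, ← h3, ofReal_integral_eq_lintegral_ofReal
    (integrable_mixKernel hs0 hs1) (.of_forall hnn)]
  refine lintegral_congr fun y => ?_
  rw [← ofReal_norm, Complex.norm_real, Real.norm_of_nonneg (hnn y)]

end Kernel

/-! ### The fractional Laplacian on `W^{2s,p}` -/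

section Convolution

variable {p : ℝ≥0∞} {f K : Rn n → ℂ}

theorem aesm_mul_comp_add (hf : AEStronglyMeasurable f volume) (hK : AEStronglyMeasurable K volume) :
    AEStronglyMeasurable (fun w : Rn n × Rn n => K w.1 * f (w.1 + w.2)) (volume.prod volume) := by
  have h1 : AEStronglyMeasurable (fun w : Rn n × Rn n => K w.1) (volume.prod volume) :=
    hK.comp_quasiMeasurePreserving Measure.quasiMeasurePreserving_fst
  have h2 : AEStronglyMeasurable (fun w : Rn n × Rn n => f (w.1 + w.2)) (volume.prod volume) :=
    hf.comp_quasiMeasurePreserving (Measure.quasiMeasurePreserving_snd.comp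
      (measurePreserving_prod_add volume volume).quasiMeasurePreserving)
  exact h1.mul h2

theorem moll_eq_of_even (hev : ∀ y, K (-y) = K y) (x : Rn n) :
    moll f K x = ∫ y, K y * f (y + x) := by
  rw [moll, ← integral_add_right_eq_self _ x]
  refine integral_congr_ae (.of_forall fun y => ?_)
  simp only
  rw [show x - (y + x) = -y by abel, hev, mul_comm]

theorem memLp_moll_of_even (hf : MemLp f p volume) (hK : AEStronglyMeasurable K volume)
    (hev : ∀ y, K (-y) = K y) (h1 : ∫⁻ z, ‖K z‖ₑ = 1) (hp : 1 ≤ p) (hp' : p ≠ ∞) :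
    MemLp (moll f K) p volume := by
  refine ⟨?_, (eLpNorm_moll_le hf.1 hK h1 hp hp').trans_lt hf.2⟩
  have h := (aesm_mul_comp_add hf.1 hK).prod_swap.integral_prod_right'
  exact h.congr (.of_forall fun x => (moll_eq_of_even hev x).symm)

theorem integrable_mul_mul_comp_sub (q : ℝ≥0∞) [ENNReal.HolderTriple p q 1] (hf : MemLp f p volume) (hK : Integrable K)
    (φ : 𝓢(Rn n, ℂ)) :
    Integrable (fun w : Rn n × Rn n => K w.1 * (f w.2 * φ (w.2 - w.1))) (volume.prod volume) := by
  have hm : AEStronglyMeasurable (fun w : Rn n × Rn n => K w.1 * (f w.2 * φ (w.2 - w.1)))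
      (volume.prod volume) := by
    refine (hK.1.comp_quasiMeasurePreserving Measure.quasiMeasurePreserving_fst).mul
      ((hf.1.comp_quasiMeasurePreserving Measure.quasiMeasurePreserving_snd).mul ?_)
    have hs : Continuous fun w : Rn n × Rn n => w.2 - w.1 := continuous_snd.sub continuous_fst
    exact (φ.continuous.comp hs).aestronglyMeasurable
  refine ⟨hm, ?_⟩
  have hφ : MemLp φ q volume := φ.memLp q volume
  have hC : eLpNorm f p volume * eLpNorm φ q volume < ∞ := ENNReal.mul_lt_top hf.2 hφ.2
  rw [HasFiniteIntegral, lintegral_prod _ hm.enorm]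
  calc _ ≤ ∫⁻ y, ‖K y‖ₑ * (eLpNorm f p volume * eLpNorm φ q volume) := by
        refine lintegral_mono fun y => ?_
        simp only [enorm_mul (K y)]
        rw [lintegral_const_mul' _ _ enorm_ne_top]
        refine mul_le_mul' le_rfl ?_
        have hmp := measurePreserving_sub_right (volume : Measure (Rn n)) y
        have h3 := eLpNorm_smul_le_mul_eLpNorm (p := p) (q := q) (r := 1) (μ := volume)
          (f := fun x => φ (x - y)) (φ := f) (hφ.1.comp_measurePreserving hmp) hf.1
        have h4 : eLpNorm (fun x => φ (x - y)) q volume = eLpNorm φ q volume :=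
          eLpNorm_comp_measurePreserving hφ.1 hmp
        rw [h4, eLpNorm_one_eq_lintegral_enorm] at h3
        exact h3
    _ = (∫⁻ y, ‖K y‖ₑ) * (eLpNorm f p volume * eLpNorm φ q volume) :=
        lintegral_mul_const'' _ hK.1.enorm
    _ < ∞ := ENNReal.mul_lt_top hK.2 hC

/-- The convolution passes from the test function to f, with the same kernel because K is even.
Young and Hölder give the absolute convergence for Fubini. -/
theorem integral_mul_conv (q : ℝ≥0∞) [ENNReal.HolderTriple p q 1] 
    (hf : MemLp f p volume) (hK : Integrable K) (hev : ∀ y, K (-y) = K y)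
    (φ : 𝓢(Rn n, ℂ)) : Integrable (fun x => f x * ∫ y, K y * φ (x - y)) ∧
      ∫ x, f x * ∫ y, K y * φ (x - y) = ∫ z, moll f K z * φ z := by
  have hI := integrable_mul_mul_comp_sub (q := q) hf hK φ
  have hJ : Integrable (fun w : Rn n × Rn n => K w.1 * (f (w.1 + w.2) * φ w.2))
      (volume.prod volume) := by
    refine ((measurePreserving_prod_add volume volume).integrable_comp hI.1 |>.2 hI).congr
      (.of_forall fun w => ?_)
    simp
  have e0 (x : Rn n) : ∫ y, K y * (f x * φ (x - y)) = f x * ∫ y, K y * φ (x - y) := by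
    rw [← integral_const_mul]
    exact integral_congr_ae (.of_forall fun y => by ring)
  refine ⟨hI.integral_prod_right.congr (.of_forall e0), ?_⟩
  calc _ = ∫ x, ∫ y, K y * (f x * φ (x - y)) := by simp only [e0]
    _ = ∫ y, ∫ x, K y * (f x * φ (x - y)) := (integral_integral_swap hI).symm
    _ = ∫ y, ∫ z, K y * (f (y + z) * φ z) := by
        refine integral_congr_ae (.of_forall fun y => ?_)
        simp only
        rw [← integral_add_left_eq_self _ y]
        simp
    _ = ∫ z, ∫ y, K y * (f (y + z) * φ z) := integral_integral_swap hJ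
    _ = _ := by
        refine integral_congr_ae (.of_forall fun z => ?_)
        simp only
        rw [moll_eq_of_even hev, ← integral_mul_const]
        exact integral_congr_ae (.of_forall fun y => by ring)

end Convolution

/-- The Bessel potential of order `r` of a Schwartz function. -/
def besselSchwartz (r : ℝ) (φ : 𝓢(Rn n, ℂ)) : 𝓢(Rn n, ℂ) :=
  𝓕 (SchwartzMap.smulLeftCLM ℂ (fun x : Rn n => ((besselSymbol r x : ℝ) : ℂ)) (𝓕⁻ φ))

/-- The definition applies 𝓕⁻ before 𝓕, as duality produces it when the distribution is tested. The
symbol is even, so the reflection ξ ↦ -ξ restores the usual order. -/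
theorem besselSchwartz_apply (r : ℝ) (φ : 𝓢(Rn n, ℂ)) (x : Rn n) :
    besselSchwartz r φ x = ∫ ξ, wave ξ x * ((besselSymbol r ξ : ℂ) * 𝓕 (φ : Rn n → ℂ) ξ) := by
  rw [besselSchwartz, SchwartzMap.fourier_coe, fourier_eq_wave, ← integral_neg_eq_self]
  refine integral_congr_ae (.of_forall fun ξ => ?_)
  simp only [SchwartzMap.smulLeftCLM_apply_apply (hasTemperateGrowth_besselSymbol r), smul_eq_mul]
  have h1 : (𝓕⁻ φ : 𝓢(Rn n, ℂ)) (-ξ) = 𝓕 (φ : Rn n → ℂ) ξ := by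
    rw [SchwartzMap.fourierInv_coe, fourierInv_eq_wave, fourier_eq_wave]
  have h2 : wave (-ξ) (-x) = wave ξ x := by simp [wave]
  have h3 : besselSymbol r (-ξ) = besselSymbol r ξ := by simp [besselSymbol]
  rw [h1, h2, h3]

theorem integral_mixKernel_mul_comp_sub {s : ℝ} (hs0 : 0 < s) (hs1 : s < 1) (φ : 𝓢(Rn n, ℂ))
    (x : Rn n) : ∫ y, (mixKernel s y : ℂ) * φ (x - y) =
      ∫ ξ, wave ξ x * ((((1 + ‖ξ‖ ^ 2) ^ s - (‖ξ‖ ^ 2) ^ s : ℝ) : ℂ) * 𝓕 (φ : Rn n → ℂ) ξ) := by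
  have hφ : Integrable (𝓕 (φ : Rn n → ℂ)) := (𝓕 φ).integrable (μ := volume)
  have hI : Integrable (fun w : Rn n × Rn n => wave (x - w.1) w.2 *
      ((mixKernel s w.1 : ℂ) * 𝓕 (φ : Rn n → ℂ) w.2)) (volume.prod volume) := by
    refine ((integrable_mixKernel hs0 hs1).ofReal.mul_prod hφ).bdd_mul (c := 1) ?_
      (.of_forall fun w => (norm_wave _ _).le)
    have : Continuous fun w : Rn n × Rn n => (x - w.1, w.2) := by fun_prop
    exact (continuous_wave.comp this).aestronglyMeasurable
  have hinv (y : Rn n) : φ (x - y) = ∫ ξ, wave (x - y) ξ * 𝓕 (φ : Rn n → ℂ) ξ := by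
    have h1 : (𝓕⁻ (𝓕 φ) : 𝓢(Rn n, ℂ)) (x - y) = φ (x - y) := by
      rw [FourierTransform.fourierInv_fourier_eq]
    rw [← h1, SchwartzMap.fourierInv_coe, fourierInv_eq_wave, SchwartzMap.fourier_coe]
    simp only [fun ξ : Rn n => wave_comm ξ (x - y)]
  calc _ = ∫ y, ∫ ξ, wave (x - y) ξ * ((mixKernel s y : ℂ) * 𝓕 (φ : Rn n → ℂ) ξ) := by
        refine integral_congr_ae (.of_forall fun y => ?_)
        simp only
        rw [hinv, ← integral_const_mul]
        exact integral_congr_ae (.of_forall fun ξ => by ring)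
    _ = ∫ ξ, ∫ y, wave (x - y) ξ * ((mixKernel s y : ℂ) * 𝓕 (φ : Rn n → ℂ) ξ) :=
        integral_integral_swap hI
    _ = _ := by
        refine integral_congr_ae (.of_forall fun ξ => ?_)
        simp only
        rw [← integral_wave_mul_mixKernel hs0 hs1, ← integral_mul_const, ← integral_const_mul]
        refine integral_congr_ae (.of_forall fun y => ?_)
        simp only
        rw [sub_eq_add_neg, wave_add, wave_comm x ξ,
          show wave (-y) ξ = wave y (-ξ) by simp [wave]]
        ring

/-- On the Fourier side, |ξ|^{2s} = (1+|ξ|²)^s - ((1+|ξ|²)^s - |ξ|^{2s}): the first symbol is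
controlled by the hypothesis on m, and the second is the transform of an L¹ kernel, hence harmless
in every L^p with 1 ≤ p < ∞. -/
theorem fracLapSchwartz_eq_bessel_sub {s : ℝ} (hs0 : 0 < s) (hs1 : s < 1) (φ : 𝓢(Rn n, ℂ))
    (x : Rn n) : fracLapSchwartz s φ x = (((2 * Real.pi) ^ (2 * s) : ℝ) : ℂ) *
      (besselSchwartz (2 * s) φ x - ∫ y, (mixKernel s y : ℂ) * φ (x - y)) := by
  have hB : Integrable fun ξ => wave ξ x * ((besselSymbol (2 * s) ξ : ℂ) * 𝓕 (φ : Rn n → ℂ) ξ) := by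
    have h := (SchwartzMap.smulLeftCLM ℂ (fun x : Rn n => ((besselSymbol (2 * s) x : ℝ) : ℂ))
      (𝓕 φ)).integrable (μ := volume)
    refine (h.congr (.of_forall fun ξ => ?_)).bdd_mul (c := 1) ?_
      (.of_forall fun w => (norm_wave _ _).le)
    · exact SchwartzMap.smulLeftCLM_apply_apply (hasTemperateGrowth_besselSymbol _) _ _
    · simp only [fun ξ : Rn n => wave_comm ξ x]
      exact (continuous_wave_right x).aestronglyMeasurable
  have hL : Integrable fun ξ => wave ξ x * (((‖ξ‖ ^ 2) ^ s : ℝ) * 𝓕 (φ : Rn n → ℂ) ξ) := by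
    have h := (integrable_lapSymbol_mul_schwartz hs0.le (𝓕 φ)).const_mul
      ((((2 * Real.pi) ^ (2 * s))⁻¹ : ℝ) : ℂ)
    refine (h.congr (.of_forall fun ξ => ?_)).bdd_mul (c := 1) ?_
      (.of_forall fun w => (norm_wave _ _).le)
    · simp only [lapSymbol]
      rw [← mul_assoc, ← Complex.ofReal_mul, Real.mul_rpow (by positivity) (norm_nonneg _),
        ← Real.rpow_natCast_mul (norm_nonneg ξ), inv_mul_cancel_left₀ (by positivity)]
      rfl
    · simp only [fun ξ : Rn n => wave_comm ξ x]
      exact (continuous_wave_right x).aestronglyMeasurable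
  have hb (ξ : Rn n) : besselSymbol (2 * s) ξ = (1 + ‖ξ‖ ^ 2) ^ s := by
    simp [besselSymbol]
  rw [besselSchwartz_apply, integral_mixKernel_mul_comp_sub hs0 hs1]
  have hsub : ∫ ξ, wave ξ x * ((((1 + ‖ξ‖ ^ 2) ^ s - (‖ξ‖ ^ 2) ^ s : ℝ) : ℂ) *
      𝓕 (φ : Rn n → ℂ) ξ) = (∫ ξ, wave ξ x * ((besselSymbol (2 * s) ξ : ℂ) * 𝓕 (φ : Rn n → ℂ) ξ)) -
        ∫ ξ, wave ξ x * (((‖ξ‖ ^ 2) ^ s : ℝ) * 𝓕 (φ : Rn n → ℂ) ξ) := by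
    rw [← integral_sub hB hL]
    refine integral_congr_ae (.of_forall fun ξ => ?_)
    simp only [hb]
    push_cast
    ring
  rw [hsub, sub_sub_cancel, ← integral_const_mul, fracLapSchwartz, fourierInv_eq_wave]
  refine integral_congr_ae (.of_forall fun ξ => ?_)
  simp only [lapSymbol]
  rw [Real.mul_rpow (by positivity) (norm_nonneg _), ← Real.rpow_natCast_mul (norm_nonneg ξ)]
  push_cast
  ring

/-- The complex conjugate of a Schwartz function. -/
def conjSchwartz (φ : 𝓢(Rn n, ℂ)) : 𝓢(Rn n, ℂ) :=
  SchwartzMap.postcompCLM (𝕜 := ℝ) (Complex.conjCLE : ℂ →L[ℝ] ℂ) φ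

theorem conjSchwartz_apply (φ : 𝓢(Rn n, ℂ)) (x : Rn n) :
    conjSchwartz φ x = starRingEnd ℂ (φ x) := rfl

/-- Clear from the pointwise formula, whose kernel is real. -/
theorem fracLapSchwartz_conj (hn : 0 < n) {s : ℝ} (hs0 : 0 < s) (hs1 : s < 1) (φ : 𝓢(Rn n, ℂ))
    (x : Rn n) : fracLapSchwartz s (conjSchwartz φ) x = starRingEnd ℂ (fracLapSchwartz s φ x) := by
  rw [fracLapSchwartz_eq_integral_sdiff hn hs0 hs1, fracLapSchwartz_eq_integral_sdiff hn hs0 hs1,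
    map_mul, ← integral_conj, Complex.conj_ofReal]
  simp only [sdiff, conjSchwartz_apply, map_sub, map_mul, Complex.conj_ofNat]

theorem exists_isFracLap {s : ℝ} (hs0 : 0 < s) (hs1 : s < 1) (hsn : 2 * s < (n : ℝ))
    {p : ℝ≥0∞} [Fact (1 ≤ p)] (hp : p = ENNReal.ofReal ((n : ℝ) / (2 * s))) {m : Rn n → ℝ}
    (hm : MemW (2 * s) p (fun x => (m x : ℂ))) : ∃ L, IsFracLap s p m L := by
  have hn : 0 < n := by
    have : (0 : ℝ) < n := by linarith
    exact_mod_cast this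
  have hp1 : 1 ≤ p := Fact.out
  have hp' : p ≠ ∞ := hp ▸ ENNReal.ofReal_ne_top
  have hpq : ENNReal.HolderTriple p (ENNReal.ofReal ((n : ℝ) / (n - 2 * s))) 1 :=
    hp ▸ holderTriple_fracLap hs0 hsn
  obtain ⟨hf, g, hg⟩ := hm
  have hgφ (φ : 𝓢(Rn n, ℂ)) : ∫ x, (m x : ℂ) * besselSchwartz (2 * s) φ x = ∫ x, g x * φ x := by
    have h := congrArg (fun T : 𝓢'(Rn n, ℂ) => T φ) hg
    simp only [besselPotential, TemperedDistribution.fourierMultiplierCLM_apply_apply,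
      Lp.toTemperedDistribution_apply, smul_eq_mul] at h
    calc _ = ∫ x, besselSchwartz (2 * s) φ x * hf.toLp _ x := by
          refine integral_congr_ae ?_
          filter_upwards [hf.coeFn_toLp] with x hx
          rw [hx, mul_comm]
      _ = ∫ x, φ x * g x := h
      _ = _ := integral_congr_ae (.of_forall fun x => mul_comm _ _)
  have hgL : MemLp g p volume := Lp.memLp g
  set K : Rn n → ℂ := fun y => (mixKernel s y : ℂ) with hK
  have hKi : Integrable K := (integrable_mixKernel hs0 hs1).ofReal
  have hKev (y : Rn n) : K (-y) = K y := by simp only [hK, mixKernel_neg]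
  set c : ℂ := (((2 * Real.pi) ^ (2 * s) : ℝ) : ℂ) with hc
  -- The function `g` is the Bessel potential of order 2s of m, in L^p by hypothesis; `L₀` is the
  -- candidate for (-Δ)^s m, not yet known to be real.
  set L₀ : Rn n → ℂ := fun x => c * (g x - moll (fun x => (m x : ℂ)) K x) with hL₀
  have hmoll := memLp_moll_of_even hf hKi.1 hKev (lintegral_enorm_mixKernel hs0 hs1) hp1 hp'
  have hL₀p : MemLp L₀ p volume := (hgL.sub hmoll).const_mul c
  have hmulS {f : Rn n → ℂ} (hf : MemLp f p volume) (φ : 𝓢(Rn n, ℂ)) :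
      Integrable fun x => f x * φ x :=
    memLp_one_iff_integrable.1 ((φ.memLp (ENNReal.ofReal ((n : ℝ) / (n - 2 * s))) volume).mul' hf)
  have hmain (φ : 𝓢(Rn n, ℂ)) : Integrable (fun x => (m x : ℂ) * fracLapSchwartz s φ x) ∧
      ∫ x, L₀ x * φ x = ∫ x, (m x : ℂ) * fracLapSchwartz s φ x := by
    obtain ⟨i1, e1⟩ := integral_mul_conv (q := ENNReal.ofReal ((n : ℝ) / (n - 2 * s))) hf hKi hKev φ
    have i2 := hmulS hf (besselSchwartz (2 * s) φ)
    have hpt (x : Rn n) : c * ((m x : ℂ) * besselSchwartz (2 * s) φ x -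
        (m x : ℂ) * ∫ y, K y * φ (x - y)) = (m x : ℂ) * fracLapSchwartz s φ x := by
      rw [fracLapSchwartz_eq_bessel_sub hs0 hs1]
      ring
    refine ⟨((i2.sub i1).const_mul c).congr (.of_forall hpt), ?_⟩
    calc _ = ∫ x, c * (g x * φ x - moll (fun x => (m x : ℂ)) K x * φ x) :=
          integral_congr_ae (.of_forall fun x => by simp only [hL₀]; ring)
      _ = c * ((∫ x, (m x : ℂ) * besselSchwartz (2 * s) φ x) -
            ∫ x, (m x : ℂ) * ∫ y, K y * φ (x - y)) := by
          rw [integral_const_mul, integral_sub (hmulS hgL φ) (hmulS hmoll φ), hgφ, e1]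
      _ = _ := by
          rw [← integral_sub i2 i1, ← integral_const_mul]
          exact integral_congr_ae (.of_forall hpt)
  -- As m is real and (-Δ)^s commutes with conjugation, the conjugate of `L₀` represents the same
  -- distribution, and hence so does the average of the two, the real part.
  refine ⟨fun x => (L₀ x).re, hL₀p.re, fun φ => ⟨(hmain φ).1, ?_⟩⟩
  have hLc : MemLp (fun x => starRingEnd ℂ (L₀ x)) p volume := hL₀p.star
  have hconj : ∫ x, starRingEnd ℂ (L₀ x) * φ x = ∫ x, (m x : ℂ) * fracLapSchwartz s φ x := by
    have h := congrArg (starRingEnd ℂ) (hmain (conjSchwartz φ)).2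
    rw [← integral_conj, ← integral_conj] at h
    simp only [map_mul, conjSchwartz_apply, Complex.conj_conj, Complex.conj_ofReal,
      fracLapSchwartz_conj hn hs0 hs1] at h
    exact h
  calc _ = ∫ x, (2⁻¹ : ℂ) * (L₀ x * φ x + starRingEnd ℂ (L₀ x) * φ x) := by
        refine integral_congr_ae (.of_forall fun x => ?_)
        simp only [Complex.re_eq_add_conj]
        ring
    _ = _ := by
        rw [integral_const_mul, integral_add (hmulS hL₀p φ) (hmulS hLc φ), (hmain φ).2, hconj]
        ring

/-! ### The dual of `H^s` -/

section Dual

variable {s : ℝ}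

theorem MemH.add (hn : 0 < n) (hs0 : 0 < s) (hs1 : s < 1) {u v : Rn n → ℂ} (hu : MemH s u)
    (hv : MemH s v) : MemH s (fun x => u x + v x) := by
  refine (memH_iff_memLp_diff hn hs0 hs1).2 ⟨hu.memLp.add hv.memLp, ?_⟩
  refine ((memLp_diff hn hs0 hs1 hu).add (memLp_diff hn hs0 hs1 hv)).ae_eq (.of_forall fun z => ?_)
  simp only [Pi.add_apply, diff]
  ring

theorem MemH.const_mul (hn : 0 < n) (hs0 : 0 < s) (hs1 : s < 1) {u : Rn n → ℂ} (hu : MemH s u)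
    (c : ℂ) : MemH s (fun x => c * u x) := by
  refine (memH_iff_memLp_diff hn hs0 hs1).2 ⟨hu.memLp.const_mul c, ?_⟩
  refine ((memLp_diff hn hs0 hs1 hu).const_mul c).ae_eq (.of_forall fun z => ?_)
  simp only [diff]
  ring

theorem memH_schwartz (s : ℝ) (φ : 𝓢(Rn n, ℂ)) : MemH s φ := by
  have h2 : MemLp φ 2 volume := φ.memLp 2 volume
  have h := (SchwartzMap.smulLeftCLM ℂ (fun x : Rn n => ((besselSymbol s x : ℝ) : ℂ))
    (𝓕 φ)).memLp 2 volume
  have h3 : MemLp (fun ξ => (besselSymbol s ξ : ℂ) * fourierL2 φ ξ) 2 volume := by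
    refine h.ae_eq ?_
    filter_upwards [fourierL2_eq_fourier φ.integrable h2] with ξ hξ
    rw [SchwartzMap.smulLeftCLM_apply_apply (hasTemperateGrowth_besselSymbol s), hξ, smul_eq_mul,
      SchwartzMap.fourier_coe]
  rw [memH_iff]
  refine ⟨h2, ?_⟩
  refine lt_of_eq_of_lt (lintegral_congr fun ξ => ?_) ((memLp_two_iff_lintegral h3.1).1 h3)
  rw [enorm_mul, mul_pow, ← besselSymbol_sq, ENNReal.ofReal_pow (besselSymbol_pos s ξ).le,
    ← ofReal_norm (besselSymbol s ξ : ℂ), Complex.norm_real,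
    Real.norm_of_nonneg (besselSymbol_pos s ξ).le]

theorem energy_rpow_le_wNorm (hs0 : 0 < s) {u : Rn n → ℂ} (hu : MemLp u 2 volume) :
    energy s u ^ (1 / 2 : ℝ) ≤
      ENNReal.ofReal ((2 * Real.pi) ^ (2 * s)) ^ (1 / 2 : ℝ) * wNorm s 2 u := by
  rw [wNorm_two hu, ← ENNReal.mul_rpow_of_nonneg _ _ (by norm_num)]
  exact ENNReal.rpow_le_rpow (energy_le_sobEnergy hs0.le u) (by norm_num)

theorem exists_le_coe_mul {a b c : ℝ≥0∞} (hc : c ≠ ∞) (h : a ≤ c * b) : a ≤ (c.toNNReal : ℝ≥0∞) * b := by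
  rwa [ENNReal.coe_toNNReal hc]

/-- Cauchy–Schwarz on the jump measure, together with the bound of the Gagliardo seminorm by the H^s
norm. It serves for both the conductivity operator and the fractional Laplacian. -/
theorem memHNeg_integral_mul_diff (hn : 0 < n) (hs0 : 0 < s) (hs1 : s < 1) {G : Rn n × Rn n → ℂ}
    (hG : MemLp G 2 (jump n s)) {T : (Rn n → ℂ) → ℂ}
    (hT : ∀ φ, MemH s φ → T φ = ∫ z, G z * diff φ z ∂jump n s) : MemHNeg s T := by
  have h22 := holderTriple_two
  have hi {φ : Rn n → ℂ} (hφ : MemH s φ) : Integrable (fun z => G z * diff φ z) (jump n s) :=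
    memLp_one_iff_integrable.1 ((memLp_diff hn hs0 hs1 hφ).mul' hG)
  refine ⟨fun φ ψ hφ hψ => ?_, fun c φ hφ => ?_, ?_⟩
  · rw [hT _ (hφ.add hn hs0 hs1 hψ), hT _ hφ, hT _ hψ, ← integral_add (hi hφ) (hi hψ)]
    refine integral_congr_ae (.of_forall fun z => ?_)
    simp only [diff]
    ring
  · rw [hT _ (hφ.const_mul hn hs0 hs1 c), hT _ hφ, ← integral_const_mul]
    refine integral_congr_ae (.of_forall fun z => ?_)
    simp only [diff]
    ring
  · set c : ℝ≥0∞ := eLpNorm G 2 (jump n s) * (ENNReal.ofReal (2 / fracConst n s) ^ (1 / 2 : ℝ) *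
      ENNReal.ofReal ((2 * Real.pi) ^ (2 * s)) ^ (1 / 2 : ℝ)) with hc
    have hctop : c ≠ ∞ := ENNReal.mul_ne_top hG.2.ne (ENNReal.mul_ne_top
      (ENNReal.rpow_ne_top_of_nonneg (by norm_num) ENNReal.ofReal_ne_top)
      (ENNReal.rpow_ne_top_of_nonneg (by norm_num) ENNReal.ofReal_ne_top))
    refine ⟨c.toNNReal, fun φ hφ => exists_le_coe_mul hctop ?_⟩
    rw [hT _ hφ]
    refine (enorm_integral_le_lintegral_enorm _).trans ?_
    rw [← eLpNorm_one_eq_lintegral_enorm]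
    refine (eLpNorm_smul_le_mul_eLpNorm (p := 2) (q := 2) (r := 1) (φ := G)
      (memLp_diff hn hs0 hs1 hφ).1 hG.1).trans ?_
    rw [hc, mul_assoc, mul_assoc]
    refine mul_le_mul' le_rfl ?_
    rw [eLpNorm_two_sq, lintegral_diff_sq hn hs0 hs1 hφ.memLp,
      ENNReal.mul_rpow_of_nonneg _ _ (by norm_num)]
    exact mul_le_mul' le_rfl (energy_rpow_le_wNorm hs0 hφ.memLp)

/-- Hölder with exponents n/(2s), 2n/(n-2s), 2n/(n-2s), whose reciprocals add up to 1; the Sobolev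
inequality controls the last two factors. -/
theorem memHNeg_integral_mul_mul (hs0 : 0 < s) (hs1 : s < 1) (hsn : 2 * s < (n : ℝ))
    {Q w : Rn n → ℂ} (hQ : MemLp Q (ENNReal.ofReal ((n : ℝ) / (2 * s))) volume) (hw : MemH s w) :
    (∀ φ, MemH s φ → Integrable fun x => Q x * w x * φ x) ∧
      MemHNeg s (fun φ => ∫ x, Q x * w x * φ x) := by
  have hn : 0 < n := by
    have : (0 : ℝ) < n := by linarith
    exact_mod_cast this
  have hrr := holderTriple_sobExp hs0 hsn
  have hpq := holderTriple_fracLap hs0 hsn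
  set p := ENNReal.ofReal ((n : ℝ) / (2 * s))
  set q := ENNReal.ofReal ((n : ℝ) / (n - 2 * s))
  set r := ENNReal.ofReal (sobExp n s) with hr
  have hi (φ : Rn n → ℂ) (hφ : MemH s φ) : Integrable (fun x => Q x * w x * φ x) := by
    refine (memLp_one_iff_integrable.1 ((hw.memLp_mul hs0 hs1 hsn hφ).mul' hQ)).congr
      (.of_forall fun x => ?_)
    simp only [mul_assoc]
  refine ⟨hi, fun φ ψ hφ hψ => ?_, fun c φ hφ => ?_, ?_⟩
  · rw [← integral_add (hi φ hφ) (hi ψ hψ)]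
    exact integral_congr_ae (.of_forall fun x => by ring)
  · rw [← integral_const_mul]
    exact integral_congr_ae (.of_forall fun x => by ring)
  · obtain ⟨K, hK⟩ := exists_eLpNorm_sobExp_le hn hs0 hsn
    have hwr := hw.memLp_sobExp hs0 hs1 hsn
    set c : ℝ≥0∞ := eLpNorm Q p volume * (eLpNorm w r volume * (K *
      ENNReal.ofReal ((2 * Real.pi) ^ (2 * s)) ^ (1 / 2 : ℝ))) with hc
    have hctop : c ≠ ∞ := ENNReal.mul_ne_top hQ.2.ne (ENNReal.mul_ne_top hwr.2.ne
      (ENNReal.mul_ne_top ENNReal.coe_ne_top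
        (ENNReal.rpow_ne_top_of_nonneg (by norm_num) ENNReal.ofReal_ne_top)))
    refine ⟨c.toNNReal, fun φ hφ => exists_le_coe_mul hctop ?_⟩
    refine (enorm_integral_le_lintegral_enorm _).trans ?_
    rw [← eLpNorm_one_eq_lintegral_enorm]
    have e : (fun x => Q x * w x * φ x) = Q • (w • φ) := by
      ext x
      simp [mul_assoc]
    rw [e]
    refine (eLpNorm_smul_le_mul_eLpNorm (p := p) (q := q) (r := 1)
      (hw.memLp.1.smul hφ.memLp.1) hQ.1).trans ?_
    rw [hc, mul_assoc]
    refine mul_le_mul' le_rfl ((eLpNorm_smul_le_mul_eLpNorm (p := r) (q := r) (r := q)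
      hφ.memLp.1 hw.memLp.1).trans ?_)
    rw [mul_assoc, mul_assoc]
    refine mul_le_mul' le_rfl ((hK φ hφ.memLp).trans ?_)
    exact mul_le_mul' le_rfl (energy_rpow_le_wNorm hs0 hφ.memLp)

theorem MemHNeg.add {T S : (Rn n → ℂ) → ℂ} (hT : MemHNeg s T) (hS : MemHNeg s S) :
    MemHNeg s (fun φ => T φ + S φ) := by
  obtain ⟨a1, m1, K1, h1⟩ := hT
  obtain ⟨a2, m2, K2, h2⟩ := hS
  refine ⟨fun φ ψ hφ hψ => ?_, fun c φ hφ => ?_, K1 + K2, fun φ hφ => ?_⟩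
  · beta_reduce
    rw [a1 φ ψ hφ hψ, a2 φ ψ hφ hψ]
    ring
  · beta_reduce
    rw [m1 c φ hφ, m2 c φ hφ]
    ring
  · rw [ENNReal.coe_add, add_mul]
    exact (enorm_add_le _ _).trans (add_le_add (h1 φ hφ) (h2 φ hφ))

theorem memHNeg_fracLapH (hn : 0 < n) (hs0 : 0 < s) (hs1 : s < 1) {w : Rn n → ℂ} (hw : MemH s w) :
    MemHNeg s (fracLapH s w) := by
  have hC := fracConst_pos n hs0 hs1
  refine memHNeg_integral_mul_diff hn hs0 hs1
    ((memLp_diff hn hs0 hs1 hw).const_mul ((fracConst n s / 2 : ℝ) : ℂ)) fun φ hφ => ?_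
  simp only [mul_assoc]
  rw [integral_const_mul, integral_diff_mul_diff hn hs0 hs1 hw hφ, ← mul_assoc, ← Complex.ofReal_mul,
    show (fracConst n s / 2 * (2 / fracConst n s) : ℝ) = 1 by field_simp, Complex.ofReal_one, one_mul]

/-! ### Density of test functions -/

theorem tendsto_fourier_mollifier {ρ : ℕ → 𝓢(Rn n, ℂ)} (hρ : IsMollifier ρ) (ξ : Rn n) :
    Filter.Tendsto (fun k => 𝓕 (ρ k : Rn n → ℂ) ξ) Filter.atTop (nhds 1) := by
  have hw : Continuous fun y : Rn n => wave y (-ξ) := by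
    simp only [fun y : Rn n => wave_comm y (-ξ)]
    exact continuous_wave_right (-ξ)
  rw [Metric.tendsto_atTop]
  intro ε hε
  obtain ⟨δ, hδ, hc⟩ := Metric.continuous_iff.1 hw 0 (ε / 2) (half_pos hε)
  obtain ⟨N, hN⟩ := exists_nat_one_div_lt hδ
  refine ⟨N, fun k hk => ?_⟩
  have hi := (ρ k).integrable (μ := volume)
  have hi2 : Integrable fun x => wave x (-ξ) * ρ k x :=
    hi.bdd_mul (c := 1) hw.aestronglyMeasurable (.of_forall fun x => (norm_wave _ _).le)
  have e : 𝓕 (ρ k : Rn n → ℂ) ξ - 1 = ∫ x, (wave x (-ξ) - wave 0 (-ξ)) * ρ k x := by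
    rw [fourier_eq_wave, ← hρ.integral k, ← integral_sub hi2 hi]
    refine integral_congr_ae (.of_forall fun x => ?_)
    simp only [wave, inner_zero_left, AddChar.map_zero_eq_one, Circle.coe_one]
    ring
  have hmass : ∫ x, ‖ρ k x‖ = 1 := by
    rw [integral_norm_eq_lintegral_enorm hi.1, hρ.mass k, ENNReal.toReal_one]
  rw [dist_eq_norm, e]
  calc _ ≤ ∫ x, ε / 2 * ‖ρ k x‖ := by
        refine norm_integral_le_of_norm_le (hi.norm.const_mul _) (.of_forall fun x => ?_)
        rw [norm_mul]
        by_cases hx : ρ k x = 0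
        · simp [hx]
        refine mul_le_mul_of_nonneg_right ?_ (norm_nonneg _)
        have h1 := hρ.support k hx
        rw [← dist_eq_norm]
        refine (hc x ((Metric.mem_ball.1 h1).trans_le ?_)).le
        refine le_trans ?_ hN.le
        exact one_div_le_one_div_of_le (by positivity) (by exact_mod_cast Nat.succ_le_succ hk)
    _ = ε / 2 := by rw [integral_const_mul, hmass, mul_one]
    _ < ε := half_lt_self hε

theorem norm_fourier_mollifier_le {ρ : ℕ → 𝓢(Rn n, ℂ)} (hρ : IsMollifier ρ) (k : ℕ) (ξ : Rn n) :
    ‖𝓕 (ρ k : Rn n → ℂ) ξ‖ₑ ≤ 1 := by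
  rw [fourier_eq_wave, ← hρ.mass k]
  refine (enorm_integral_le_lintegral_enorm _).trans_eq (lintegral_congr fun x => ?_)
  rw [enorm_mul, ← ofReal_norm (wave _ _), norm_wave, ENNReal.ofReal_one, one_mul]

/-- An `H^s` function with compact support in `Ω` is a limit of test functions of `Ω`. -/
theorem exists_isTest_tendsto {Ω C : Set (Rn n)} (hΩ : IsOpen Ω) (hC : IsCompact C) (hCΩ : C ⊆ Ω)
    {v : Rn n → ℂ} (hv : MemH s v) (hsupp : ∀ x, x ∉ C → v x = 0) :
    ∃ φ : ℕ → 𝓢(Rn n, ℂ), (∀ᶠ k in Filter.atTop, IsTest Ω (φ k)) ∧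
      Filter.Tendsto (fun k => wNorm s 2 (fun x => v x - φ k x)) Filter.atTop (nhds 0) := by
  have h22 := holderTriple_two
  obtain ⟨ρ, hρ⟩ := exists_isMollifier n
  have hvc : HasCompactSupport v := HasCompactSupport.intro hC hsupp
  have hv2 := hv.memLp
  have hv1 : Integrable v := by
    have h1 := memLp_indicator_const (μ := (volume : Measure (Rn n))) 2 hC.measurableSet (1 : ℂ)
      (Or.inr hC.measure_lt_top.ne)
    refine (memLp_one_iff_integrable.1 (hv2.mul' h1)).congr (.of_forall fun x => ?_)
    by_cases hx : x ∈ C <;> simp [hx, hsupp]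
  have hsm (k : ℕ) : ContDiff ℝ (↑(⊤ : ℕ∞)) (moll v (ρ k)) :=
    (hρ.compact k).contDiff_convolution_right (ContinuousLinearMap.mul ℝ ℂ) hv1.locallyIntegrable
      ((ρ k).smooth _)
  have hcs (k : ℕ) : HasCompactSupport (moll v (ρ k)) :=
    hvc.convolution (ContinuousLinearMap.mul ℝ ℂ) (hρ.compact k)
  refine ⟨fun k => (hcs k).toSchwartzMap (hsm k), ?_, ?_⟩
  -- A compact subset of the open set Ω has a closed neighbourhood of some radius δ inside Ω, which
  -- contains the support of the mollification as soon as the mollifier has radius at most δ.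
  · obtain ⟨δ, hδ, hδΩ⟩ := hC.exists_cthickening_subset_open hΩ hCΩ
    obtain ⟨N, hN⟩ := exists_nat_one_div_lt hδ
    filter_upwards [Filter.eventually_ge_atTop N] with k hk
    refine ⟨hcs k, (closure_minimal ?_ Metric.isClosed_cthickening).trans hδΩ⟩
    intro x hx
    by_contra hx'
    refine hx (integral_eq_zero_of_ae (.of_forall fun z => ?_))
    simp only [Pi.zero_apply, mul_eq_zero]
    by_contra! hz
    refine hx' (Metric.mem_cthickening_of_dist_le x z δ C
      (by_contra fun h => hz.1 (hsupp z h)) ?_)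
    have h1 := Metric.mem_ball.1 (hρ.support k hz.2)
    rw [dist_zero_right, ← dist_eq_norm] at h1
    refine h1.le.trans (le_trans ?_ hN.le)
    exact one_div_le_one_div_of_le (by positivity) (by exact_mod_cast Nat.succ_le_succ hk)
  · have happ (k : ℕ) (x : Rn n) : (hcs k).toSchwartzMap (hsm k) x = moll v (ρ k) x := rfl
    simp only [happ]
    have hm2 (k : ℕ) : MemLp (moll v (ρ k)) 2 volume :=
      ((hcs k).toSchwartzMap (hsm k)).memLp 2 volume
    have hm1 (k : ℕ) : Integrable (moll v (ρ k)) :=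
      ((hcs k).toSchwartzMap (hsm k)).integrable (μ := volume)
    -- Mollification multiplies the transform by that of ρ_k, which has modulus at most 1 and tends
    -- to 1 pointwise. The H^s error thus tends to 0 by dominated convergence, with 4 times the
    -- energy density of v as majorant.
    have hF (k : ℕ) : fourierL2 (fun x => v x - moll v (ρ k) x) =ᵐ[volume]
        fun ξ => fourierL2 v ξ * (1 - 𝓕 (ρ k : Rn n → ℂ) ξ) := by
      filter_upwards [fourierL2_sub hv2 (hm2 k), fourierL2_eq_fourier (hm1 k) (hm2 k),
        fourierL2_eq_fourier hv1 hv2] with ξ h1 h2 h3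
      have h4 : 𝓕 (moll v (ρ k)) ξ = 𝓕 v ξ * 𝓕 (ρ k : Rn n → ℂ) ξ :=
        Real.fourier_mul_convolution_eq hv1 (ρ k).integrable ξ
      rw [h1, h2, h4, h3]
      ring
    have hfin := ((memH_iff s v).1 hv).2
    have hlim : Filter.Tendsto (fun k => sobEnergy s (fun x => v x - moll v (ρ k) x))
        Filter.atTop (nhds 0) := by
      have hE (k : ℕ) : sobEnergy s (fun x => v x - moll v (ρ k) x) =
          ∫⁻ ξ, ENNReal.ofReal (sobWeight s ξ) *
            ‖fourierL2 v ξ * (1 - 𝓕 (ρ k : Rn n → ℂ) ξ)‖ₑ ^ 2 := by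
        refine lintegral_congr_ae ?_
        filter_upwards [hF k] with ξ hξ
        rw [hξ]
      simp only [hE]
      have hwm : Measurable fun ξ : Rn n => ENNReal.ofReal (sobWeight s ξ) := by
        unfold sobWeight
        fun_prop
      have h0 : ∫⁻ ξ : Rn n, (0 : ℝ≥0∞) = 0 := lintegral_zero
      rw [← h0]
      refine tendsto_lintegral_of_dominated_convergence'
        (fun ξ => 4 * (ENNReal.ofReal (sobWeight s ξ) * ‖fourierL2 v ξ‖ₑ ^ 2)) (fun k => ?_)
        (fun k => .of_forall fun ξ => ?_) ?_ ?_
      · refine hwm.aemeasurable.mul (AEMeasurable.pow_const (AEStronglyMeasurable.enorm ?_) 2)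
        exact (aestronglyMeasurable_fourierL2 v).mul
          (aestronglyMeasurable_const.sub (continuous_fourier (ρ k).integrable).aestronglyMeasurable)
      · beta_reduce
        rw [enorm_mul, mul_pow]
        have h1 : ‖1 - 𝓕 (ρ k : Rn n → ℂ) ξ‖ₑ ≤ 2 := by
          refine enorm_sub_le.trans ?_
          rw [enorm_one]
          exact (add_le_add le_rfl (norm_fourier_mollifier_le hρ k ξ)).trans_eq one_add_one_eq_two
        calc _ ≤ ENNReal.ofReal (sobWeight s ξ) * (‖fourierL2 v ξ‖ₑ ^ 2 * 2 ^ 2) := by gcongr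
          _ = _ := by ring
      · rw [lintegral_const_mul' _ _ (by norm_num)]
        exact ENNReal.mul_ne_top (by norm_num) hfin.ne
      · refine .of_forall fun ξ => ?_
        have h1 : Filter.Tendsto (fun k => fourierL2 v ξ * (1 - 𝓕 (ρ k : Rn n → ℂ) ξ)) Filter.atTop
            (nhds 0) := by
          simpa using ((tendsto_const_nhds (x := (1 : ℂ))).sub
            (tendsto_fourier_mollifier hρ ξ)).const_mul (fourierL2 v ξ)
        have h2 := (ENNReal.continuous_pow 2).tendsto _ |>.comp (h1.enorm)
        have h3 := ENNReal.Tendsto.const_mul h2 (Or.inr ENNReal.ofReal_ne_top :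
          (‖(0 : ℂ)‖ₑ ^ 2 ≠ 0 ∨ ENNReal.ofReal (sobWeight s ξ) ≠ ∞))
        simpa using h3
    have h1 := hlim.ennrpow_const (1 / 2 : ℝ)
    rw [ENNReal.zero_rpow_of_pos (by norm_num)] at h1
    refine h1.congr fun k => ?_
    exact (wNorm_two (hv2.sub (hm2 k))).symm

/-- Vanishing in Ω is stated for smooth test functions, but it will be needed for their products
with γ^{1/2} and γ^{-1/2}, which lie only in H^s. Continuity of T and approximation by test
functions bridge the gap. -/
theorem MemHNeg.eq_zero_of_vanishesIn (hn : 0 < n) (hs0 : 0 < s) (hs1 : s < 1)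
    {T : (Rn n → ℂ) → ℂ} (hT : MemHNeg s T)
    {Ω C : Set (Rn n)} (hΩ : IsOpen Ω) (hTΩ : VanishesIn Ω T) (hC : IsCompact C) (hCΩ : C ⊆ Ω)
    {v : Rn n → ℂ} (hv : MemH s v) (hsupp : ∀ x, x ∉ C → v x = 0) : T v = 0 := by
  obtain ⟨φ, hφ, hlim⟩ := exists_isTest_tendsto hΩ hC hCΩ hv hsupp
  obtain ⟨hadd, hmul, K, hK⟩ := hT
  have hle (k : ℕ) (hk : IsTest Ω (φ k)) : ‖T v‖ₑ ≤ K * wNorm s 2 (fun x => v x - φ k x) := by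
    have h1 : MemH s (fun x => v x + (-1) * φ k x) :=
      hv.add hn hs0 hs1 ((memH_schwartz s (φ k)).const_mul hn hs0 hs1 (-1))
    have h2 : T (fun x => v x + (-1) * φ k x) = T v := by
      rw [hadd _ _ hv ((memH_schwartz s (φ k)).const_mul hn hs0 hs1 (-1)), hmul _ _ (memH_schwartz s (φ k)), hTΩ _ hk,
        mul_zero, add_zero]
    have h3 := hK _ h1
    rw [h2] at h3
    simpa only [neg_one_mul, ← sub_eq_add_neg] using h3
  have h4 : Filter.Tendsto (fun k => (K : ℝ≥0∞) * wNorm s 2 (fun x => v x - φ k x)) Filter.atTop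
      (nhds 0) := by
    simpa using ENNReal.Tendsto.const_mul hlim (Or.inr ENNReal.coe_ne_top)
  have h5 : ‖T v‖ₑ ≤ 0 := ge_of_tendsto h4 (hφ.mono hle)
  simpa using h5

end Dual

/-! ### The conductivity equation -/

section Conductivity

variable {s : ℝ} (hs0 : 0 < s) (hs1 : s < 1) (hsn : 2 * s < (n : ℝ)) {γ : Rn n → ℝ}
  (hγ : Measurable γ) {lo hi : ℝ} (hlo : 0 < lo) (hbd : ∀ᵐ x, lo ≤ γ x ∧ γ x ≤ hi)
  {L : Rn n → ℝ} (hL : IsFracLap s (ENNReal.ofReal ((n : ℝ) / (2 * s))) (mCond γ) L)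

theorem pos_of_two_mul_lt {s : ℝ} (hs0 : 0 < s) (hsn : 2 * s < (n : ℝ)) : 0 < n := by
  have : (0 : ℝ) < n := by linarith
  exact_mod_cast this

theorem diff_sqrtCond (γ : Rn n → ℝ) (z : Rn n × Rn n) :
    diff (fun x => (sqrtCond γ x : ℂ)) z = diff (fun x => (mCond γ x : ℂ)) z := by
  simp only [diff, mCond]
  push_cast
  ring

include hγ in
theorem aesm_sqrtCond : AEStronglyMeasurable (fun x => (sqrtCond γ x : ℂ)) volume :=
  (Complex.measurable_ofReal.comp hγ.sqrt).aestronglyMeasurable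

include hγ in
theorem aesm_invSqrtCond : AEStronglyMeasurable (fun x => (invSqrtCond γ x : ℂ)) volume :=
  (Complex.measurable_ofReal.comp hγ.sqrt.inv).aestronglyMeasurable

include hγ in
theorem aesm_mCond : AEStronglyMeasurable (fun x => (mCond γ x : ℂ)) volume :=
  (Complex.measurable_ofReal.comp (hγ.sqrt.sub measurable_const)).aestronglyMeasurable

include hlo hbd in
theorem sqrtCond_bounds : ∀ᵐ x, Real.sqrt lo ≤ sqrtCond γ x ∧ sqrtCond γ x ≤ Real.sqrt hi ∧
    0 < sqrtCond γ x := by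
  filter_upwards [hbd] with x hx
  exact ⟨Real.sqrt_le_sqrt hx.1, Real.sqrt_le_sqrt hx.2, Real.sqrt_pos.2 (hlo.trans_le hx.1)⟩

include hlo hbd in
theorem norm_sqrtCond_le : ∀ᵐ x, ‖(sqrtCond γ x : ℂ)‖ ≤ Real.sqrt hi := by
  filter_upwards [sqrtCond_bounds hlo hbd] with x hx
  rw [Complex.norm_real, Real.norm_of_nonneg hx.2.2.le]
  exact hx.2.1

include hlo hbd in
theorem norm_invSqrtCond_le : ∀ᵐ x, ‖(invSqrtCond γ x : ℂ)‖ ≤ (Real.sqrt lo)⁻¹ := by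
  filter_upwards [sqrtCond_bounds hlo hbd] with x hx
  have h0 : 0 < Real.sqrt lo := Real.sqrt_pos.2 hlo
  rw [Complex.norm_real,
    Real.norm_of_nonneg (show 0 ≤ invSqrtCond γ x from inv_nonneg.2 (Real.sqrt_nonneg _))]
  exact inv_anti₀ h0 hx.1

include hlo hbd in
theorem norm_mCond_le : ∀ᵐ x, ‖(mCond γ x : ℂ)‖ ≤ Real.sqrt hi + 1 := by
  filter_upwards [sqrtCond_bounds hlo hbd] with x hx
  rw [Complex.norm_real, Real.norm_eq_abs, abs_le, mCond]
  constructor <;> linarith [hx.2.1, hx.2.2]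

include hlo hbd in
-- 1/a(x+h) - 1/a(x) = -δa/(a(x) a(x+h)) for a = γ^{1/2}, and a(x) a(x+h) ≥ `lo` almost everywhere.
-- So γ^{-1/2} inherits the multiplier property from m.
theorem norm_diff_invSqrtCond_le (s : ℝ) : ∀ᵐ z ∂jump n s,
    ‖diff (fun x => (invSqrtCond γ x : ℂ)) z‖ ≤ lo⁻¹ * ‖diff (fun x => (mCond γ x : ℂ)) z‖ := by
  have h := sqrtCond_bounds hlo hbd
  filter_upwards [(quasiMeasurePreserving_snd_jump s).ae h,
    (quasiMeasurePreserving_add_jump s).ae h] with z h1 h2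
  rw [← diff_sqrtCond]
  have e : diff (fun x => (invSqrtCond γ x : ℂ)) z =
      (((sqrtCond γ z.2 * sqrtCond γ (z.2 + z.1))⁻¹ : ℝ) : ℂ) *
        -diff (fun x => (sqrtCond γ x : ℂ)) z := by
    have h3 : (sqrtCond γ z.2 : ℂ) ≠ 0 := by exact_mod_cast h1.2.2.ne'
    have h4 : (sqrtCond γ (z.2 + z.1) : ℂ) ≠ 0 := by exact_mod_cast h2.2.2.ne'
    have h5 (x : Rn n) : (invSqrtCond γ x : ℂ) = (sqrtCond γ x : ℂ)⁻¹ := by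
      rw [← Complex.ofReal_inv]
      rfl
    simp only [diff, h5]
    push_cast
    field_simp
    ring
  rw [e, norm_mul, norm_neg, Complex.norm_real]
  refine mul_le_mul_of_nonneg_right ?_ (norm_nonneg _)
  rw [Real.norm_of_nonneg (inv_nonneg.2 (mul_pos h1.2.2 h2.2.2).le)]
  refine inv_anti₀ hlo ?_
  rw [← Real.mul_self_sqrt hlo.le]
  exact mul_le_mul h1.1 h2.1 (Real.sqrt_nonneg _) h1.2.2.le

include hlo hbd in
theorem mulFun_sqrtCond_invSqrtCond (w : Rn n → ℂ) :
    mulFun (sqrtCond γ) (mulFun (invSqrtCond γ) w) =ᵐ[volume] w := by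
  filter_upwards [sqrtCond_bounds hlo hbd] with x hx
  have h1 : (sqrtCond γ x : ℂ) ≠ 0 := by exact_mod_cast hx.2.2.ne'
  have h5 : (invSqrtCond γ x : ℂ) = (sqrtCond γ x : ℂ)⁻¹ := by
    rw [← Complex.ofReal_inv]
    rfl
  rw [mulFun, mulFun, h5, mul_inv_cancel_left₀ h1]

include hs0 hs1 hsn hγ hlo hbd hL

theorem MemH.mulFun_sqrtCond {u : Rn n → ℂ} (hu : MemH s u) :
    MemH s (FracCond.mulFun (sqrtCond γ) u) :=
  MemH.mulFun (pos_of_two_mul_lt hs0 hsn) hs0 hs1 hsn hL (aesm_mCond hγ) (norm_mCond_le hlo hbd)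
    (aesm_sqrtCond hγ) (norm_sqrtCond_le hlo hbd) (K := 1)
    (.of_forall fun z => by rw [diff_sqrtCond, one_mul]) hu

theorem MemH.mulFun_invSqrtCond {u : Rn n → ℂ} (hu : MemH s u) :
    MemH s (FracCond.mulFun (invSqrtCond γ) u) :=
  MemH.mulFun (pos_of_two_mul_lt hs0 hsn) hs0 hs1 hsn hL (aesm_mCond hγ) (norm_mCond_le hlo hbd)
    (aesm_invSqrtCond hγ) (norm_invSqrtCond_le hlo hbd) (norm_diff_invSqrtCond_le hlo hbd s) hu

omit hL in
theorem memHNeg_condOp {u : Rn n → ℂ} (hu : MemH s u) : MemHNeg s (condOp s γ u) := by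
  have hn := pos_of_two_mul_lt hs0 hsn
  have hB := norm_sqrtCond_le hlo hbd
  have ham := aesm_sqrtCond hγ
  have hG : MemLp (fun z : Rn n × Rn n => (sqrtCond γ z.2 : ℂ) * (sqrtCond γ (z.2 + z.1) : ℂ) *
      diff u z) 2 (jump n s) := by
    refine (memLp_diff hn hs0 hs1 hu).of_le_mul (c := Real.sqrt hi * Real.sqrt hi)
      (((aesm_snd s ham).mul (aesm_add s ham)).mul (aesm_diff s hu.memLp.1)) ?_
    filter_upwards [(quasiMeasurePreserving_snd_jump s).ae hB,
      (quasiMeasurePreserving_add_jump s).ae hB] with z h1 h2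
    rw [norm_mul, norm_mul]
    gcongr
  exact memHNeg_integral_mul_diff hn hs0 hs1 (hG.const_mul ((fracConst n s / 2 : ℝ) : ℂ))
    fun φ _ => condOp_eq hs0 hs1 γ u φ

omit hs0 hs1 hsn in
theorem memLp_div_sqrtCond : MemLp (fun x => ((-L x / sqrtCond γ x : ℝ) : ℂ))
    (ENNReal.ofReal ((n : ℝ) / (2 * s))) volume := by
  have h1 := hL.1.ofReal (K := ℂ)
  refine h1.of_le_mul (c := (Real.sqrt lo)⁻¹) ?_ ?_
  · exact Complex.continuous_ofReal.comp_aestronglyMeasurable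
      (hL.1.1.neg.div₀ hγ.sqrt.aestronglyMeasurable)
  · filter_upwards [sqrtCond_bounds hlo hbd] with x hx
    have h0 : 0 < Real.sqrt lo := Real.sqrt_pos.2 hlo
    change ‖((-L x / sqrtCond γ x : ℝ) : ℂ)‖ ≤ _ * ‖((L x : ℝ) : ℂ)‖
    rw [Complex.norm_real, Complex.norm_real, norm_div, norm_neg, div_eq_inv_mul,
      Real.norm_of_nonneg hx.2.2.le]
    exact mul_le_mul_of_nonneg_right (inv_anti₀ h0 hx.1) (norm_nonneg _)

theorem memHNeg_schrodOp {w : Rn n → ℂ} (hw : MemH s w) :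
    (∀ φ, MemH s φ → Integrable fun x => ((-L x / sqrtCond γ x : ℝ) : ℂ) * w x * φ x) ∧
      MemHNeg s (schrodOp s (fun x => -L x / sqrtCond γ x) w) := by
  obtain ⟨h1, h2⟩ := memHNeg_integral_mul_mul hs0 hs1 hsn
    (memLp_div_sqrtCond hγ hlo hbd hL) hw
  exact ⟨h1, (memHNeg_fracLapH (pos_of_two_mul_lt hs0 hsn) hs0 hs1 hw).add h2⟩

omit hs0 hs1 hsn hγ hlo hbd hL in
theorem schrodOp_congr (s : ℝ) (q : Rn n → ℝ) {w w' φ φ' : Rn n → ℂ} (hw : w =ᵐ[volume] w')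
    (hφ : φ =ᵐ[volume] φ') : schrodOp s q w φ = schrodOp s q w' φ' := by
  rw [schrodOp, schrodOp, fracLapH, fracLapH, fourierL2_congr hw, fourierL2_congr hφ]
  congr 1
  refine integral_congr_ae ?_
  filter_upwards [hw, hφ] with x h1 h2
  rw [h1, h2]

/-- The Liouville reduction in weak form. -/
theorem condOp_eq_schrodOp {u φ : Rn n → ℂ} (hu : MemH s u) (hφ : MemH s φ) :
    condOp s γ u φ = schrodOp s (fun x => -L x / sqrtCond γ x) (mulFun (sqrtCond γ) u)
      (mulFun (sqrtCond γ) φ) := by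
  have hn := pos_of_two_mul_lt hs0 hsn
  have h22 := holderTriple_two
  have hC := fracConst_pos n hs0 hs1
  have hW := hu.mulFun_sqrtCond hs0 hs1 hsn hγ hlo hbd hL
  have hΨ := hφ.mulFun_sqrtCond hs0 hs1 hsn hγ hlo hbd hL
  set W := mulFun (sqrtCond γ) u with hWdef
  set Ψ := mulFun (sqrtCond γ) φ with hΨdef
  have i1 : Integrable (fun z => diff W z * diff Ψ z) (jump n s) :=
    memLp_one_iff_integrable.1 ((memLp_diff hn hs0 hs1 hΨ).mul' (memLp_diff hn hs0 hs1 hW))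
  have i2 := integrable_diff_mul_diff_mul hn hs0 hs1 hsn hL (aesm_mCond hγ)
    (norm_mCond_le hlo hbd) hW hφ
  have e1 : fracLapH s W Ψ = ((fracConst n s / 2 : ℝ) : ℂ) *
      ∫ z, diff W z * diff Ψ z ∂jump n s := by
    rw [integral_diff_mul_diff hn hs0 hs1 hW hΨ, ← mul_assoc, ← Complex.ofReal_mul,
      show (fracConst n s / 2 * (2 / fracConst n s) : ℝ) = 1 by field_simp, Complex.ofReal_one,
      one_mul]
  have e2 : ∫ x, ((-L x / sqrtCond γ x : ℝ) : ℂ) * W x * Ψ x =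
      -(((fracConst n s / 2 : ℝ) : ℂ) *
        ∫ z, diff (fun x => (mCond γ x : ℂ)) z * diff (fun x => W x * φ x) z ∂jump n s) := by
    rw [← integral_fracLap_mul_mul hn hs0 hs1 hsn hL (aesm_mCond hγ) (norm_mCond_le hlo hbd) hW hφ,
      ← integral_neg]
    refine integral_congr_ae ?_
    filter_upwards [sqrtCond_bounds hlo hbd] with x hx
    have h1 : (sqrtCond γ x : ℂ) ≠ 0 := by exact_mod_cast hx.2.2.ne'
    rw [hΨdef, mulFun]
    push_cast
    field_simp
  rw [condOp_eq hs0 hs1, schrodOp, e1, e2, ← sub_eq_add_neg, ← mul_sub, ← integral_sub i1 i2,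
    ← integral_const_mul]
  -- The algebraic core: a(x) a(x+h) δu δφ = δ(au) δ(aφ) - δa δ(auφ) with a = γ^{1/2}, where δa =
  -- δm. It holds at every pair of points.
  refine integral_congr_ae (.of_forall fun z => ?_)
  simp only [hWdef, hΨdef, mulFun, diff, mCond, Complex.ofReal_sub, Complex.ofReal_one]
  ring

end Conductivity

end FracCond

end

/-! ### The Liouville reduction -/

theorem theorem3p1 {n : ℕ} {s : ℝ} (hs0 : 0 < s) (hs1 : s < 1) (hsn : 2 * s < (n : ℝ))
    {p : ℝ≥0∞} [Fact (1 ≤ p)] (hp : p = ENNReal.ofReal ((n : ℝ) / (2 * s)))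
    {Ω : Set (Rn n)} (hΩ : IsOpen Ω) {γ : Rn n → ℝ} (hγ : Measurable γ)
    {lo hi : ℝ} (hlo : 0 < lo) (hbd : ∀ᵐ x ∂(volume : Measure (Rn n)), lo ≤ γ x ∧ γ x ≤ hi)
    (hm : FracCond.MemWc (2 * s) p Ω (fun x => (FracCond.mCond γ x : ℂ))) :
    -- the potential is well defined: `(-Δ)^s m` is a function in `L^p`
    FracCond.IsFracLap s p (FracCond.mCond γ) (FracCond.fracLapW s p (FracCond.mCond γ)) ∧
    -- all terms of the two equations are well defined
    (∀ u : Rn n → ℂ, FracCond.MemH s u →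
      MemLp (FracCond.flux s γ u) 2 volume ∧
      FracCond.MemHNeg s (FracCond.condOp s γ u) ∧
      FracCond.MemH s (FracCond.mulFun (FracCond.sqrtCond γ) u) ∧
      FracCond.MemH s (FracCond.mulFun (FracCond.invSqrtCond γ) u) ∧
      (∀ φ : Rn n → ℂ, FracCond.MemH s φ →
        Integrable (fun x => (FracCond.potential s p γ x : ℂ) * u x * φ x) volume) ∧
      FracCond.MemHNeg s (FracCond.schrodOp s (FracCond.potential s p γ) u)) ∧
    -- the equivalence of the two exterior value problems
    (∀ u g : Rn n → ℂ, FracCond.MemH s u → FracCond.MemHOn s (FracCond.exterior Ω) g →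
      FracCond.MemHOn s (FracCond.exterior Ω) (FracCond.mulFun (FracCond.sqrtCond γ) g) ∧
      (FracCond.SolvesCond s γ Ω u g ↔
        FracCond.SolvesSchrod s (FracCond.potential s p γ) Ω
          (FracCond.mulFun (FracCond.sqrtCond γ) u)
          (FracCond.mulFun (FracCond.sqrtCond γ) g))) ∧
    -- the identity `C_γ^s (γ^{-1/2} w) = γ^{1/2} ((-Δ)^s + q) w` in `H^{-s}`
    (∀ w : Rn n → ℂ, FracCond.MemH s w → ∀ φ : Rn n → ℂ, FracCond.MemH s φ →
      FracCond.condOp s γ (FracCond.mulFun (FracCond.invSqrtCond γ) w) φ =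
        FracCond.mulDual (FracCond.sqrtCond γ)
          (FracCond.schrodOp s (FracCond.potential s p γ) w) φ) := by
  subst hp
  have hn := FracCond.pos_of_two_mul_lt hs0 hsn
  -- Since (-Δ)^s m exists in L^p, the default value 0 in `fracLapW` does not occur.
  have hL : FracCond.IsFracLap s (ENNReal.ofReal ((n : ℝ) / (2 * s))) (FracCond.mCond γ)
      (FracCond.fracLapW s (ENNReal.ofReal ((n : ℝ) / (2 * s))) (FracCond.mCond γ)) := by
    have h := FracCond.exists_isFracLap hs0 hs1 hsn rfl hm.1
    rw [FracCond.fracLapW, dif_pos h]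
    exact h.choose_spec
  have hmul {u : Rn n → ℂ} (hu : FracCond.MemH s u) :=
    FracCond.MemH.mulFun_sqrtCond hs0 hs1 hsn hγ hlo hbd hL hu
  have hinv {u : Rn n → ℂ} (hu : FracCond.MemH s u) :=
    FracCond.MemH.mulFun_invSqrtCond hs0 hs1 hsn hγ hlo hbd hL hu
  have hcond {u φ : Rn n → ℂ} (hu : FracCond.MemH s u) (hφ : FracCond.MemH s φ) :
      FracCond.condOp s γ u φ = FracCond.schrodOp s (FracCond.potential s _ γ)
        (FracCond.mulFun (FracCond.sqrtCond γ) u) (FracCond.mulFun (FracCond.sqrtCond γ) φ) :=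
    FracCond.condOp_eq_schrodOp hs0 hs1 hsn hγ hlo hbd hL hu hφ
  have hcancel := FracCond.mulFun_sqrtCond_invSqrtCond (n := n) hlo hbd
  have hC {u : Rn n → ℂ} (hu : FracCond.MemH s u) :=
    FracCond.memHNeg_condOp hs0 hs1 hsn hγ hlo hbd hu
  have hS {w : Rn n → ℂ} (hw : FracCond.MemH s w) :=
    FracCond.memHNeg_schrodOp hs0 hs1 hsn hγ hlo hbd hL hw
  -- The product of a with a test function keeps its compact support in Ω, and only its membership
  -- in H^s has to be supplied.
  have hvanish (a : Rn n → ℝ) {T : (Rn n → ℂ) → ℂ} (hT : FracCond.MemHNeg s T)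
      (hTΩ : FracCond.VanishesIn Ω T) {φ : 𝓢(Rn n, ℂ)} (hφ : FracCond.IsTest Ω φ)
      (haφ : FracCond.MemH s (FracCond.mulFun a φ)) : T (FracCond.mulFun a φ) = 0 :=
    FracCond.MemHNeg.eq_zero_of_vanishesIn hn hs0 hs1 hT hΩ hTΩ hφ.1 hφ.2 haφ fun x hx => by
      rw [FracCond.mulFun, image_eq_zero_of_notMem_tsupport hx, mul_zero]
  refine ⟨hL, fun u hu => ⟨?_, hC hu, hmul hu, hinv hu, (hS hu).1, (hS hu).2⟩,
    fun u g hu hg => ⟨?_, ?_⟩, fun w hw φ hφ => ?_⟩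
  · exact FracCond.memLp_flux hn hs0 hs1 hγ (FracCond.norm_sqrtCond_le hlo hbd) hu
  · obtain ⟨v, hv, hgv⟩ := hg
    refine ⟨_, hmul hv, ?_⟩
    filter_upwards [hgv] with x hx
    rw [FracCond.mulFun, FracCond.mulFun, hx]
  · refine and_congr ⟨fun h φ hφ => ?_, fun h φ hφ => ?_⟩ ⟨fun h => ?_, fun h => ?_⟩
    · have hφ' := FracCond.memH_schwartz s φ
      -- Write φ = γ^{1/2}(γ^{-1/2}φ): the Schrödinger side tested with φ is the conductivity side
      -- tested with γ^{-1/2}φ.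
      rw [← FracCond.schrodOp_congr s _ Filter.EventuallyEq.rfl (hcancel φ), ← hcond hu (hinv hφ')]
      exact hvanish _ (hC hu) h hφ (hinv hφ')
    · have hφ' := FracCond.memH_schwartz s φ
      rw [hcond hu hφ']
      exact hvanish _ (hS (hmul hu)).2 h hφ (hmul hφ')
    · filter_upwards [h] with x hx
      rw [FracCond.mulFun, FracCond.mulFun, hx]
    · filter_upwards [h, ae_restrict_of_ae (FracCond.sqrtCond_bounds hlo hbd)] with x hx h1
      exact mul_left_cancel₀ (Complex.ofReal_ne_zero.2 h1.2.2.ne') hx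
  -- The weak identity for u = γ^{-1/2}w, where γ^{1/2}u = w almost everywhere.
  · rw [hcond (hinv hw) hφ]
    exact FracCond.schrodOp_congr s _ (hcancel w) Filter.EventuallyEq.rfl
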